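/- **Setting.** Let $0<d<2$, $t\in[0,1]$, let $\ell\ge 1$ be a fixed integer, and let $M=M(n)$, $M'=M'(n)$ be non-negative integers with $M/n\to td/2$ and $M'/n\to(1-t)d/2$ as $n\to\infty$. *Correlated formulas.* Let $\boldsymbol a_1,\dots,\boldsymbol a_M,\boldsymbol a_1',\dots,\boldsymbol a_{M'}',\boldsymbol a_1'',\dots,\boldsymbol a_{M'}''$ be independent and uniform among the $4\binom n2$ clauses with two distinct variables from $V_n=\{x_1,\dots,x_n\}$. Let $\Phi_1=\boldsymbol a_1\wedge\dots\wedge\boldsymbol a_M\wedge\boldsymbol a'_1\wedge\dots\wedge\boldsymbol a'_{M'}$ and $\Phi_2=\boldsymbol a_1\wedge\dots\wedge\boldsymbol a_M\wedge\boldsymbol a''_1\wedge\dots\wedge\boldsymbol a''_{M'}$. The first $M$ clauses are called shared; clauses with different names count as different even if they contain the same literals. *Pruning.* For a 2-CNF $\Phi$ and a literal $l_0$, let $\mathcal L(\Phi,l_0)$ be the smallest set of literals that contains $l_0$ and that contains $l$ whenever $\Phi$ has a clause $l\vee\neg l'$ with $l'\in\mathcal L(\Phi,l_0)$. The pruned formula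 $\hat\Phi$ is obtained from $\Phi$ by removing, for every literal $l_0$, all clauses all of whose variables $x$ satisfy $x,\neg x\in\mathcal L(\Phi,l_0)$. *Tree.* $\boldsymbol T^\otimes=\boldsymbol T^\otimes_{d,t}$ is the multitype Galton–Watson tree whose root $o$ is a shared variable and in which, independently for all $s,s'\in\{\pm1\}$ and $h\in\{1,2\}$, a shared variable has $\mathrm{Po}(dt/4)$ shared child clauses of type $(s,s')$ and $\mathrm{Po}(d(1-t)/4)$ $h$-distinct child clauses of type $(s,s')$; an $h$-distinct variable has $\mathrm{Po}(d/4)$ $h$-distinct child clauses of type $(s,s')$; and every clause has exactly one child, a variable that is shared or $h$-distinct like the clause. In a clause of type $(s,s')$ the parent variable appears with sign $s$ and the child variable with sign $s'$. Let $\boldsymbol T^{\otimes,(2\ell)}$ be the tree of all nodes at distance at most $2\ell$ from $o$. A possible outcome of $\boldsymbol T^{\otimes,(2\ell)}$ is a tree $T$ with $\mathbb P[\boldsymbol T^{\otimes,(2\ell)}\cong T]>0$, where $\cong$ denotes isomorphism preserving the root and all types of variables and clauses. Let $T_h$ be the 2-CNF obtained from $T$ by deleting all $(3-h)$-distinct variables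 and clauses. *Instances.* For a variable $x$ of a 2-CNF $\Phi$ let $\partial^{\le 2\ell}_{\Phi}x$ be the sub-formula of all variables and clauses at distance at most $2\ell$ from $x$ in the bipartite variable–clause incidence graph. A variable $x\in V_n$ is a $2\ell$-instance of $T$ in $(\hat\Phi_1,\hat\Phi_2)$ if there are isomorphisms $\iota_h$ of 2-CNFs (respecting signs) from $T_h$ to $\partial^{\le 2\ell}_{\hat\Phi_h}x$, $h=1,2$, such that - $\iota_1(o)=\iota_2(o)=x$; - $\iota_1(y)=\iota_2(y)$ for every shared variable $y$; - $\iota_1(a)=\iota_2(a)\in\{\boldsymbol a_1,\dots,\boldsymbol a_M\}$ for every shared clause $a$; - $\iota_1(a)\in\{\boldsymbol a'_1,\dots,\boldsymbol a'_{M'}\}$ for every $1$-distinct clause $a$ whose parent is shared; - $\iota_2(a)\in\{\boldsymbol a''_1,\dots,\boldsymbol a''_{M'}\}$ for every $2$-distinct clause $a$ whose parent is shared. Let $\boldsymbol N^{(2\ell)}(T)$ be the number of $2\ell$-instances of $T$ in $(\hat\Phi_1,\hat\Phi_2)$. **Proposition.** With high probability, for all possible outcomes $T$ of $\boldsymbol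 T^{\otimes,(2\ell)}$ we have $\boldsymbol N^{(2\ell)}(T)\sim n\,\mathbb P[\boldsymbol T^{\otimes,(2\ell)}\cong T]$. That is, there are events $E_n$ with $\mathbb P[E_n]\to1$ such that for every possible outcome $T$ and every $\varepsilon>0$ there is $n_0$ such that for all $n\ge n_0$, on $E_n$, $$\bigl|\boldsymbol N^{(2\ell)}(T)-n\,\mathbb P[\boldsymbol T^{\otimes,(2\ell)}\cong T]\bigr|\le\varepsilon\, n\,\mathbb P[\boldsymbol T^{\otimes,(2\ell)}\cong T].$$ -/

import Mathlib

open Filter Topology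
open scoped ENNReal NNReal

noncomputable section

/-! ### Boolean formulas -/

/-- A literal over the variables `V`: `(x, 1)` is `x` and `(x, -1)` is its negation. -/
abbrev Lit (V : Type) : Type := V × ℤˣ

/-- The negation of a literal. -/
def Lit.neg {V : Type} (l : Lit V) : Lit V := (l.1, -l.2)

/-- A CNF: a set of variables, a set of (names of) clauses, and for each clause the set of
literals that it contains. Distinct clauses may contain the same literals. -/
structure CNF (V A : Type) where
  vars : Set V
  clauses : Set A
  lits : A → Set (Lit V)

namespace CNF

variable {V A V' A' : Type}

/-- The incidence graph: a variable and a clause are adjacent if the variable appears in the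
clause. -/
def incidenceGraph (Φ : CNF V A) : SimpleGraph (V ⊕ A) :=
  SimpleGraph.fromRel fun u v =>
    ∃ x ∈ Φ.vars, ∃ a ∈ Φ.clauses, (∃ s : ℤˣ, (x, s) ∈ Φ.lits a) ∧ u = Sum.inl x ∧ v = Sum.inr a

/-- The sub-formula of all variables and clauses at distance at most `k` from the variable `x`. -/
def neighbourhood (Φ : CNF V A) (k : ℕ) (x : V) : CNF V A where
  vars := {y ∈ Φ.vars | Φ.incidenceGraph.edist (Sum.inl x) (Sum.inl y) ≤ k}
  clauses := {a ∈ Φ.clauses | Φ.incidenceGraph.edist (Sum.inl x) (Sum.inr a) ≤ k}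
  lits := Φ.lits

/-- An isomorphism of formulas: bijections of the variables and of the clauses that preserve
which variable appears in which clause with which sign. -/
structure Iso (Φ : CNF V A) (Ψ : CNF V' A') where
  onVars : Φ.vars ≃ Ψ.vars
  onClauses : Φ.clauses ≃ Ψ.clauses
  lits_iff : ∀ (a : Φ.clauses) (y : Φ.vars) (s : ℤˣ),
    ((y : V), s) ∈ Φ.lits a ↔ ((onVars y : V'), s) ∈ Ψ.lits (onClauses a)

/-- The set of literals that Unit Clause Propagation produces from the initial set `L₀`: while
there is a clause `l ∨ ¬ l'` such that `l'` has been added already, add `l`. -/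
inductive UCP (Φ : CNF V A) (L₀ : Set (Lit V)) : Lit V → Prop
  | init {l : Lit V} (hl : l ∈ L₀) : UCP Φ L₀ l
  | propagate {a : A} {l l' : Lit V} (ha : a ∈ Φ.clauses) (hal : Φ.lits a = {l, l'.neg})
      (hl' : UCP Φ L₀ l') : UCP Φ L₀ l

/-- The conflict clauses: the clauses all of whose variables `x` are such that both `x` and `¬ x`
are among the literals produced by Unit Clause Propagation. -/
def conflictClauses (Φ : CNF V A) (L₀ : Set (Lit V)) : Set A :=
  {a ∈ Φ.clauses | ∀ l ∈ Φ.lits a, Φ.UCP L₀ l ∧ Φ.UCP L₀ l.neg}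

/-- The pruned formula: remove all conflict clauses of all runs of Unit Clause Propagation that
start from a single literal. -/
def prune (Φ : CNF V A) : CNF V A where
  vars := Φ.vars
  clauses := Φ.clauses \ ⋃ l ∈ {l : Lit V | l.1 ∈ Φ.vars}, Φ.conflictClauses {l}
  lits := Φ.lits

end CNF

/-! ### The pair of correlated random formulas -/

/-- The `4 * n.choose 2` possible clauses with two distinct variables among `n` variables. -/
abbrev Clause (n : ℕ) : Type :=
  {c : Finset (Lit (Fin n)) // c.card = 2 ∧ (c.image Prod.fst).card = 2}

/-- Names of the clauses: `shared i` for the `M` shared clauses, and `distinct h i` for the `M'`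
clauses that appear in the formula with index `h` only. The two formulas have the indices
`0` and `1`. -/
inductive ClauseName (M M' : ℕ) : Type
  | shared (i : Fin M) : ClauseName M M'
  | distinct (h : Fin 2) (i : Fin M') : ClauseName M M'
  deriving DecidableEq, Fintype

/-- A realisation of the `M + 2 * M'` random clauses. -/
abbrev Sample (n M M' : ℕ) : Type := ClauseName M M' → Clause n

/-- The probability of an event under the uniform distribution on a finite type. For `Sample`
this means that all clauses are independent and uniformly random. -/
def uniformProb {Ω : Type} [Fintype Ω] (E : Set Ω) : ℝ := (E.ncard : ℝ) / Fintype.card Ω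

/-- The formula with index `h`: the conjunction of the shared and the `h`-distinct clauses. -/
def formula {n M M' : ℕ} (ω : Sample n M M') (h : Fin 2) : CNF (Fin n) (ClauseName M M') where
  vars := Set.univ
  clauses := {a | (∃ i, a = .shared i) ∨ ∃ i, a = .distinct h i}
  lits a := ↑(ω a).1

/-! ### The multitype Galton-Watson tree -/

/-- Classes of nodes of the tree: shared, or `h`-distinct (where `h` is `0` or `1`). -/
inductive NodeClass : Type
  | shared : NodeClass
  | distinct (h : Fin 2) : NodeClass
  deriving DecidableEq, Fintype

/-- The twelve types of clause nodes: the class, the sign of the parent variable and the sign of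
the child variable. -/
abbrev ClauseType : Type := NodeClass × ℤˣ × ℤˣ

/-- Trees with `ℓ` generations of clauses, i.e. of depth `2 * ℓ`. The root variable has, for each
clause type, a list of child clauses of that type. Each of these clauses has a single child
variable, whose class is that of the clause and from which a tree of depth `2 * (ℓ - 1)` is
pending. -/
def TypedTree : ℕ → Type
  | 0 => Unit
  | ℓ + 1 => ClauseType → List (TypedTree ℓ)

/-- Mean number of child clauses of type `c` of a variable of class `τ`. -/
def rate (d t : ℝ) (τ : NodeClass) (c : ClauseType) : ℝ :=
  match τ, c.1 with
  | .shared, .shared => d * t / 4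
  | .shared, .distinct _ => d * (1 - t) / 4
  | .distinct _, .shared => 0
  | .distinct h, .distinct h' => if h = h' then d / 4 else 0

theorem tsum_prod_fin {α : Type} (k : ℕ) (f : Fin k → α → ℝ≥0∞) :
    ∑' g : Fin k → α, ∏ i, f i (g i) = ∏ i, ∑' a, f i a := by
  induction k with
  | zero => simp
  | succ k ih =>
    rw [← (Fin.consEquiv fun _ : Fin (k + 1) => α).tsum_eq, ENNReal.tsum_prod', Fin.prod_univ_succ,
      ← ih fun i => f i.succ, ← ENNReal.tsum_mul_right]
    refine tsum_congr fun a => ?_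
    rw [← ENNReal.tsum_mul_left]
    refine tsum_congr fun g => ?_
    simp [Fin.consEquiv, Fin.prod_univ_succ]

theorem tsum_prod_fintype {ι α : Type} [Fintype ι] (f : ι → α → ℝ≥0∞) :
    ∑' g : ι → α, ∏ i, f i (g i) = ∏ i, ∑' a, f i a := by
  have e := Fintype.equivFin ι
  rw [← (Equiv.arrowCongr e.symm (Equiv.refl α)).tsum_eq, ← e.symm.prod_comp,
    ← tsum_prod_fin _ fun i => f (e.symm i)]
  refine tsum_congr fun g => ?_
  rw [← e.symm.prod_comp]
  simp

/-- The law of a family of independent random variables with laws `p i`. -/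
def independentFamily {ι α : Type} [Fintype ι] (p : ι → PMF α) : PMF (ι → α) :=
  ⟨fun g => ∏ i, p i (g i), by
    rw [ENNReal.summable.hasSum_iff, tsum_prod_fintype]
    simp [PMF.tsum_coe]⟩

/-- The law of a list of `k` independent samples from `p`. -/
def independentList {α : Type} (p : PMF α) : ℕ → PMF (List α)
  | 0 => PMF.pure []
  | k + 1 => p.bind fun a => (independentList p k).bind fun l => PMF.pure (a :: l)

/-- The law of the Galton-Watson tree with a root of class `τ`, truncated at depth `2 * ℓ`. The
numbers of child clauses of the different types are independent Poisson variables, and the trees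
pending from the grandchildren are independent Galton-Watson trees. -/
def galtonWatson (d t : ℝ) : (ℓ : ℕ) → NodeClass → PMF (TypedTree ℓ)
  | 0, _ => PMF.pure ()
  | ℓ + 1, τ => independentFamily fun c : ClauseType =>
      ((ProbabilityTheory.poissonMeasure (rate d t τ c).toNNReal).toPMF).bind fun k =>
        independentList (galtonWatson d t ℓ c.1) k

/-- Addresses of the variables of a tree. The root is `[]`; an entry `(c, i)` stands for the step
to the variable below the `i`-th child clause of type `c`. -/
abbrev Address : Type := List (ClauseType × ℕ)

/-- The class of a variable, given its address, when the root is a shared variable. -/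
def Address.nodeClass (v : Address) : NodeClass :=
  match v.getLast? with
  | none => .shared
  | some (c, _) => c.1

namespace TypedTree

/-- The addresses of the variables of a tree. -/
def nodes : (ℓ : ℕ) → TypedTree ℓ → Set Address
  | 0, _ => {[]}
  | ℓ + 1, T => {v | v = [] ∨ ∃ (c : ClauseType) (i : Fin (T c).length) (w : Address),
      w ∈ nodes ℓ ((T c).get i) ∧ v = (c, (i : ℕ)) :: w}

/-- The tree as a formula. Each clause has the same address as its child variable, so the addresses
of the clauses are those of the variables other than the root. The sign of the parent variable
and the sign of the child variable are given by the type of the clause. -/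
def toCNF {ℓ : ℕ} (T : TypedTree ℓ) : CNF Address Address where
  vars := nodes ℓ T
  clauses := nodes ℓ T \ {[]}
  lits v := match v.getLast? with
    | none => ∅
    | some ((_, s, s'), _) => {(v.dropLast, s), (v, s')}

/-- The formula obtained from the tree by deleting all `h'`-distinct variables and clauses
for `h' ≠ h`. -/
def part {ℓ : ℕ} (T : TypedTree ℓ) (h : Fin 2) : CNF Address Address where
  vars := {v ∈ T.toCNF.vars | ∀ h', h' ≠ h → v.nodeClass ≠ .distinct h'}
  clauses := {a ∈ T.toCNF.clauses | ∀ h', h' ≠ h → a.nodeClass ≠ .distinct h'}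
  lits := T.toCNF.lits

/-- Two trees are isomorphic if there is an isomorphism that preserves the root and the types of
all variables and clauses. -/
def Isomorphic {ℓ : ℕ} (T T' : TypedTree ℓ) : Prop :=
  ∃ ι : CNF.Iso T.toCNF T'.toCNF,
    (∀ v : T.toCNF.vars, (v : Address) = [] → (ι.onVars v : Address) = []) ∧
    (∀ v : T.toCNF.vars, Address.nodeClass (ι.onVars v) = Address.nodeClass v) ∧
    ∀ a : T.toCNF.clauses,
      (ι.onClauses a : Address).getLast?.map Prod.fst = (a : Address).getLast?.map Prod.fst

/-- The probability that the Galton-Watson tree with a shared root, truncated at depth `2 * ℓ`,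
is isomorphic to `T`. -/
def prob (d t : ℝ) {ℓ : ℕ} (T : TypedTree ℓ) : ℝ :=
  ((galtonWatson d t ℓ .shared).toOuterMeasure {T' | T'.Isomorphic T}).toReal

end TypedTree

/-- The variable `x` is a `2 * ℓ`-instance of the tree `T` in the pair of formulas `(Φ 0, Φ 1)`. -/
def IsInstance {n M M' ℓ : ℕ} (T : TypedTree ℓ) (Φ : Fin 2 → CNF (Fin n) (ClauseName M M'))
    (x : Fin n) : Prop :=
  ∃ ι : (h : Fin 2) → CNF.Iso (T.part h) ((Φ h).neighbourhood (2 * ℓ) x),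
    (∀ (h : Fin 2) (v : (T.part h).vars), (v : Address) = [] → ((ι h).onVars v : Fin n) = x) ∧
    (∀ (v : (T.part 0).vars) (w : (T.part 1).vars), (v : Address) = w →
      Address.nodeClass v = .shared → ((ι 0).onVars v : Fin n) = (ι 1).onVars w) ∧
    (∀ (a : (T.part 0).clauses) (b : (T.part 1).clauses), (a : Address) = b →
      Address.nodeClass a = .shared →
        ∃ i, ((ι 0).onClauses a : ClauseName M M') = .shared i ∧
          ((ι 1).onClauses b : ClauseName M M') = .shared i) ∧
    ∀ (h : Fin 2) (a : (T.part h).clauses), Address.nodeClass a = .distinct h →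
      Address.nodeClass (a : Address).dropLast = .shared →
        ∃ i, ((ι h).onClauses a : ClauseName M M') = .distinct h i

/-- The number of `2 * ℓ`-instances of `T` in the pair of pruned formulas. -/
def numInstances {n M M' ℓ : ℕ} (T : TypedTree ℓ) (ω : Sample n M M') : ℕ :=
  {x : Fin n | IsInstance T (fun h => (formula ω h).prune) x}.ncard

end

/-! Elements of `TypedTree ℓ` are plane trees. Such a tree is realized at a variable if the unpruned
formulas show it there, with siblings of the same type listed in increasing order of their clause
names and with no further clauses at the inner variables (those at depth less than `2 * ℓ`). The
ordering is then forced, so at most one plane tree is realized at a variable, and in at most one way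
(`realized_unique`, `realized_unique'`). Let Y_T be the fraction of variables at which T is realized
and p_T the Galton-Watson probability of T as a plane tree. The Y_T sum to at most 1, the p_T sum to
1.

The main point is that lower bounds suffice. Counting realizations of the disjoint union of two
trees gives E[Y_T Y_T'] ≥ p_T p_T' - o(1) (`Pattern.lowerBound_le`, `Pattern.tendsto_lowerBound`,
`Pattern.weight_sum`, `treePattern.weight_eq_galtonWatson`). Since the total mass is at most 1, no
term can exceed its lower bound by much, and Y_T is close to p_T in mean square (`mean_sq_sub_le`).
Overlapping trees and upper bounds on expectations never have to be treated.

Pruning removes a clause only if both its variables are conflicted. A conflicted variable lies on a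
lasso, that is, a chain of implications in which only the last variable is a repetition
(`Conflicted.exists_onLasso`). The expected number of lassos with k clauses is of order k (d/2)^k,
so for d < 2 the expected number of conflicted variables is bounded (`mean_conflicted_le`). Inner
variables of a realized tree have bounded degree, hence one conflicted variable spoils boundedly
many roots (`ncard_conflictedRoots_le`). An unspoiled realized tree survives pruning and is an
instance (`isInstance_of_realized`).

Summing over the plane trees isomorphic to `T` bounds the number of instances of `T` from below. For
the upper bound, a variable cannot be an instance of two non-isomorphic valid trees
(`IsInstance.isomorphic`), so the lower bounds for all other trees leave too few variables
(`abs_numInstances_sub_le`). A diagonal argument over the countably many trees and tolerances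
produces the events (`exists_events`). -/

noncomputable section

/-! ### Combinatorics of typed trees -/

namespace TypedTree

/-- The number of child clauses of type `c` of the variable with address `v`. -/
def deg : (ℓ : ℕ) → TypedTree ℓ → Address → ClauseType → ℕ
  | 0, _, _, _ => 0
  | _ + 1, T, [], c => (T c).length
  | ℓ + 1, T, (c, i) :: w, c' => if h : i < (T c).length then deg ℓ ((T c).get ⟨i, h⟩) w c' else 0

/-- The finite set of the addresses of the variables at depth less than `2 * ℓ`. -/
def innerFinset : (ℓ : ℕ) → TypedTree ℓ → Finset Address
  | 0, _ => ∅
  | ℓ + 1, T => insert [] (Finset.univ.biUnion fun c : ClauseType =>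
      Finset.univ.biUnion fun i : Fin (T c).length =>
        (innerFinset ℓ ((T c).get i)).image (List.cons (c, (i : ℕ))))

/-- The finite set of the addresses of the variables. -/
def nodeFinset : (ℓ : ℕ) → TypedTree ℓ → Finset Address
  | 0, _ => {[]}
  | ℓ + 1, T => insert [] (Finset.univ.biUnion fun c : ClauseType =>
      Finset.univ.biUnion fun i : Fin (T c).length =>
        (nodeFinset ℓ ((T c).get i)).image (List.cons (c, (i : ℕ))))

theorem mem_nodeFinset : ∀ {ℓ : ℕ} {T : TypedTree ℓ} {v : Address},
    v ∈ nodeFinset ℓ T ↔ v ∈ nodes ℓ T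
  | 0, _, _ => by simp [nodeFinset, nodes]
  | ℓ + 1, T, v => by
    simp only [nodeFinset, nodes, Finset.mem_insert, Finset.mem_biUnion, Finset.mem_univ, true_and,
      Finset.mem_image, Set.mem_ofPred_eq, mem_nodeFinset (ℓ := ℓ)]
    simp only [eq_comm]

theorem nil_mem_nodes : ∀ {ℓ : ℕ} (T : TypedTree ℓ), [] ∈ nodes ℓ T
  | 0, _ => rfl
  | _ + 1, _ => Or.inl rfl

theorem cons_mem_nodes {ℓ : ℕ} {T : TypedTree (ℓ + 1)} {c : ClauseType} {i : ℕ} {w : Address} :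
    (c, i) :: w ∈ nodes (ℓ + 1) T ↔ ∃ h : i < (T c).length, w ∈ nodes ℓ ((T c).get ⟨i, h⟩) := by
  constructor
  · rintro (h | ⟨c', j, w', hw, h⟩)
    · cases h
    · simp only [List.cons.injEq, Prod.mk.injEq] at h
      obtain ⟨⟨rfl, rfl⟩, rfl⟩ := h
      exact ⟨j.2, hw⟩
  · rintro ⟨h, hw⟩
    exact Or.inr ⟨c, ⟨i, h⟩, w, hw, rfl⟩

theorem mem_innerFinset : ∀ {ℓ : ℕ} {T : TypedTree ℓ} {v : Address},
    v ∈ innerFinset ℓ T ↔ v ∈ nodes ℓ T ∧ v.length < ℓ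
  | 0, _, _ => by simp [innerFinset]
  | ℓ + 1, T, [] => by simp [innerFinset, nil_mem_nodes]
  | ℓ + 1, T, (c, i) :: w => by
    rw [cons_mem_nodes]
    simp only [innerFinset, Finset.mem_insert, Finset.mem_biUnion, Finset.mem_univ, true_and,
      Finset.mem_image, mem_innerFinset (ℓ := ℓ), List.length_cons, List.cons.injEq, Prod.mk.injEq,
      reduceCtorEq, false_or, add_lt_add_iff_right]
    constructor
    · rintro ⟨c', j, w', ⟨h1, h2⟩, ⟨rfl, rfl⟩, rfl⟩
      exact ⟨⟨j.2, h1⟩, h2⟩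
    · rintro ⟨⟨h, h1⟩, h2⟩
      exact ⟨c, ⟨i, h⟩, w, ⟨h1, h2⟩, ⟨rfl, rfl⟩, rfl⟩

theorem length_le_of_mem_nodes : ∀ {ℓ : ℕ} {T : TypedTree ℓ} {v : Address},
    v ∈ nodes ℓ T → v.length ≤ ℓ
  | 0, _, _, h => by rw [Set.mem_singleton_iff.1 h]; rfl
  | _ + 1, _, [], _ => by simp
  | ℓ + 1, T, (c, i) :: w, h => by
    obtain ⟨_, hw⟩ := cons_mem_nodes.1 h
    simpa using length_le_of_mem_nodes hw

theorem append_mem_nodes : ∀ {ℓ : ℕ} {T : TypedTree ℓ} {v : Address} {c : ClauseType} {i : ℕ},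
    v ++ [(c, i)] ∈ nodes ℓ T ↔ v ∈ nodes ℓ T ∧ i < deg ℓ T v c
  | 0, _, v, _, _ => by simp [nodes, deg]
  | ℓ + 1, T, [], c, i => by
    rw [List.nil_append, cons_mem_nodes]
    simp [deg, nil_mem_nodes]
  | ℓ + 1, T, (c', j) :: w, c, i => by
    rw [List.cons_append, cons_mem_nodes, cons_mem_nodes]
    by_cases h : j < (T c').length
    · simp only [h, exists_true_left, deg, dite_true]
      exact append_mem_nodes
    · simp [h]

theorem mem_nodes_of_append {ℓ : ℕ} {T : TypedTree ℓ} {v : Address} {e : ClauseType × ℕ}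
    (h : v ++ [e] ∈ nodes ℓ T) : v ∈ nodes ℓ T :=
  (append_mem_nodes.1 h).1

theorem length_lt_of_append {ℓ : ℕ} {T : TypedTree ℓ} {v : Address} {e : ClauseType × ℕ}
    (h : v ++ [e] ∈ nodes ℓ T) : v.length < ℓ := by
  simpa using length_le_of_mem_nodes h

/-- Two realized trees are compared through their address sets, address by address. The numbers of
children of the root can be read off from the addresses with one entry. -/
theorem nodes_injective : ∀ {ℓ : ℕ}, Function.Injective (nodes ℓ)
  | 0, _, _, _ => rfl
  | ℓ + 1, T, T', h => by
    have hl : ∀ c, (T c).length = (T' c).length := by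
      have key : ∀ (T : TypedTree (ℓ + 1)) c i, i < (T c).length ↔ [(c, i)] ∈ nodes (ℓ + 1) T := by
        intro T c i
        rw [cons_mem_nodes]
        simp [nil_mem_nodes]
      intro c
      refine le_antisymm ?_ ?_ <;> by_contra! hlt
      · have := (key T c _).1 hlt
        rw [h, ← key] at this
        exact lt_irrefl _ this
      · have := (key T' c _).1 hlt
        rw [← h, ← key] at this
        exact lt_irrefl _ this
    funext c
    refine List.ext_get (hl c) fun i h1 h2 => nodes_injective (Set.ext fun w => ?_)
    have := Set.ext_iff.1 h ((c, i) :: w)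
    simpa [cons_mem_nodes, h1, h2] using this

/-- The final diagonal argument avoids one bad event per tree and tolerance, so it needs countably
many trees. -/
instance instCountable : ∀ ℓ, Countable (TypedTree ℓ)
  | 0 => inferInstanceAs (Countable Unit)
  | ℓ + 1 =>
    have := instCountable ℓ
    inferInstanceAs (Countable (ClauseType → List (TypedTree ℓ)))

end TypedTree

/-- The class of a variable, given its address, when the root has class `τ`. -/
def Address.classFrom (τ : NodeClass) (v : Address) : NodeClass :=
  match v.getLast? with
  | none => τ
  | some (c, _) => c.1

theorem Address.classFrom_append (τ : NodeClass) (v : Address) (e : ClauseType × ℕ) :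
    Address.classFrom τ (v ++ [e]) = e.1.1 := by
  simp [Address.classFrom]

theorem Address.classFrom_cons (τ : NodeClass) (v : Address) (e : ClauseType × ℕ) :
    Address.classFrom τ (e :: v) = Address.classFrom e.1.1 v := by
  rcases List.eq_nil_or_concat v with rfl | ⟨w, e', rfl⟩
  · rfl
  · rw [List.concat_eq_append, ← List.cons_append, Address.classFrom_append,
      Address.classFrom_append]

theorem Address.nodeClass_append (v : Address) (e : ClauseType × ℕ) :
    Address.nodeClass (v ++ [e]) = e.1.1 := by
  simp [Address.nodeClass]

theorem Address.classFrom_shared (v : Address) : Address.classFrom .shared v = v.nodeClass := rfl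

/-! ### The law of the Galton-Watson tree -/

theorem independentFamily_apply {ι α : Type} [Fintype ι] (p : ι → PMF α) (g : ι → α) :
    independentFamily p g = ∏ i, p i (g i) := rfl

theorem independentList_apply {α : Type} (p : PMF α) : ∀ (k : ℕ) (l : List α),
    independentList p k l = if l.length = k then ∏ i : Fin l.length, p (l.get i) else 0
  | 0, l => by
    rw [independentList, PMF.pure_apply]
    rcases l with _ | ⟨a, l⟩ <;> simp
  | k + 1, [] => by
    rw [independentList, PMF.bind_apply]
    simp
  | k + 1, b :: l => by
    rw [independentList, PMF.bind_apply, tsum_eq_single b]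
    · rw [PMF.bind_apply, tsum_eq_single l]
      · rw [PMF.pure_apply, if_pos rfl, mul_one, independentList_apply p k l]
        by_cases h : l.length = k
        · simp only [h, List.length_cons, if_true]
          rw [Fin.prod_univ_succ]
          simp
        · simp [h]
      · intro l' hl'
        rw [PMF.pure_apply, if_neg (by simpa using hl'.symm), mul_zero]
    · intro a ha
      rw [PMF.bind_apply, ENNReal.tsum_eq_zero.2, mul_zero]
      intro l'
      rw [PMF.pure_apply, if_neg (by simp [ha.symm]), mul_zero]

/-- The probability that a variable of class `τ` has `k c` child clauses of each type `c`. -/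
def offspringWeight (d t : ℝ) (τ : NodeClass) (k : ClauseType → ℕ) : ℝ≥0∞ :=
  ∏ c, (ProbabilityTheory.poissonMeasure (rate d t τ c).toNNReal).toPMF (k c)

theorem galtonWatson_succ_apply (d t : ℝ) (ℓ : ℕ) (τ : NodeClass) (T : TypedTree (ℓ + 1)) :
    galtonWatson d t (ℓ + 1) τ T = offspringWeight d t τ (fun c => (T c).length) *
      ∏ c, ∏ i : Fin (T c).length, galtonWatson d t ℓ c.1 ((T c).get i) := by
  rw [offspringWeight, ← Finset.prod_mul_distrib, galtonWatson]
  refine (independentFamily_apply _ _).trans (Finset.prod_congr rfl fun c _ => ?_)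
  rw [PMF.bind_apply, tsum_eq_single (T c).length]
  · rw [independentList_apply, if_pos rfl]
  · intro k hk
    rw [independentList_apply, if_neg hk.symm, mul_zero]

/-- The recursion unfolds into one offspring factor per inner variable; the last generation carries
none, because its children are not revealed. In this form the law can be compared with the limit of
the expected counts. -/
theorem galtonWatson_apply (d t : ℝ) : ∀ (ℓ : ℕ) (τ : NodeClass) (T : TypedTree ℓ),
    galtonWatson d t ℓ τ T =
      ∏ v ∈ T.innerFinset, offspringWeight d t (v.classFrom τ) (T.deg ℓ v)
  | 0, _, T => by
    exact ((PMF.pure_apply (α := Unit) () T).trans (if_pos rfl)).trans Finset.prod_empty.symm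
  | ℓ + 1, τ, T => by
    rw [galtonWatson_succ_apply, TypedTree.innerFinset, Finset.prod_insert, Finset.prod_biUnion]
    · congr 1
      refine Finset.prod_congr rfl fun c _ => ?_
      rw [Finset.prod_biUnion]
      · refine Finset.prod_congr rfl fun i _ => ?_
        rw [Finset.prod_image, galtonWatson_apply d t ℓ]
        · refine Finset.prod_congr rfl fun w _ => ?_
          rw [Address.classFrom_cons]
          congr 1
          funext c'
          simp [TypedTree.deg]
        · intro a _ b _ h
          exact (List.cons.inj h).2
      · intro i _ j _ hij
        rw [Function.onFun, Finset.disjoint_left]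
        intro v hv hv'
        simp only [Finset.mem_image] at hv hv'
        obtain ⟨w, -, rfl⟩ := hv
        obtain ⟨w', -, h⟩ := hv'
        exact hij (Fin.ext (congrArg Prod.snd (List.cons.inj h).1).symm)
    · intro c _ c' _ hc
      rw [Function.onFun, Finset.disjoint_left]
      intro v hv hv'
      simp only [Finset.mem_biUnion, Finset.mem_univ, true_and, Finset.mem_image] at hv hv'
      obtain ⟨i, w, -, rfl⟩ := hv
      obtain ⟨i', w', -, h⟩ := hv'
      exact hc (congrArg Prod.fst (List.cons.inj h).1).symm
    · simp

theorem rate_nonneg {d t : ℝ} (hd : 0 ≤ d) (ht0 : 0 ≤ t) (ht1 : t ≤ 1) (τ : NodeClass)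
    (c : ClauseType) : 0 ≤ rate d t τ c := by
  have : 0 ≤ 1 - t := by linarith
  unfold rate
  split
  · positivity
  · positivity
  · exact le_rfl
  · split_ifs <;> positivity

theorem offspringWeight_toReal {d t : ℝ} (hd : 0 ≤ d) (ht0 : 0 ≤ t) (ht1 : t ≤ 1) (τ : NodeClass)
    (k : ClauseType → ℕ) : (offspringWeight d t τ k).toReal =
      ∏ c, (Real.exp (-rate d t τ c) * rate d t τ c ^ k c / (k c).factorial) := by
  rw [offspringWeight, ENNReal.toReal_prod]
  refine Finset.prod_congr rfl fun c _ => ?_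
  rw [MeasureTheory.Measure.toPMF_apply, ← MeasureTheory.measureReal_def,
    ProbabilityTheory.poissonMeasure_real_singleton, Real.coe_toNNReal _ (rate_nonneg hd ht0 ht1 τ c)]

/-- The classes of the variables of a tree are as in a Galton-Watson tree: children of
`h`-distinct variables are `h`-distinct. -/
def TypedTree.Valid {ℓ : ℕ} (T : TypedTree ℓ) : Prop :=
  ∀ (v : Address) (e : ClauseType × ℕ), v ++ [e] ∈ T.nodes → Address.nodeClass v = .shared ∨ Address.nodeClass v = e.1.1

/-- A child of forbidden class would contribute a factor `0 ^ k` with `k ≥ 1` to the probability. -/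
theorem valid_of_galtonWatson {d t : ℝ} (hd : 0 ≤ d) (ht0 : 0 ≤ t) (ht1 : t ≤ 1) {ℓ : ℕ}
    {T : TypedTree ℓ} (h : galtonWatson d t ℓ .shared T ≠ 0) : T.Valid := by
  rintro v ⟨c, i⟩ hv
  rw [galtonWatson_apply, Finset.prod_ne_zero_iff] at h
  have h1 := h v (TypedTree.mem_innerFinset.2
    ⟨TypedTree.mem_nodes_of_append hv, TypedTree.length_lt_of_append hv⟩)
  have h2 := (TypedTree.append_mem_nodes.1 hv).2
  have h3 : (offspringWeight d t (v.classFrom .shared) (T.deg ℓ v)).toReal ≠ 0 := by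
    refine ENNReal.toReal_ne_zero.2 ⟨h1, ?_⟩
    exact ENNReal.prod_ne_top fun c _ => PMF.apply_ne_top _ _
  rw [offspringWeight_toReal hd ht0 ht1, Finset.prod_ne_zero_iff] at h3
  have h4 := h3 c (Finset.mem_univ _)
  have h5 : rate d t v.nodeClass c ≠ 0 := by
    intro h0
    rw [Address.classFrom_shared, h0, zero_pow (by omega)] at h4
    simp at h4
  by_contra! hcon
  apply h5
  obtain ⟨ha, hb⟩ := hcon
  unfold rate
  revert ha hb
  cases v.nodeClass with
  | shared => simp
  | distinct k =>
    rcases hc : c.1 with _ | k'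
    · simp
    · simp only [ne_eq, NodeClass.distinct.injEq]
      intro _ hne
      rw [if_neg hne]

end

noncomputable section

/-! ### Patterns in the random clauses -/

/-- The class of the variable that is reached from a variable of class `τ` through the clause `a`,
if this clause belongs to the formulas that contain variables of class `τ`. -/
def childClass {M M' : ℕ} : NodeClass → ClauseName M M' → Option NodeClass
  | .shared, .shared _ => some .shared
  | .shared, .distinct h _ => some (.distinct h)
  | .distinct h, .shared _ => some (.distinct h)
  | .distinct h, .distinct h' _ => if h = h' then some (.distinct h) else none

/-- The variables of class `τ` belong to the formula with index `h`. -/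
def NodeClass.InPart (h : Fin 2) (τ : NodeClass) : Prop := τ = .shared ∨ τ = .distinct h

theorem NodeClass.inPart_iff {h : Fin 2} {τ : NodeClass} :
    τ.InPart h ↔ ∀ h', h' ≠ h → τ ≠ .distinct h' := by
  rcases τ with _ | k
  · simp [InPart]
  · simp only [InPart, reduceCtorEq, NodeClass.distinct.injEq, false_or, ne_eq]
    constructor
    · rintro rfl h' hh rfl
      exact hh rfl
    · intro H
      by_contra hk
      exact H k hk rfl

/-- The class of a tree clause is not the kind of its name: from an `h`-distinct variable, a clause
with a shared name also leads to an `h`-distinct variable. -/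
theorem childClass_of_mem {n M M' : ℕ} {ω : Sample n M M'} {h : Fin 2} {τ : NodeClass}
    {a : ClauseName M M'} (hτ : τ.InPart h) (ha : a ∈ (formula ω h).clauses) :
    ∃ σ, childClass τ a = some σ ∧ σ.InPart h := by
  rcases hτ with rfl | rfl <;> rcases ha with ⟨i, rfl⟩ | ⟨i, rfl⟩ <;>
    simp [childClass, NodeClass.InPart]

theorem mem_of_childClass {n M M' : ℕ} {ω : Sample n M M'} {h : Fin 2} {τ σ : NodeClass}
    {a : ClauseName M M'} (hc : childClass τ a = some σ) (hσ : σ.InPart h) :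
    τ.InPart h ∧ a ∈ (formula ω h).clauses := by
  rcases τ with _ | k <;> rcases a with i | ⟨k', i⟩ <;> simp only [childClass] at hc
  · exact ⟨Or.inl rfl, Or.inl ⟨i, rfl⟩⟩
  · obtain rfl := Option.some_injective _ hc
    rcases hσ with h1 | h1
    · cases h1
    · cases h1
      exact ⟨Or.inl rfl, Or.inr ⟨i, rfl⟩⟩
  · obtain rfl := Option.some_injective _ hc
    exact ⟨hσ, Or.inl ⟨i, rfl⟩⟩
  · split_ifs at hc with hk
    subst hk
    obtain rfl := Option.some_injective _ hc
    rcases hσ with h1 | h1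
    · cases h1
    · cases h1
      exact ⟨Or.inr rfl, Or.inr ⟨i, rfl⟩⟩

/-- A numbering of the names of the clauses. -/
def nameRank {M M' : ℕ} (a : ClauseName M M') : ℕ := Fintype.equivFin _ a

theorem nameRank_injective {M M' : ℕ} : Function.Injective (nameRank (M := M) (M' := M')) :=
  fun _ _ h => (Fintype.equivFin _).injective (Fin.ext h)

/-- The shape of a forest of variables: `V` is the set of variables, `S` is the set of clauses,
every clause `s` joins its parent variable `par s` to its child variable `child s`. -/
structure Pattern where
  V : Type
  S : Type
  fintypeV : Fintype V
  fintypeS : Fintype S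
  decidableEqV : DecidableEq V
  decidableEqS : DecidableEq S
  par : S → V
  child : S → V
  typ : S → ClauseType
  idx : S → ℕ
  cls : V → NodeClass
  inner : Finset V
  child_ne_par : ∀ s, child s ≠ par s
  idx_injective : ∀ s s', par s = par s' → typ s = typ s' → idx s = idx s' → s = s'

namespace Pattern

attribute [instance] Pattern.fintypeV Pattern.fintypeS Pattern.decidableEqV Pattern.decidableEqS

/-- The clauses are matched to names that are compatible with their classes, and siblings of the
same type are matched in increasing order. -/
structure Sorted (P : Pattern) {M M' : ℕ} (g : P.S → ClauseName M M') : Prop where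
  injective : Function.Injective g
  compatible : ∀ s, childClass (P.cls (P.par s)) (g s) = some (P.typ s).1
  increasing : ∀ s s', P.par s = P.par s' → P.typ s = P.typ s' → P.idx s < P.idx s' →
    nameRank (g s) < nameRank (g s')

/-- The pattern is realized by the variables `f` and the clauses `g`: the clauses contain the
literals that the pattern prescribes, and no other clauses of the respective formulas contain
the inner variables. -/
structure Realized (P : Pattern) {n M M' : ℕ} (ω : Sample n M M') (f : P.V → Fin n)
    (g : P.S → ClauseName M M') : Prop where
  injective : Function.Injective f
  sorted : P.Sorted g
  lits_eq : ∀ s, (ω (g s)).1 = {(f (P.par s), (P.typ s).2.1), (f (P.child s), (P.typ s).2.2)}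
  avoid : ∀ a ∉ Set.range g, ∀ v ∈ P.inner, childClass (P.cls v) a ≠ none →
    ∀ s, (f v, s) ∉ (ω a).1

theorem Realized.mem_lits_iff {P : Pattern} {n M M' : ℕ} {ω : Sample n M M'} {f : P.V → Fin n}
    {g : P.S → ClauseName M M'} (H : P.Realized ω f g) {s : P.S} {l : Lit (Fin n)} :
    l ∈ (ω (g s)).1 ↔
      l = (f (P.par s), (P.typ s).2.1) ∨ l = (f (P.child s), (P.typ s).2.2) := by
  rw [H.lits_eq, Finset.mem_insert, Finset.mem_singleton]

/-- This is `avoid` in positive form: around an inner variable the relevant formulas contain the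
clauses of the pattern only. -/
theorem Realized.exists_of_mem {P : Pattern} {n M M' : ℕ} {ω : Sample n M M'} {f : P.V → Fin n}
    {g : P.S → ClauseName M M'} (H : P.Realized ω f g) {a : ClauseName M M'} {v : P.V}
    (hv : v ∈ P.inner) (ha : childClass (P.cls v) a ≠ none) {e : ℤˣ} (he : (f v, e) ∈ (ω a).1) :
    ∃ s, g s = a ∧ (v = P.par s ∧ e = (P.typ s).2.1 ∨ v = P.child s ∧ e = (P.typ s).2.2) := by
  by_cases hr : a ∈ Set.range g
  · obtain ⟨s, rfl⟩ := hr
    refine ⟨s, rfl, ?_⟩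
    rw [H.mem_lits_iff] at he
    simpa [H.injective.eq_iff] using he
  · exact absurd he (H.avoid a hr v hv ha e)

end Pattern

/-- The pattern of a tree. -/
def treePattern {ℓ : ℕ} (T : TypedTree ℓ) : Pattern where
  V := {v : Address // v ∈ T.nodeFinset}
  S := {v : Address // v ∈ T.nodeFinset ∧ v ≠ []}
  fintypeV := inferInstance
  fintypeS := Fintype.subtype (T.nodeFinset.filter (· ≠ [])) (by simp)
  decidableEqV := Classical.decEq _
  decidableEqS := Classical.decEq _
  par s := ⟨s.1.dropLast, by
    obtain ⟨v, h1, h2⟩ := s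
    obtain ⟨p, e, rfl⟩ := (List.eq_nil_or_concat' v).resolve_left h2
    rw [TypedTree.mem_nodeFinset] at h1 ⊢
    simpa using TypedTree.mem_nodes_of_append h1⟩
  child s := ⟨s.1, s.2.1⟩
  typ s := (s.1.getLast s.2.2).1
  idx s := (s.1.getLast s.2.2).2
  cls v := Address.nodeClass v.1
  inner := Finset.univ.filter fun v => v.1.length < ℓ
  child_ne_par s h := by
    have h1 := congrArg (fun v => List.length v.1) h
    have h2 := List.length_pos_of_ne_nil s.2.2
    simp only [List.length_dropLast] at h1
    omega
  idx_injective s s' h1 h2 h3 := by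
    refine Subtype.ext ?_
    rw [← List.dropLast_append_getLast s.2.2, ← List.dropLast_append_getLast s'.2.2]
    rw [Prod.ext h2 h3, show s.1.dropLast = s'.1.dropLast from Subtype.ext_iff.1 h1]

namespace treePattern

variable {ℓ : ℕ} {T : TypedTree ℓ}

/-- The variable with a given address. -/
def node (v : Address) (h : v ∈ T.nodes) : (treePattern T).V := ⟨v, TypedTree.mem_nodeFinset.2 h⟩

/-- The clause with a given address. -/
def clause (p : Address) (e : ClauseType × ℕ) (h : p ++ [e] ∈ T.nodes) : (treePattern T).S :=
  ⟨p ++ [e], TypedTree.mem_nodeFinset.2 h, by simp⟩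

variable {p : Address} {e : ClauseType × ℕ} {h : p ++ [e] ∈ T.nodes}

theorem par_clause : (treePattern T).par (clause p e h) = node p (TypedTree.mem_nodes_of_append h) :=
  Subtype.ext (by simp [treePattern, clause, node])

theorem child_clause : (treePattern T).child (clause p e h) = node (p ++ [e]) h := rfl

theorem typ_clause : (treePattern T).typ (clause p e h) = e.1 := by
  simp [treePattern, clause]

theorem idx_clause : (treePattern T).idx (clause p e h) = e.2 := by
  simp [treePattern, clause]

theorem cls_node {v : Address} {h : v ∈ T.nodes} :
    (treePattern T).cls (node v h) = Address.nodeClass v := rfl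

theorem exists_eq_clause (s : (treePattern T).S) : ∃ p e h, s = clause p e h := by
  obtain ⟨v, h1, h2⟩ := s
  obtain ⟨p, e, rfl⟩ := (List.eq_nil_or_concat' v).resolve_left h2
  exact ⟨p, e, TypedTree.mem_nodeFinset.1 h1, rfl⟩

theorem exists_eq_node (v : (treePattern T).V) : ∃ w h, v = node w h :=
  ⟨v.1, TypedTree.mem_nodeFinset.1 v.2, rfl⟩

theorem node_inj {v w : Address} {h : v ∈ T.nodes} {h' : w ∈ T.nodes} :
    node v h = node w h' ↔ v = w := Subtype.ext_iff

theorem clause_inj {p' : Address} {e' : ClauseType × ℕ} {h' : p' ++ [e'] ∈ T.nodes} :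
    clause p e h = clause p' e' h' ↔ p ++ [e] = p' ++ [e'] := Subtype.ext_iff

theorem node_mem_inner {v : Address} {h : v ∈ T.nodes} :
    node v h ∈ (treePattern T).inner ↔ v.length < ℓ :=
  Finset.mem_filter.trans (and_iff_right (Finset.mem_univ _))

end treePattern

/-! ### Uniqueness of realizations -/

section Uniqueness

open treePattern

variable {ℓ n M M' : ℕ} {ω : Sample n M M'}

/-- The names of the clauses that lead to the children of type `c` of the variable with
address `p`. -/
theorem range_siblings {T : TypedTree ℓ} {f : (treePattern T).V → Fin n}
    {g : (treePattern T).S → ClauseName M M'} (H : (treePattern T).Realized ω f g)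
    {p : Address} (hp : p ∈ T.nodes) (hl : p.length < ℓ) (c : ClauseType) :
    Set.range (fun i : Fin (T.deg ℓ p c) =>
      g (clause p (c, i) (TypedTree.append_mem_nodes.2 ⟨hp, i.2⟩))) =
    {a | childClass (Address.nodeClass p) a = some c.1 ∧
      (∀ q e (h : q ++ [e] ∈ T.nodes), q ++ [e] = p → g (clause q e h) ≠ a) ∧
      ∃ y, (ω a).1 = {(f (node p hp), c.2.1), (y, c.2.2)} ∧ y ≠ f (node p hp)} := by
  ext a
  simp only [Set.mem_range, Set.mem_ofPred_eq]
  constructor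
  · rintro ⟨i, rfl⟩
    refine ⟨?_, ?_, f (node (p ++ [(c, (i : ℕ))]) (TypedTree.append_mem_nodes.2 ⟨hp, i.2⟩)), ?_, ?_⟩
    · have := H.sorted.compatible (clause p (c, i) (TypedTree.append_mem_nodes.2 ⟨hp, i.2⟩))
      rwa [par_clause, typ_clause] at this
    · rintro q e h rfl h'
      have h'' := congrArg List.length (clause_inj.1 (H.sorted.injective h'))
      simp at h''
    · have := H.lits_eq (clause p (c, i) (TypedTree.append_mem_nodes.2 ⟨hp, i.2⟩))
      rwa [par_clause, typ_clause, child_clause] at this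
    · rw [H.injective.ne_iff, Ne, node_inj]
      simp
  · rintro ⟨hc, hpar, y, hy, hne⟩
    obtain ⟨s, rfl, hs⟩ := H.exists_of_mem (v := node p hp) (a := a) (e := c.2.1)
      (node_mem_inner.2 hl) (by rw [cls_node, hc]; simp) (by rw [hy]; simp)
    obtain ⟨q, e, h, rfl⟩ := exists_eq_clause s
    rcases hs with ⟨h1, h2⟩ | ⟨h1, -⟩
    · rw [par_clause, node_inj] at h1
      subst h1
      obtain ⟨c', i⟩ := e
      rw [typ_clause] at h2
      have hcl := H.sorted.compatible (clause p (c', i) h)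
      rw [par_clause, typ_clause, cls_node, hc] at hcl
      have hl2 := H.lits_eq (clause p (c', i) h)
      rw [par_clause, typ_clause, child_clause, hy] at hl2
      have h3 : (y, c.2.2) ∈ ({(f (node p hp), c'.2.1),
          (f (node (p ++ [(c', i)]) h), c'.2.2)} : Finset (Lit (Fin n))) := by
        rw [← hl2]; simp
      simp only [Finset.mem_insert, Prod.mk.injEq, hne, false_and, Finset.mem_singleton,
        false_or] at h3
      have hcc : c = c' := Prod.ext (Option.some_injective _ hcl) (Prod.ext h2 h3.2)
      subst hcc
      exact ⟨⟨i, (TypedTree.append_mem_nodes.1 h).2⟩, rfl⟩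
    · rw [child_clause, node_inj] at h1
      exact absurd rfl (hpar q e h h1.symm)

theorem strictMono_siblings {T : TypedTree ℓ} {f : (treePattern T).V → Fin n}
    {g : (treePattern T).S → ClauseName M M'} (H : (treePattern T).Realized ω f g)
    {p : Address} (hp : p ∈ T.nodes) (c : ClauseType) :
    StrictMono (fun i : Fin (T.deg ℓ p c) =>
      nameRank (g (clause p (c, i) (TypedTree.append_mem_nodes.2 ⟨hp, i.2⟩)))) := by
  intro i j hij
  apply H.sorted.increasing
  · rw [par_clause, par_clause]
  · rw [typ_clause, typ_clause]
  · rw [idx_clause, idx_clause]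
    exact hij

theorem Fin.strictMono_unique_of_range_eq {k k' : ℕ} {u : Fin k → ℕ} {u' : Fin k' → ℕ}
    (hu : StrictMono u) (hu' : StrictMono u') (h : Set.range u = Set.range u') :
    ∃ hk : k = k', ∀ i, u i = u' (Fin.cast hk i) := by
  have hk : k = k' := by
    have h1 := Set.ncard_range_of_injective hu.injective
    have h2 := Set.ncard_range_of_injective hu'.injective
    rw [h, h2] at h1
    simpa using h1.symm
  subst hk
  exact ⟨rfl, fun i => congrFun ((hu.range_inj hu').1 h) i⟩

/-- Walking down from the common root, the set of names leading to the children of each type is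
forced by `ω`, and `nameRank` forces their order. -/
theorem realized_unique_aux {T T' : TypedTree ℓ} {f : (treePattern T).V → Fin n}
    {g : (treePattern T).S → ClauseName M M'} {f' : (treePattern T').V → Fin n}
    {g' : (treePattern T').S → ClauseName M M'} (H : (treePattern T).Realized ω f g)
    (H' : (treePattern T').Realized ω f' g')
    (hx : f (node [] (TypedTree.nil_mem_nodes T)) = f' (node [] (TypedTree.nil_mem_nodes T')))
    (v : Address) (hv : v ∈ T.nodes) :
    ∃ hv' : v ∈ T'.nodes, f (node v hv) = f' (node v hv') ∧
      ∀ p e (h : p ++ [e] ∈ T.nodes) (h' : p ++ [e] ∈ T'.nodes), p ++ [e] = v →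
        g (clause p e h) = g' (clause p e h') := by
  induction v using List.reverseRecOn with
  | nil => exact ⟨TypedTree.nil_mem_nodes T', hx, fun p e _ _ h => by simp at h⟩
  | append_singleton p e ih =>
    have hp := TypedTree.mem_nodes_of_append hv
    have hl := TypedTree.length_lt_of_append hv
    obtain ⟨hp', hfp, hgp⟩ := ih hp
    obtain ⟨c, i⟩ := e
    have hi := (TypedTree.append_mem_nodes.1 hv).2
    -- The description in `range_siblings` sees the tree only through the class of `p`, its image
    -- and the name of the clause above it, and on these the two realizations agree by induction.
    have hrange : Set.range (fun i : Fin (T.deg ℓ p c) =>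
        g (clause p (c, i) (TypedTree.append_mem_nodes.2 ⟨hp, i.2⟩))) =
        Set.range (fun i : Fin (T'.deg ℓ p c) =>
        g' (clause p (c, i) (TypedTree.append_mem_nodes.2 ⟨hp', i.2⟩))) := by
      rw [range_siblings H hp hl, range_siblings H' hp' hl, hfp]
      ext a
      simp only [Set.mem_ofPred_eq]
      refine and_congr_right fun _ => and_congr_left fun _ => ?_
      constructor
      · rintro h1 q e h rfl
        rw [← hgp q e hp hp' rfl]
        exact h1 q e hp rfl
      · rintro h1 q e h rfl
        rw [hgp q e hp hp' rfl]
        exact h1 q e hp' rfl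
    have hrange' := congrArg (Set.image nameRank) hrange
    rw [← Set.range_comp, ← Set.range_comp] at hrange'
    obtain ⟨hk, hu⟩ := Fin.strictMono_unique_of_range_eq (strictMono_siblings H hp c)
      (strictMono_siblings H' hp' c) hrange'
    have hv' : p ++ [(c, i)] ∈ T'.nodes := TypedTree.append_mem_nodes.2 ⟨hp', hk ▸ hi⟩
    have hg : g (clause p (c, i) hv) = g' (clause p (c, i) hv') :=
      nameRank_injective (hu ⟨i, hi⟩)
    refine ⟨hv', ?_, ?_⟩
    · have h1 := H.lits_eq (clause p (c, i) hv)
      have h2 := H'.lits_eq (clause p (c, i) hv')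
      rw [par_clause, typ_clause, child_clause] at h1 h2
      rw [hg, h2] at h1
      have h3 : (f (node _ hv), c.2.2) ∈ ({(f' (node p hp'), c.2.1),
          (f' (node (p ++ [(c, i)]) hv'), c.2.2)} : Finset (Lit (Fin n))) := by
        rw [h1]; simp
      have h4 : f (node _ hv) ≠ f' (node p hp') := by
        rw [← hfp, H.injective.ne_iff, Ne, node_inj]
        simp
      simpa [h4] using h3
    · intro q e h h' heq
      obtain ⟨rfl, rfl⟩ := List.append_singleton_inj.1 heq
      exact hg

/-- At most one tree is realized at a variable, and in at most one way. -/
theorem realized_unique {T T' : TypedTree ℓ} {f : (treePattern T).V → Fin n}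
    {g : (treePattern T).S → ClauseName M M'} {f' : (treePattern T').V → Fin n}
    {g' : (treePattern T').S → ClauseName M M'} (H : (treePattern T).Realized ω f g)
    (H' : (treePattern T').Realized ω f' g')
    (hx : f (node [] (TypedTree.nil_mem_nodes T)) = f' (node [] (TypedTree.nil_mem_nodes T'))) :
    T = T' := by
  apply TypedTree.nodes_injective
  ext v
  exact ⟨fun h => (realized_unique_aux H H' hx v h).1,
    fun h => (realized_unique_aux H' H hx.symm v h).1⟩

theorem realized_unique' {T : TypedTree ℓ} {f f' : (treePattern T).V → Fin n}
    {g g' : (treePattern T).S → ClauseName M M'} (H : (treePattern T).Realized ω f g)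
    (H' : (treePattern T).Realized ω f' g')
    (hx : f (node [] (TypedTree.nil_mem_nodes T)) = f' (node [] (TypedTree.nil_mem_nodes T))) :
    f = f' ∧ g = g' := by
  constructor
  · funext v
    obtain ⟨w, h, rfl⟩ := exists_eq_node v
    exact (realized_unique_aux H H' hx w h).2.1
  · funext s
    obtain ⟨p, e, h, rfl⟩ := exists_eq_clause s
    exact (realized_unique_aux H H' hx _ h).2.2 p e h h rfl

end Uniqueness

end

noncomputable section

/-! ### Realized trees are instances -/

/-- An invariant indexed by the number of steps is carried along a shortest walk. It serves to show
that a neighbourhood contains nothing beyond the realized tree. -/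
theorem SimpleGraph.exists_of_edist_le {W : Type} {G : SimpleGraph W} {N : ℕ} {x w : W}
    (Q : ℕ → W → Prop) (h0 : Q 0 x)
    (hs : ∀ k < N, ∀ u u', Q k u → G.Adj u u' → Q (k + 1) u') (h : G.edist x w ≤ N) :
    ∃ k ≤ N, Q k w := by
  have key : ∀ {u w : W} (p : G.Walk u w) (j : ℕ), Q j u → j + p.length ≤ N →
      Q (j + p.length) w := by
    intro u w p
    induction p with
    | nil => exact fun j h _ => h
    | cons hadj p ih =>
      intro j hj hN
      rw [SimpleGraph.Walk.length_cons] at hN ⊢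
      have := ih (j + 1) (hs j (by omega) _ _ hj hadj) (by omega)
      rwa [show j + (p.length + 1) = j + 1 + p.length by omega]
  have hne : G.edist x w ≠ ⊤ := ne_top_of_le_ne_top (ENat.natCast_ne_top N) h
  obtain ⟨p, hp⟩ := (SimpleGraph.edist_ne_top_iff_reachable.1 hne).exists_walk_length_eq_edist
  rw [← hp, Nat.cast_le] at h
  exact ⟨p.length, h, by simpa using key p 0 h0 (by simpa using h)⟩

namespace CNF

variable {V A : Type} {Φ : CNF V A}

theorem incidenceGraph_adj {u v : V ⊕ A} : Φ.incidenceGraph.Adj u v ↔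
    (∃ x ∈ Φ.vars, ∃ a ∈ Φ.clauses, (∃ s : ℤˣ, (x, s) ∈ Φ.lits a) ∧
      u = Sum.inl x ∧ v = Sum.inr a) ∨
    ∃ x ∈ Φ.vars, ∃ a ∈ Φ.clauses, (∃ s : ℤˣ, (x, s) ∈ Φ.lits a) ∧
      v = Sum.inl x ∧ u = Sum.inr a := by
  rw [incidenceGraph, SimpleGraph.fromRel_adj, and_iff_right_of_imp]
  rintro (⟨x, _, a, _, _, rfl, rfl⟩ | ⟨x, _, a, _, _, rfl, rfl⟩) <;> simp

theorem incidenceGraph_adj_of_mem {x : V} {a : A} {s : ℤˣ} (hx : x ∈ Φ.vars) (ha : a ∈ Φ.clauses)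
    (h : (x, s) ∈ Φ.lits a) : Φ.incidenceGraph.Adj (Sum.inl x) (Sum.inr a) :=
  incidenceGraph_adj.2 (Or.inl ⟨x, hx, a, ha, ⟨s, h⟩, rfl, rfl⟩)

theorem edist_le_succ {G : SimpleGraph V} {x y z : V} {k : ℕ} (h : G.edist x y ≤ k)
    (hadj : G.Adj y z) : G.edist x z ≤ (k + 1 : ℕ) := by
  refine (SimpleGraph.edist_triangle (v := y)).trans ?_
  rw [Nat.cast_add, Nat.cast_one]
  exact add_le_add h (SimpleGraph.edist_eq_one_iff_adj.2 hadj).le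

end CNF

/-- Unit Clause Propagation from some literal leads to a contradiction at the variable `u`. -/
def Conflicted {V A : Type} (Φ : CNF V A) (u : V) : Prop :=
  ∃ l₀ : Lit V, ∀ s, Φ.UCP {l₀} (u, s)

/-- A conflict clause has only conflicted variables, so a single unconflicted variable protects its
clauses from pruning. -/
theorem mem_prune_clauses {n M M' : ℕ} {ω : Sample n M M'} {h : Fin 2} {a : ClauseName M M'}
    (ha : a ∈ (formula ω h).clauses) {u : Fin n} {s : ℤˣ} (hu : (u, s) ∈ (ω a).1)
    (hc : ¬ Conflicted (formula ω h) u) : a ∈ (formula ω h).prune.clauses := by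
  refine ⟨ha, ?_⟩
  simp only [Set.mem_iUnion, not_exists]
  intro l₀ _ hcon
  have := hcon.2 (u, s) hu
  refine hc ⟨l₀, fun s' => ?_⟩
  rcases Int.units_eq_one_or s with rfl | rfl <;> rcases Int.units_eq_one_or s' with rfl | rfl
  · exact this.1
  · exact this.2
  · simpa [Lit.neg] using this.2
  · exact this.1

section

open treePattern

variable {ℓ n M M' : ℕ} {T : TypedTree ℓ} {ω : Sample n M M'} {f : (treePattern T).V → Fin n}
  {g : (treePattern T).S → ClauseName M M'}

theorem inPart_of_clause (H : (treePattern T).Realized ω f g) {h : Fin 2} {p : Address}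
    {e : ClauseType × ℕ} (hv : p ++ [e] ∈ T.nodes) (hp : (e.1.1).InPart h) :
    (Address.nodeClass p).InPart h ∧ g (clause p e hv) ∈ (formula ω h).clauses := by
  have := H.sorted.compatible (clause p e hv)
  rw [par_clause, typ_clause] at this
  exact mem_of_childClass this hp

theorem mem_part_vars {h : Fin 2} {v : Address} :
    v ∈ (T.part h).vars ↔ v ∈ T.nodes ∧ (Address.nodeClass v).InPart h := by
  rw [NodeClass.inPart_iff]
  rfl

theorem mem_part_clauses {h : Fin 2} {v : Address} : v ∈ (T.part h).clauses ↔
    v ∈ T.nodes ∧ v ≠ [] ∧ (Address.nodeClass v).InPart h := by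
  rw [NodeClass.inPart_iff, ← and_assoc]
  rfl

theorem part_lits {h : Fin 2} {p : Address} {e : ClauseType × ℕ} :
    (T.part h).lits (p ++ [e]) = {(p, e.1.2.1), (p ++ [e], e.1.2.2)} := by
  simp [TypedTree.part, TypedTree.toCNF]

/-- No inner variable of the realized tree is conflicted. -/
def Unconflicted (T : TypedTree ℓ) (ω : Sample n M M') (f : (treePattern T).V → Fin n) : Prop :=
  ∀ h, ∀ v ∈ (treePattern T).inner, ((treePattern T).cls v).InPart h →
    ¬ Conflicted (formula ω h) (f v)

/-- The parent of a clause of the tree is always inner, so conflicts at the leaves do no harm. -/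
theorem mem_pruned (H : (treePattern T).Realized ω f g) (hU : Unconflicted T ω f) {h : Fin 2}
    {p : Address} {e : ClauseType × ℕ} (hv : p ++ [e] ∈ T.nodes) (hp : (e.1.1).InPart h) :
    g (clause p e hv) ∈ (formula ω h).prune.clauses := by
  have h1 := inPart_of_clause H hv hp
  refine mem_prune_clauses h1.2 (u := f (node p (TypedTree.mem_nodes_of_append hv)))
    (s := e.1.2.1) ?_ ?_
  · rw [H.lits_eq, par_clause, typ_clause]
    simp
  · exact hU h _ (node_mem_inner.2 (TypedTree.length_lt_of_append hv)) h1.1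

theorem adj_of_realized (H : (treePattern T).Realized ω f g) (hU : Unconflicted T ω f) {h : Fin 2}
    {p : Address} {e : ClauseType × ℕ} (hv : p ++ [e] ∈ T.nodes) (hp : (e.1.1).InPart h) :
    (formula ω h).prune.incidenceGraph.Adj
        (Sum.inl (f (node p (TypedTree.mem_nodes_of_append hv)))) (Sum.inr (g (clause p e hv))) ∧
      (formula ω h).prune.incidenceGraph.Adj
        (Sum.inr (g (clause p e hv))) (Sum.inl (f (node (p ++ [e]) hv))) := by
  have h1 := mem_pruned H hU hv hp
  constructor
  · refine CNF.incidenceGraph_adj_of_mem (s := e.1.2.1) (Set.mem_univ _) h1 ?_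
    change _ ∈ (ω (g (clause p e hv))).1
    rw [H.lits_eq, par_clause, typ_clause]
    simp
  · refine (CNF.incidenceGraph_adj_of_mem (s := e.1.2.2) (Set.mem_univ _) h1 ?_).symm
    change _ ∈ (ω (g (clause p e hv))).1
    rw [H.lits_eq, child_clause, typ_clause]
    simp

theorem edist_realized_le (H : (treePattern T).Realized ω f g) (hU : Unconflicted T ω f)
    {h : Fin 2} (v : Address) (hv : v ∈ T.nodes) (hp : (Address.nodeClass v).InPart h) :
    (formula ω h).prune.incidenceGraph.edist
      (Sum.inl (f (node [] (TypedTree.nil_mem_nodes T)))) (Sum.inl (f (node v hv))) ≤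
        (2 * v.length : ℕ) := by
  induction v using List.reverseRecOn with
  | nil => simp
  | append_singleton p e ih =>
    rw [Address.nodeClass_append] at hp
    have h1 := adj_of_realized H hU hv hp
    have := CNF.edist_le_succ (CNF.edist_le_succ
      (ih (TypedTree.mem_nodes_of_append hv) (inPart_of_clause H hv hp).1) h1.1) h1.2
    rwa [List.length_append, List.length_singleton, mul_add]

theorem edist_realized_clause_le (H : (treePattern T).Realized ω f g) (hU : Unconflicted T ω f)
    {h : Fin 2} {p : Address} {e : ClauseType × ℕ} (hv : p ++ [e] ∈ T.nodes)
    (hp : (e.1.1).InPart h) :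
    (formula ω h).prune.incidenceGraph.edist
      (Sum.inl (f (node [] (TypedTree.nil_mem_nodes T)))) (Sum.inr (g (clause p e hv))) ≤
        (2 * ℓ : ℕ) := by
  have h2 := inPart_of_clause H hv hp
  refine (CNF.edist_le_succ (edist_realized_le H hU p (TypedTree.mem_nodes_of_append hv) h2.1)
    (adj_of_realized H hU hv hp).1).trans ?_
  rw [Nat.cast_le]
  have := TypedTree.length_lt_of_append hv
  omega

/-- The variables and clauses that can be reached by a walk of length `k` from the root of a
realized tree. -/
def Reached (T : TypedTree ℓ) (f : (treePattern T).V → Fin n)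
    (g : (treePattern T).S → ClauseName M M') (h : Fin 2) (k : ℕ) :
    Fin n ⊕ ClauseName M M' → Prop
  | .inl y => ∃ v hv, f (node v hv) = y ∧ (Address.nodeClass v).InPart h ∧ 2 * v.length ≤ k
  | .inr a => ∃ p e hv, g (clause p e hv) = a ∧ (e.1.1).InPart h ∧ 2 * p.length + 1 ≤ k

/-- A variable reached in fewer than `2 * ℓ` steps is inner, so all its clauses belong to the tree
and the walk cannot leave the tree. This gives surjectivity of the isomorphism onto the
neighbourhood. -/
theorem exists_reached (H : (treePattern T).Realized ω f g) {h : Fin 2}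
    {w : Fin n ⊕ ClauseName M M'} (hw : (formula ω h).prune.incidenceGraph.edist
      (Sum.inl (f (node [] (TypedTree.nil_mem_nodes T)))) w ≤ (2 * ℓ : ℕ)) :
    ∃ k ≤ 2 * ℓ, Reached T f g h k w := by
  refine SimpleGraph.exists_of_edist_le (Reached T f g h) ?_ ?_ hw
  · exact ⟨[], TypedTree.nil_mem_nodes T, rfl, Or.inl rfl, by simp⟩
  · intro k hk u u' hQ hadj
    rcases CNF.incidenceGraph_adj.1 hadj with ⟨y, -, a, ha, ⟨s, hs⟩, rfl, rfl⟩ |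
      ⟨y, -, a, -, ⟨s, hs⟩, rfl, rfl⟩
    · obtain ⟨v, hv, rfl, hp, hl⟩ := hQ
      obtain ⟨σ, hσ, hσp⟩ := childClass_of_mem hp ha.1
      obtain ⟨t, rfl, ht⟩ := H.exists_of_mem (v := node v hv) (a := a)
        (node_mem_inner.2 (by omega)) (by rw [cls_node, hσ]; simp) hs
      obtain ⟨p, e, hpe, rfl⟩ := exists_eq_clause t
      refine ⟨p, e, hpe, rfl, ?_, ?_⟩
      · rcases ht with ⟨ht, -⟩ | ⟨ht, -⟩
        · rw [par_clause, node_inj] at ht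
          subst ht
          have := H.sorted.compatible (clause v e hpe)
          rw [par_clause, typ_clause, cls_node, hσ] at this
          rwa [← Option.some_injective _ this]
        · rw [child_clause, node_inj] at ht
          subst ht
          rwa [Address.nodeClass_append] at hp
      · rcases ht with ⟨ht, -⟩ | ⟨ht, -⟩
        · rw [par_clause, node_inj] at ht
          subst ht
          omega
        · rw [child_clause, node_inj] at ht
          subst ht
          rw [List.length_append, List.length_singleton] at hl
          omega
    · obtain ⟨p, e, hpe, rfl, hp, hl⟩ := hQ
      change _ ∈ (ω (g (clause p e hpe))).1 at hs
      rw [H.mem_lits_iff, par_clause, child_clause] at hs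
      rcases hs with hs | hs
      · refine ⟨p, TypedTree.mem_nodes_of_append hpe, (congrArg Prod.fst hs).symm,
          (inPart_of_clause H hpe hp).1, by omega⟩
      · refine ⟨p ++ [e], hpe, (congrArg Prod.fst hs).symm, ?_, ?_⟩
        · rwa [Address.nodeClass_append]
        · rw [List.length_append, List.length_singleton]
          omega

/-- The isomorphism of the part of a realized tree onto a neighbourhood in the pruned formula. -/
theorem exists_iso_of_realized (H : (treePattern T).Realized ω f g) (hU : Unconflicted T ω f)
    (h : Fin 2) :
    ∃ ι : CNF.Iso (T.part h) ((formula ω h).prune.neighbourhood (2 * ℓ)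
        (f (node [] (TypedTree.nil_mem_nodes T)))),
      (∀ v : (T.part h).vars, (ι.onVars v : Fin n) = f (node v (mem_part_vars.1 v.2).1)) ∧
      ∀ p e (hv : p ++ [e] ∈ (T.part h).clauses),
        (ι.onClauses ⟨p ++ [e], hv⟩ : ClauseName M M') =
          g (clause p e (mem_part_clauses.1 hv).1) := by
  have hcl : ∀ a : (T.part h).clauses, a.1 ∈ T.nodeFinset ∧ a.1 ≠ [] := fun a =>
    ⟨TypedTree.mem_nodeFinset.2 (mem_part_clauses.1 a.2).1, (mem_part_clauses.1 a.2).2.1⟩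
  have hg : ∀ p e (hv : p ++ [e] ∈ (T.part h).clauses),
      g ⟨p ++ [e], hcl ⟨p ++ [e], hv⟩⟩ = g (clause p e (mem_part_clauses.1 hv).1) :=
    fun _ _ _ => rfl
  let F : (T.part h).vars → ((formula ω h).prune.neighbourhood (2 * ℓ)
      (f (node [] (TypedTree.nil_mem_nodes T)))).vars := fun v =>
    ⟨f (node v (mem_part_vars.1 v.2).1), Set.mem_univ _, by
      refine (edist_realized_le H hU v (mem_part_vars.1 v.2).1 (mem_part_vars.1 v.2).2).trans ?_
      exact_mod_cast Nat.mul_le_mul_left 2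
        (TypedTree.length_le_of_mem_nodes (mem_part_vars.1 v.2).1)⟩
  let G : (T.part h).clauses → ((formula ω h).prune.neighbourhood (2 * ℓ)
      (f (node [] (TypedTree.nil_mem_nodes T)))).clauses := fun a =>
    ⟨g ⟨a.1, hcl a⟩, by
      obtain ⟨a, ha⟩ := a
      obtain ⟨h1, h2, h3⟩ := mem_part_clauses.1 ha
      obtain ⟨p, e, rfl⟩ := (List.eq_nil_or_concat' a).resolve_left h2
      rw [Address.nodeClass_append] at h3
      exact ⟨mem_pruned H hU h1 h3, by exact_mod_cast edist_realized_clause_le H hU h1 h3⟩⟩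
  have hF : Function.Bijective F := by
    constructor
    · intro v w hvw
      exact Subtype.ext (node_inj.1 (H.injective (congrArg Subtype.val hvw)))
    · rintro ⟨y, -, hy⟩
      obtain ⟨k, -, v, hv, rfl, hp, -⟩ := exists_reached H (by exact_mod_cast hy)
      exact ⟨⟨v, mem_part_vars.2 ⟨hv, hp⟩⟩, rfl⟩
  have hG : Function.Bijective G := by
    constructor
    · intro v w hvw
      have h1 := congrArg Subtype.val (H.sorted.injective (congrArg Subtype.val hvw))
      exact Subtype.ext h1
    · rintro ⟨a, -, ha⟩
      obtain ⟨k, -, p, e, hv, rfl, hp, -⟩ := exists_reached H (by exact_mod_cast ha)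
      exact ⟨⟨p ++ [e], mem_part_clauses.2 ⟨hv, by simp, by rwa [Address.nodeClass_append]⟩⟩, rfl⟩
  refine ⟨⟨Equiv.ofBijective F hF, Equiv.ofBijective G hG, ?_⟩, fun _ => rfl, fun _ _ _ => rfl⟩
  rintro ⟨a, ha⟩ ⟨y, hy⟩ s
  obtain ⟨h1, h2, h3⟩ := mem_part_clauses.1 ha
  obtain ⟨p, e, rfl⟩ := (List.eq_nil_or_concat' a).resolve_left h2
  change (y, s) ∈ (T.part h).lits (p ++ [e]) ↔
    (f (node y (mem_part_vars.1 hy).1), s) ∈ (ω (g (clause p e h1))).1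
  rw [part_lits, H.mem_lits_iff, par_clause, child_clause, typ_clause]
  simp only [Set.mem_insert_iff, Set.mem_singleton_iff, Prod.mk.injEq, H.injective.eq_iff, node_inj]

theorem isInstance_of_realized (H : (treePattern T).Realized ω f g) (hU : Unconflicted T ω f) :
    IsInstance T (fun h => (formula ω h).prune) (f (node [] (TypedTree.nil_mem_nodes T))) := by
  choose ι hι hι' using exists_iso_of_realized H hU
  refine ⟨ι, ?_, ?_, ?_, ?_⟩
  · rintro h ⟨v, hv⟩ hv'
    obtain rfl : v = [] := hv'
    exact hι h _
  · rintro ⟨v, hv⟩ ⟨w, hw⟩ hvw -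
    obtain rfl : v = w := hvw
    rw [hι, hι]
  · rintro ⟨a, ha⟩ ⟨b, hb⟩ hab hs
    obtain rfl : a = b := hab
    obtain ⟨h1, h2, h3⟩ := mem_part_clauses.1 ha
    obtain ⟨p, e, rfl⟩ := (List.eq_nil_or_concat' a).resolve_left h2
    rw [Address.nodeClass_append] at hs
    have hc := H.sorted.compatible (clause p e h1)
    rw [par_clause, typ_clause, hs] at hc
    rw [hι' 0 p e ha, hι' 1 p e hb]
    -- Only a shared parent together with a shared name leads to a shared child; the other
    -- combinations contradict `hc`.
    rcases h0 : (treePattern T).cls (node p (TypedTree.mem_nodes_of_append h1)) with _ | k <;>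
      rcases h4 : g (clause p e h1) with i | ⟨k', i⟩ <;> rw [h0, h4] at hc <;>
      simp [childClass] at hc
    exact ⟨i, rfl, rfl⟩
  · rintro h ⟨a, ha⟩ hs hs'
    obtain ⟨h1, h2, h3⟩ := mem_part_clauses.1 ha
    obtain ⟨p, e, rfl⟩ := (List.eq_nil_or_concat' a).resolve_left h2
    rw [Address.nodeClass_append] at hs
    rw [List.dropLast_concat] at hs'
    have hc := H.sorted.compatible (clause p e h1)
    rw [par_clause, typ_clause, hs, cls_node, hs'] at hc
    rw [hι' h p e ha]
    rcases h4 : g (clause p e h1) with i | ⟨k', i⟩ <;> rw [h4] at hc <;>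
      simp [childClass] at hc
    subst hc
    exact ⟨i, rfl⟩

end

end

noncomputable section

/-! ### Isomorphisms of trees and instances -/

namespace CNF

variable {V A V' A' V'' A'' : Type}

/-- The inverse of an isomorphism. -/
def Iso.symm {Φ : CNF V A} {Ψ : CNF V' A'} (ι : Iso Φ Ψ) : Iso Ψ Φ where
  onVars := ι.onVars.symm
  onClauses := ι.onClauses.symm
  lits_iff a y s := by
    rw [ι.lits_iff]
    simp

/-- The composition of two isomorphisms. -/
def Iso.trans {Φ : CNF V A} {Ψ : CNF V' A'} {Θ : CNF V'' A''} (ι : Iso Φ Ψ) (κ : Iso Ψ Θ) :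
    Iso Φ Θ where
  onVars := ι.onVars.trans κ.onVars
  onClauses := ι.onClauses.trans κ.onClauses
  lits_iff a y s := by
    rw [ι.lits_iff, κ.lits_iff]
    rfl

/-- A formula whose variables are addresses that form a tree, as in `TypedTree.toCNF`. -/
structure IsAddressFormula (Φ : CNF Address Address) : Prop where
  nil_mem : [] ∈ Φ.vars
  mem_clauses : ∀ a, a ∈ Φ.clauses ↔ a ∈ Φ.vars ∧ a ≠ []
  mem_of_append : ∀ (p : Address) (e : ClauseType × ℕ), p ++ [e] ∈ Φ.vars → p ∈ Φ.vars
  lits_append : ∀ (p : Address) (e : ClauseType × ℕ),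
    Φ.lits (p ++ [e]) = {(p, e.1.2.1), (p ++ [e], e.1.2.2)}

theorem IsAddressFormula.append_mem_clauses {Φ : CNF Address Address} (h : Φ.IsAddressFormula)
    {p : Address} {e : ClauseType × ℕ} (hv : p ++ [e] ∈ Φ.vars) : p ++ [e] ∈ Φ.clauses :=
  (h.mem_clauses _).2 ⟨hv, by simp⟩

/-- An isomorphism that fixes the root respects the direction of the edges. By induction the clause
above `p` is mapped to the clause above the image of `p`. Injectivity keeps the clause above `p ++
[e]` away from it, so the image of `p` is the parent end of the new clause. -/
theorem Iso.onVars_append {Φ Ψ : CNF Address Address} (hΦ : Φ.IsAddressFormula)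
    (hΨ : Ψ.IsAddressFormula) (κ : Iso Φ Ψ)
    (h0 : ∀ v : Φ.vars, (v : Address) = [] → (κ.onVars v : Address) = []) (v : Address) :
    ∀ (p : Address) (e : ClauseType × ℕ) (hv : p ++ [e] ∈ Φ.vars), v = p ++ [e] →
    ∃ e', (κ.onVars ⟨p ++ [e], hv⟩ : Address) =
        (κ.onVars ⟨p, hΦ.mem_of_append p e hv⟩ : Address) ++ [e'] ∧ e'.1.2 = e.1.2 ∧
      (κ.onClauses ⟨p ++ [e], hΦ.append_mem_clauses hv⟩ : Address) =
        κ.onVars ⟨p ++ [e], hv⟩ := by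
  induction v using List.reverseRecOn with
  | nil => intro p e _ h; simp at h
  | append_singleton p₀ e₀ ih =>
    rintro p e hv heq
    obtain ⟨rfl, rfl⟩ := List.append_singleton_inj.1 heq
    have hp := hΦ.mem_of_append _ _ hv
    set a' := κ.onClauses ⟨p₀ ++ [e₀], hΦ.append_mem_clauses hv⟩ with ha'
    obtain ⟨-, hne⟩ := (hΨ.mem_clauses a').1 a'.2
    obtain ⟨p', e', hpe⟩ := (List.eq_nil_or_concat' (a' : Address)).resolve_left hne
    have h1 := (κ.lits_iff ⟨p₀ ++ [e₀], hΦ.append_mem_clauses hv⟩ ⟨p₀, hp⟩ e₀.1.2.1).1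
      (by rw [hΦ.lits_append]; simp)
    have h2 := (κ.lits_iff ⟨p₀ ++ [e₀], hΦ.append_mem_clauses hv⟩ ⟨p₀ ++ [e₀], hv⟩ e₀.1.2.2).1
      (by rw [hΦ.lits_append]; simp)
    rw [← ha', hpe, hΨ.lits_append] at h1 h2
    simp only [Set.mem_insert_iff, Set.mem_singleton_iff, Prod.mk.injEq] at h1 h2
    have h3 : (κ.onVars ⟨p₀, hp⟩ : Address) ≠ p' ++ [e'] := by
      intro hcon
      rcases List.eq_nil_or_concat' p₀ with rfl | ⟨q, e₁, rfl⟩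
      · rw [h0 _ rfl] at hcon
        simp at hcon
      · obtain ⟨_, -, -, h5⟩ := ih q e₁ hp rfl
        rw [hcon, ← hpe] at h5
        have h6 := congrArg (fun x => x.1.length) (κ.onClauses.injective (Subtype.ext h5))
        simp at h6
    have h4 : (κ.onVars ⟨p₀, hp⟩ : Address) ≠ κ.onVars ⟨p₀ ++ [e₀], hv⟩ := by
      intro hcon
      have h6 := congrArg (fun x => x.1.length) (κ.onVars.injective (Subtype.ext hcon))
      simp at h6
    obtain ⟨h5, h6⟩ := h1.resolve_right fun h => h3 h.1
    obtain ⟨h7, h8⟩ := h2.resolve_left fun h => h4 (h5.trans h.1.symm)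
    exact ⟨e', by rw [h7, h5], Prod.ext h6.symm h8.symm, by rw [h7, hpe]⟩

/-- An isomorphism of address formulas as a map of addresses. -/
theorem Iso.exists_map {Φ Ψ : CNF Address Address} (hΦ : Φ.IsAddressFormula)
    (hΨ : Ψ.IsAddressFormula) (κ : Iso Φ Ψ)
    (h0 : ∀ v : Φ.vars, (v : Address) = [] → (κ.onVars v : Address) = []) :
    ∃ k : Address → Address, (∀ v : Φ.vars, (κ.onVars v : Address) = k v) ∧
      (∀ v : Φ.clauses, (κ.onClauses v : Address) = k v) ∧ k [] = [] ∧
      (∀ v ∈ Φ.vars, k v ∈ Ψ.vars) ∧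
      ∀ (p : Address) (e : ClauseType × ℕ), p ++ [e] ∈ Φ.vars →
        ∃ e', k (p ++ [e]) = k p ++ [e'] ∧ e'.1.2 = e.1.2 := by
  classical
  refine ⟨fun v => if h : v ∈ Φ.vars then κ.onVars ⟨v, h⟩ else [], ?_, ?_, ?_, ?_, ?_⟩
  · rintro ⟨v, hv⟩
    simp [hv]
  · rintro ⟨a, ha⟩
    obtain ⟨hv, hne⟩ := (hΦ.mem_clauses a).1 ha
    obtain ⟨p, e, rfl⟩ := (List.eq_nil_or_concat' a).resolve_left hne
    obtain ⟨_, -, -, h⟩ := Iso.onVars_append hΦ hΨ κ h0 _ p e hv rfl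
    simpa [hv] using h
  · simp [hΦ.nil_mem, h0]
  · intro v hv
    simp [hv]
  · intro p e hv
    obtain ⟨e', h, h', -⟩ := Iso.onVars_append hΦ hΨ κ h0 _ p e hv rfl
    exact ⟨e', by simpa [hv, hΦ.mem_of_append p e hv] using h, h'⟩

/-- A map of addresses that gives an isomorphism of formulas. -/
theorem exists_iso_of_map {Φ Ψ : CNF Address Address} {W : Set Address} {k k' : Address → Address}
    (hk : ∀ v ∈ Φ.vars, k v ∈ Ψ.vars ∧ k' (k v) = v)
    (hk' : ∀ v ∈ Ψ.vars, k' v ∈ Φ.vars ∧ k (k' v) = v)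
    (hc : ∀ v ∈ Φ.clauses, k v ∈ Ψ.clauses ∧ k' (k v) = v)
    (hc' : ∀ v ∈ Ψ.clauses, k' v ∈ Φ.clauses ∧ k (k' v) = v)
    (hW : Set.InjOn k W) (hΦW : Φ.vars ⊆ W)
    (hl : ∀ a ∈ Φ.clauses, ∃ (p : Address) (e e' : ClauseType × ℕ), a = p ++ [e] ∧
      p ∈ W ∧ a ∈ W ∧ k a = k p ++ [e'] ∧ e'.1.2 = e.1.2)
    (hlΦ : ∀ (p : Address) (e : ClauseType × ℕ),
      Φ.lits (p ++ [e]) = {(p, e.1.2.1), (p ++ [e], e.1.2.2)})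
    (hlΨ : ∀ (p : Address) (e : ClauseType × ℕ),
      Ψ.lits (p ++ [e]) = {(p, e.1.2.1), (p ++ [e], e.1.2.2)}) :
    ∃ ι : Iso Φ Ψ, (∀ v, (ι.onVars v : Address) = k v) ∧ (∀ v, (ι.onClauses v : Address) = k v) ∧
      (∀ v, (ι.onVars.symm v : Address) = k' v) ∧
      ∀ v, (ι.onClauses.symm v : Address) = k' v := by
  refine ⟨⟨⟨fun v => ⟨k v, (hk v v.2).1⟩, fun v => ⟨k' v, (hk' v v.2).1⟩,
    fun v => Subtype.ext (hk v v.2).2, fun v => Subtype.ext (hk' v v.2).2⟩,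
    ⟨fun v => ⟨k v, (hc v v.2).1⟩, fun v => ⟨k' v, (hc' v v.2).1⟩,
    fun v => Subtype.ext (hc v v.2).2, fun v => Subtype.ext (hc' v v.2).2⟩, ?_⟩,
    fun _ => rfl, fun _ => rfl, fun _ => rfl, fun _ => rfl⟩
  rintro ⟨a, ha⟩ ⟨y, hy⟩ s
  obtain ⟨p, e, e', rfl, hp, ha', hka, he⟩ := hl a ha
  change (y, s) ∈ Φ.lits (p ++ [e]) ↔ (k y, s) ∈ Ψ.lits (k (p ++ [e]))
  rw [hlΦ, hka, hlΨ, ← hka, he]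
  simp only [Set.mem_insert_iff, Set.mem_singleton_iff, Prod.mk.injEq,
    hW.eq_iff (hΦW hy) hp, hW.eq_iff (hΦW hy) ha']

end CNF

namespace TypedTree

variable {ℓ : ℕ} {T T' T'' : TypedTree ℓ}

theorem toCNF_lits (p : Address) (e : ClauseType × ℕ) :
    T.toCNF.lits (p ++ [e]) = {(p, e.1.2.1), (p ++ [e], e.1.2.2)} := by
  simp [toCNF]

theorem isAddressFormula_toCNF : T.toCNF.IsAddressFormula where
  nil_mem := nil_mem_nodes T
  mem_clauses _ := Iff.rfl
  mem_of_append _ _ := mem_nodes_of_append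
  lits_append := toCNF_lits

theorem Valid.isAddressFormula_part (hT : T.Valid) (h : Fin 2) : (T.part h).IsAddressFormula where
  nil_mem := mem_part_vars.2 ⟨nil_mem_nodes T, Or.inl rfl⟩
  mem_clauses a := by
    rw [mem_part_vars, mem_part_clauses]
    tauto
  mem_of_append p e hv := by
    rw [mem_part_vars, Address.nodeClass_append] at hv
    rw [mem_part_vars]
    refine ⟨mem_nodes_of_append hv.1, ?_⟩
    rcases hT p e hv.1 with h1 | h1
    · exact Or.inl h1
    · rw [h1]
      exact hv.2
  lits_append _ _ := part_lits

/-- The maps `k` and `k'` of addresses are inverse isomorphisms of trees. -/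
structure IsTreeIso (T T' : TypedTree ℓ) (k k' : Address → Address) : Prop where
  mapsTo : ∀ v ∈ T.nodes, k v ∈ T'.nodes
  mapsTo' : ∀ v ∈ T'.nodes, k' v ∈ T.nodes
  left_inv : ∀ v ∈ T.nodes, k' (k v) = v
  right_inv : ∀ v ∈ T'.nodes, k (k' v) = v
  nil : k [] = []
  append : ∀ (p : Address) (e : ClauseType × ℕ), p ++ [e] ∈ T.nodes →
    ∃ i, k (p ++ [e]) = k p ++ [(e.1, i)]

namespace IsTreeIso

variable {k k' k₂ k₂' : Address → Address}

theorem injOn (H : IsTreeIso T T' k k') : Set.InjOn k T.nodes := fun v hv w hw h => by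
  rw [← H.left_inv v hv, h, H.left_inv w hw]

theorem symm (H : IsTreeIso T T' k k') : IsTreeIso T' T k' k where
  mapsTo := H.mapsTo'
  mapsTo' := H.mapsTo
  left_inv := H.right_inv
  right_inv := H.left_inv
  nil := by
    conv_lhs => rw [← H.nil]
    exact H.left_inv _ (nil_mem_nodes T)
  append p' e' hv := by
    have h1 := H.right_inv _ hv
    have h2 := H.mapsTo' _ hv
    rcases List.eq_nil_or_concat' (k' (p' ++ [e'])) with h | ⟨q, e, h⟩
    · rw [h, H.nil] at h1
      simp at h1
    · rw [h] at h1 h2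
      obtain ⟨i, h3⟩ := H.append q e h2
      rw [h3] at h1
      obtain ⟨rfl, rfl⟩ := List.append_singleton_inj.1 h1
      exact ⟨e.2, by rw [h, H.left_inv _ (mem_nodes_of_append h2)]⟩

theorem trans (H : IsTreeIso T T' k k') (H₂ : IsTreeIso T' T'' k₂ k₂') :
    IsTreeIso T T'' (k₂ ∘ k) (k' ∘ k₂') where
  mapsTo v hv := H₂.mapsTo _ (H.mapsTo _ hv)
  mapsTo' v hv := H.mapsTo' _ (H₂.mapsTo' _ hv)
  left_inv v hv := by simp [H₂.left_inv _ (H.mapsTo _ hv), H.left_inv _ hv]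
  right_inv v hv := by simp [H.right_inv _ (H₂.mapsTo' _ hv), H₂.right_inv _ hv]
  nil := by simp [H.nil, H₂.nil]
  append p e hv := by
    obtain ⟨i, h⟩ := H.append p e hv
    have h2 := H.mapsTo _ hv
    rw [h] at h2
    obtain ⟨j, h'⟩ := H₂.append _ _ h2
    exact ⟨j, by simp [h, h']⟩

theorem nodeClass_eq (H : IsTreeIso T T' k k') {v : Address} (hv : v ∈ T.nodes) :
    Address.nodeClass (k v) = Address.nodeClass v := by
  rcases List.eq_nil_or_concat' v with rfl | ⟨p, e, rfl⟩
  · rw [H.nil]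
  · obtain ⟨i, h⟩ := H.append p e hv
    rw [h, Address.nodeClass_append, Address.nodeClass_append]

theorem ne_nil (H : IsTreeIso T T' k k') {v : Address} (hv : v ∈ T.nodes) (hne : v ≠ []) :
    k v ≠ [] := by
  obtain ⟨p, e, rfl⟩ := (List.eq_nil_or_concat' v).resolve_left hne
  obtain ⟨i, h⟩ := H.append p e hv
  simp [h]

theorem exists_append (H : IsTreeIso T T' k k') {a : Address} (ha : a ∈ T.nodes) (hne : a ≠ []) :
    ∃ (p : Address) (e e' : ClauseType × ℕ), a = p ++ [e] ∧
      p ∈ T.nodes ∧ a ∈ T.nodes ∧ k a = k p ++ [e'] ∧ e'.1 = e.1 := by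
  obtain ⟨p, e, rfl⟩ := (List.eq_nil_or_concat' a).resolve_left hne
  obtain ⟨i, h⟩ := H.append p e ha
  exact ⟨p, e, _, rfl, mem_nodes_of_append ha, ha, h, rfl⟩

theorem isomorphic (H : IsTreeIso T T' k k') : Isomorphic T T' := by
  obtain ⟨ι, h1, h2, -⟩ := CNF.exists_iso_of_map (Φ := T.toCNF) (Ψ := T'.toCNF)
    (k := k) (k' := k') (W := T.nodes)
    (fun v hv => ⟨H.mapsTo v hv, H.left_inv v hv⟩) (fun v hv => ⟨H.mapsTo' v hv, H.right_inv v hv⟩)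
    (fun v hv => ⟨⟨H.mapsTo v hv.1, H.ne_nil hv.1 hv.2⟩, H.left_inv v hv.1⟩)
    (fun v hv => ⟨⟨H.mapsTo' v hv.1, H.symm.ne_nil hv.1 hv.2⟩, H.right_inv v hv.1⟩)
    H.injOn subset_rfl
    (fun a ha => by
      obtain ⟨p, e, e', h1, h2, h3, h4, h5⟩ := H.exists_append ha.1 ha.2
      exact ⟨p, e, e', h1, h2, h3, h4, by rw [h5]⟩) toCNF_lits toCNF_lits
  refine ⟨ι, fun v hv => ?_, fun v => ?_, fun a => ?_⟩
  · rw [h1, hv, H.nil]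
  · rw [h1, H.nodeClass_eq v.2]
  · obtain ⟨p, e, e', h3, -, -, h4, h5⟩ := H.exists_append a.2.1 a.2.2
    rw [h2, h4, h3]
    simp [h5]

end IsTreeIso

theorem Isomorphic.exists_isTreeIso (h : Isomorphic T T') : ∃ k k', IsTreeIso T T' k k' := by
  obtain ⟨ι, h0, hcls, htyp⟩ := h
  obtain ⟨k, hk, hkc, hk0, hkm, hks⟩ :=
    ι.exists_map isAddressFormula_toCNF isAddressFormula_toCNF h0
  obtain ⟨k', hk', -, -, hkm', -⟩ :=
    ι.symm.exists_map isAddressFormula_toCNF isAddressFormula_toCNF (by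
      rintro v hv
      have := h0 ⟨[], nil_mem_nodes T⟩ rfl
      have h1 : v = ι.onVars ⟨[], nil_mem_nodes T⟩ := Subtype.ext (hv.trans this.symm)
      rw [h1]
      simp [CNF.Iso.symm])
  refine ⟨k, k', hkm, hkm', fun v hv => ?_, fun v hv => ?_, hk0, fun p e hv => ?_⟩
  · have h1 := hk ⟨v, hv⟩
    have h2 := hk' (ι.onVars ⟨v, hv⟩)
    rw [h1] at h2
    rw [← h2]
    simp [CNF.Iso.symm]
  · have h1 := hk' ⟨v, hv⟩
    have h2 := hk (ι.symm.onVars ⟨v, hv⟩)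
    rw [h1] at h2
    rw [← h2]
    simp [CNF.Iso.symm]
  · obtain ⟨e', h1, -⟩ := hks p e hv
    have h2 := htyp ⟨p ++ [e], hv, by simp⟩
    rw [hkc, h1] at h2
    simp only [List.getLast?_append, List.getLast?_singleton, Option.some_or, Option.map_some,
      Option.some.injEq] at h2
    exact ⟨e'.2, by rw [h1, ← h2]⟩

theorem Isomorphic.symm (h : Isomorphic T T') : Isomorphic T' T := by
  obtain ⟨_, _, H⟩ := h.exists_isTreeIso
  exact H.symm.isomorphic

theorem Isomorphic.trans (h : Isomorphic T T') (h' : Isomorphic T' T'') : Isomorphic T T'' := by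
  obtain ⟨_, _, H⟩ := h.exists_isTreeIso
  obtain ⟨_, _, H'⟩ := h'.exists_isTreeIso
  exact (H.trans H').isomorphic

end TypedTree

open TypedTree

/-- Isomorphic trees have the same instances. -/
theorem IsInstance.of_isomorphic {n M M' ℓ : ℕ} {T T' : TypedTree ℓ}
    {Φ : Fin 2 → CNF (Fin n) (ClauseName M M')} {x : Fin n} (h : IsInstance T Φ x)
    (hT : Isomorphic T T') : IsInstance T' Φ x := by
  obtain ⟨k, k', H⟩ := hT.symm.exists_isTreeIso
  have hex : ∀ h : Fin 2, ∃ κ : CNF.Iso (T'.part h) (T.part h),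
      (∀ v, (κ.onVars v : Address) = k v) ∧ ∀ v, (κ.onClauses v : Address) = k v := by
    intro h
    obtain ⟨κ, h1, h2, -⟩ := CNF.exists_iso_of_map (Φ := T'.part h) (Ψ := T.part h)
      (k := k) (k' := k') (W := T'.nodes)
      (fun v hv => by
        rw [mem_part_vars] at hv
        rw [mem_part_vars, H.nodeClass_eq hv.1]
        exact ⟨⟨H.mapsTo v hv.1, hv.2⟩, H.left_inv v hv.1⟩)
      (fun v hv => by
        rw [mem_part_vars] at hv
        rw [mem_part_vars, H.symm.nodeClass_eq hv.1]
        exact ⟨⟨H.mapsTo' v hv.1, hv.2⟩, H.right_inv v hv.1⟩)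
      (fun v hv => by
        rw [mem_part_clauses] at hv
        rw [mem_part_clauses, H.nodeClass_eq hv.1]
        exact ⟨⟨H.mapsTo v hv.1, H.ne_nil hv.1 hv.2.1, hv.2.2⟩, H.left_inv v hv.1⟩)
      (fun v hv => by
        rw [mem_part_clauses] at hv
        rw [mem_part_clauses, H.symm.nodeClass_eq hv.1]
        exact ⟨⟨H.mapsTo' v hv.1, H.symm.ne_nil hv.1 hv.2.1, hv.2.2⟩, H.right_inv v hv.1⟩)
      H.injOn (fun v hv => (mem_part_vars.1 hv).1)
      (fun a ha => by
        rw [mem_part_clauses] at ha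
        obtain ⟨p, e, e', h1, h2, h3, h4, h5⟩ := H.exists_append ha.1 ha.2.1
        exact ⟨p, e, e', h1, h2, h3, h4, by rw [h5]⟩)
      (fun _ _ => part_lits) (fun _ _ => part_lits)
    exact ⟨κ, h1, h2⟩
  choose κ hκ hκc using hex
  obtain ⟨ι, hi0, hi1, hi2, hi3⟩ := h
  refine ⟨fun h => (κ h).trans (ι h), ?_, ?_, ?_, ?_⟩
  · intro h v hv
    exact hi0 h _ (by rw [hκ, hv, H.nil])
  · intro v w hvw hs
    exact hi1 _ _ (by rw [hκ, hκ, hvw])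
      (by rw [hκ, H.nodeClass_eq (mem_part_vars.1 v.2).1, hs])
  · intro a b hab hs
    exact hi2 _ _ (by rw [hκc, hκc, hab])
      (by rw [hκc, H.nodeClass_eq (mem_part_clauses.1 a.2).1, hs])
  · intro h a hs hs'
    obtain ⟨ha, hne, -⟩ := mem_part_clauses.1 a.2
    refine hi3 h _ (by rw [hκc, H.nodeClass_eq ha, hs]) ?_
    obtain ⟨p, e, e', h1, h2, h3, h4, h5⟩ := H.exists_append ha hne
    rw [hκc, h4, List.dropLast_concat, H.nodeClass_eq h2, ← hs', h1, List.dropLast_concat]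

/-- If a variable is an instance of two trees, then their parts are isomorphic, and the
isomorphisms preserve and agree on shared variables. -/
theorem IsInstance.exists_maps {n M M' ℓ : ℕ} {T T' : TypedTree ℓ}
    {Φ : Fin 2 → CNF (Fin n) (ClauseName M M')} {x : Fin n} (hT : T.Valid) (hT' : T'.Valid)
    (h : IsInstance T Φ x) (h' : IsInstance T' Φ x) :
    ∃ k k' : Fin 2 → Address → Address,
      (∀ h, ∀ v ∈ (T.part h).vars, k h v ∈ (T'.part h).vars ∧ k' h (k h v) = v) ∧
      (∀ h, ∀ v ∈ (T'.part h).vars, k' h v ∈ (T.part h).vars ∧ k h (k' h v) = v) ∧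
      (∀ h, k h [] = []) ∧
      (∀ h (p : Address) (e : ClauseType × ℕ), p ++ [e] ∈ (T.part h).vars →
        ∃ e', k h (p ++ [e]) = k h p ++ [e'] ∧ e'.1.2 = e.1.2) ∧
      (∀ v ∈ T.nodes, Address.nodeClass v = .shared →
        k 0 v = k 1 v ∧ ∀ h, Address.nodeClass (k h v) = .shared) ∧
      ∀ v ∈ T'.nodes, Address.nodeClass v = .shared →
        k' 0 v = k' 1 v ∧ ∀ h, Address.nodeClass (k' h v) = .shared := by
  -- Stated for an arbitrary ordered pair of trees, so that it yields both `k` and `k'`.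
  have main : ∀ {T T' : TypedTree ℓ} (hT : T.Valid) (hT' : T'.Valid)
      (ι : (h : Fin 2) → CNF.Iso (T.part h) ((Φ h).neighbourhood (2 * ℓ) x))
      (ι' : (h : Fin 2) → CNF.Iso (T'.part h) ((Φ h).neighbourhood (2 * ℓ) x)),
      (∀ (h : Fin 2) (v : (T.part h).vars), (v : Address) = [] → ((ι h).onVars v : Fin n) = x) →
      (∀ (h : Fin 2) (v : (T'.part h).vars), (v : Address) = [] → ((ι' h).onVars v : Fin n) = x) →
      (∀ (a : (T.part 0).clauses) (b : (T.part 1).clauses), (a : Address) = b →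
        Address.nodeClass a = .shared →
          ∃ i, ((ι 0).onClauses a : ClauseName M M') = .shared i ∧
            ((ι 1).onClauses b : ClauseName M M') = .shared i) →
      (∀ (a : (T'.part 0).clauses) (b : (T'.part 1).clauses), (a : Address) = b →
        Address.nodeClass a = .shared →
          ∃ i, ((ι' 0).onClauses a : ClauseName M M') = .shared i ∧
            ((ι' 1).onClauses b : ClauseName M M') = .shared i) →
      (∀ (h : Fin 2) (a : (T'.part h).clauses), Address.nodeClass a = .distinct h →
        Address.nodeClass (a : Address).dropLast = .shared →
          ∃ i, ((ι' h).onClauses a : ClauseName M M') = .distinct h i) →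
      ∃ k : Fin 2 → Address → Address,
        (∀ h (v : (T.part h).vars), (((ι h).trans (ι' h).symm).onVars v : Address) = k h v) ∧
        (∀ h, k h [] = []) ∧
        (∀ h, ∀ v ∈ (T.part h).vars, k h v ∈ (T'.part h).vars) ∧
        (∀ h (p : Address) (e : ClauseType × ℕ), p ++ [e] ∈ (T.part h).vars →
          ∃ e', k h (p ++ [e]) = k h p ++ [e'] ∧ e'.1.2 = e.1.2) ∧
        ∀ v ∈ T.nodes, Address.nodeClass v = .shared →
          k 0 v = k 1 v ∧ ∀ h, Address.nodeClass (k h v) = .shared := by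
    intro T T' hT hT' ι ι' hr hr' hsh hsh' hd'
    have hroot : ∀ h (v : (T.part h).vars), (v : Address) = [] →
        (((ι h).trans (ι' h).symm).onVars v : Address) = [] := by
      intro h v hv
      have h1 := hr h v hv
      have h2 := hr' h ⟨[], (hT'.isAddressFormula_part h).nil_mem⟩ rfl
      have h3 : (ι h).onVars v = (ι' h).onVars ⟨[], (hT'.isAddressFormula_part h).nil_mem⟩ :=
        Subtype.ext (h1.trans h2.symm)
      change (((ι' h).onVars.symm ((ι h).onVars v) : (T'.part h).vars) : Address) = []
      rw [h3, Equiv.symm_apply_apply]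
    choose k hk hkc hk0 hkm hks using fun h => ((ι h).trans (ι' h).symm).exists_map
      (hT.isAddressFormula_part h) (hT'.isAddressFormula_part h) (hroot h)
    refine ⟨k, hk, hk0, hkm, hks, ?_⟩
    intro v
    induction v using List.reverseRecOn with
    | nil => exact fun _ _ => ⟨by rw [hk0, hk0], fun h => by rw [hk0]; rfl⟩
    | append_singleton p e ih =>
      intro hv hs
      rw [Address.nodeClass_append] at hs
      have hps : Address.nodeClass p = .shared := by
        rcases hT p e hv with h1 | h1
        · exact h1
        · rw [h1, hs]
      obtain ⟨hp1, hp2⟩ := ih (mem_nodes_of_append hv) hps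
      have hmv : ∀ h, p ++ [e] ∈ (T.part h).vars := fun h =>
        mem_part_vars.2 ⟨hv, by rw [Address.nodeClass_append]; exact Or.inl hs⟩
      have hmc : ∀ h, p ++ [e] ∈ (T.part h).clauses := fun h =>
        (hT.isAddressFormula_part h).append_mem_clauses (hmv h)
      have hkc' : ∀ h, k h (p ++ [e]) ∈ (T'.part h).clauses := fun h => by
        rw [← hkc h ⟨p ++ [e], hmc h⟩]
        exact Subtype.coe_prop _
      have himg : ∀ h, (ι' h).onClauses ⟨k h (p ++ [e]), hkc' h⟩ =
          (ι h).onClauses ⟨p ++ [e], hmc h⟩ := by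
        intro h
        rw [← Equiv.eq_symm_apply]
        exact Subtype.ext (hkc h ⟨p ++ [e], hmc h⟩).symm
      obtain ⟨i, hi0, hi1⟩ := hsh ⟨_, hmc 0⟩ ⟨_, hmc 1⟩ rfl
        (by rw [Address.nodeClass_append]; exact hs)
      have hi : ∀ h, ((ι' h).onClauses ⟨k h (p ++ [e]), hkc' h⟩ : ClauseName M M') = .shared i := by
        intro h
        rw [himg]
        fin_cases h
        · exact hi0
        · exact hi1
      have hcls : ∀ h, Address.nodeClass (k h (p ++ [e])) = .shared := by
        intro h
        -- The image has a shared parent by induction. Were it `h`-distinct, its name in `T'` would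
        -- have to be distinct, but that name is `.shared i`.
        rcases (mem_part_clauses.1 (hkc' h)).2.2 with h1 | h1
        · exact h1
        · exfalso
          obtain ⟨e', he', -⟩ := hks h p e (hmv h)
          obtain ⟨j, hj⟩ := hd' h ⟨_, hkc' h⟩ h1
            (by
              change Address.nodeClass (k h (p ++ [e])).dropLast = _
              rw [he', List.dropLast_concat, hp2])
          rw [hi] at hj
          cases hj
      refine ⟨?_, hcls⟩
      have h01 : k 0 (p ++ [e]) ∈ (T'.part 1).clauses := by
        obtain ⟨h1, h2, -⟩ := mem_part_clauses.1 (hkc' 0)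
        exact mem_part_clauses.2 ⟨h1, h2, Or.inl (hcls 0)⟩
      -- Both isomorphisms of `T'` give the shared clause `k 0 (p ++ [e])` the same name, namely
      -- `.shared i`. Under `ι' 1` this is also the name of `k 1 (p ++ [e])`, so the two addresses
      -- coincide.
      obtain ⟨j, hj0, hj1⟩ := hsh' ⟨_, hkc' 0⟩ ⟨_, h01⟩ rfl (hcls 0)
      rw [hi] at hj0
      cases hj0
      have := (ι' 1).onClauses.injective (Subtype.ext (hj1.trans (hi 1).symm))
      exact congrArg Subtype.val this
  obtain ⟨ι, hi0, -, hi2, hi3⟩ := h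
  obtain ⟨ι', hi0', -, hi2', hi3'⟩ := h'
  obtain ⟨k, h1, h2, h3, h4, h5⟩ := main hT hT' ι ι' hi0 hi0' hi2 hi2' hi3'
  obtain ⟨k', h1', h2', h3', h4', h5'⟩ := main hT' hT ι' ι hi0' hi0 hi2' hi2 hi3
  refine ⟨k, k', fun h v hv => ⟨h3 h v hv, ?_⟩, fun h v hv => ⟨h3' h v hv, ?_⟩, h2, h4, h5, h5'⟩
  · have := h1' h (((ι h).trans (ι' h).symm).onVars ⟨v, hv⟩)
    rw [h1] at this
    rw [← this]
    simp [CNF.Iso.symm, CNF.Iso.trans]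
  · have := h1 h (((ι' h).trans (ι h).symm).onVars ⟨v, hv⟩)
    rw [h1'] at this
    rw [← this]
    simp [CNF.Iso.symm, CNF.Iso.trans]

/-- The formula in which the variables of class `τ` are considered. -/
def NodeClass.home : NodeClass → Fin 2
  | .shared => 0
  | .distinct h => h

theorem NodeClass.inPart_home (τ : NodeClass) : τ.InPart τ.home := by
  rcases τ with _ | h
  · exact Or.inl rfl
  · exact Or.inr rfl

/-- A variable is an instance of at most one tree up to isomorphism. -/
theorem IsInstance.isomorphic {n M M' ℓ : ℕ} {T T' : TypedTree ℓ}
    {Φ : Fin 2 → CNF (Fin n) (ClauseName M M')} {x : Fin n} (hT : T.Valid) (hT' : T'.Valid)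
    (h : IsInstance T Φ x) (h' : IsInstance T' Φ x) : Isomorphic T T' := by
  obtain ⟨k, k', hk, hk', hk0, hks, hsh, hsh'⟩ := h.exists_maps hT hT' h'
  -- The two maps agree where both are relevant, so they glue to one map that uses at each variable
  -- the formula `home` of its class.
  have agree : ∀ {h v}, v ∈ T.nodes → (Address.nodeClass v).InPart h →
      k (Address.nodeClass v).home v = k h v := by
    intro h v hv hp
    rcases hp with h1 | h1
    · rw [h1]
      obtain ⟨h2, -⟩ := hsh v hv h1
      change k 0 v = k h v
      fin_cases h
      · rfl
      · exact h2
    · rw [h1]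
      rfl
  have cls : ∀ h, ∀ v ∈ (T.part h).vars, Address.nodeClass (k h v) = Address.nodeClass v := by
    intro h v hv
    obtain ⟨h1, h2⟩ := mem_part_vars.1 hv
    rcases h2 with h3 | h3
    · rw [(hsh v h1 h3).2 h, h3]
    · obtain ⟨h4, h5⟩ := mem_part_vars.1 (hk h v hv).1
      rcases h5 with h6 | h6
      -- A shared image of a distinct variable would be pulled back by `k'` to a shared variable.
      · have := (hsh' _ h4 h6).2 h
        rw [(hk h v hv).2, h3] at this
        cases this
      · rw [h6, h3]
  have cls' : ∀ h, ∀ v ∈ (T'.part h).vars, Address.nodeClass (k' h v) = Address.nodeClass v := by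
    intro h v hv
    rw [← cls h _ (hk' h v hv).1, (hk' h v hv).2]
  have hm : ∀ {v}, v ∈ T.nodes → v ∈ (T.part (Address.nodeClass v).home).vars := fun hv =>
    mem_part_vars.2 ⟨hv, NodeClass.inPart_home _⟩
  have hm' : ∀ {v}, v ∈ T'.nodes → v ∈ (T'.part (Address.nodeClass v).home).vars := fun hv =>
    mem_part_vars.2 ⟨hv, NodeClass.inPart_home _⟩
  refine IsTreeIso.isomorphic (k := fun v => k (Address.nodeClass v).home v)
    (k' := fun v => k' (Address.nodeClass v).home v) ⟨?_, ?_, ?_, ?_, ?_, ?_⟩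
  · exact fun v hv => (mem_part_vars.1 (hk _ v (hm hv)).1).1
  · exact fun v hv => (mem_part_vars.1 (hk' _ v (hm' hv)).1).1
  · intro v hv
    simp only [cls _ v (hm hv)]
    exact (hk _ v (hm hv)).2
  · intro v hv
    simp only [cls' _ v (hm' hv)]
    exact (hk' _ v (hm' hv)).2
  · exact hk0 _
  · intro p e hv
    obtain ⟨e', h1, h2⟩ := hks _ p e (hm hv)
    have h3 := cls _ _ (hm hv)
    rw [h1, Address.nodeClass_append, Address.nodeClass_append] at h3
    have hp := mem_nodes_of_append hv
    refine ⟨e'.2, ?_⟩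
    change k _ (p ++ [e]) = k _ p ++ _
    have hpart : (Address.nodeClass p).InPart (Address.nodeClass (p ++ [e])).home :=
      (mem_part_vars.1 ((hT.isAddressFormula_part _).mem_of_append p e (hm hv))).2
    rw [h1, agree hp hpart]
    congr 2
    exact Prod.ext (Prod.ext h3 h2) rfl

end

noncomputable section

/-! ### Counting clauses -/

/-- The clause that consists of two literals. -/
def mkClause {n : ℕ} (l l' : Lit (Fin n)) (h : l.1 ≠ l'.1) : Clause n :=
  ⟨{l, l'}, by
    rw [Finset.card_pair fun hl => h (congrArg Prod.fst hl)], by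
    rw [Finset.image_insert, Finset.image_singleton, Finset.card_pair h]⟩

theorem exists_eq_mkClause {n : ℕ} (c : Clause n) : ∃ l l' h, c = mkClause l l' h := by
  obtain ⟨c, h1, h2⟩ := c
  obtain ⟨l, l', hne, rfl⟩ := Finset.card_eq_two.1 h1
  refine ⟨l, l', fun h => ?_, rfl⟩
  rw [Finset.image_insert, Finset.image_singleton, h] at h2
  simp at h2

theorem card_lit_ne {n : ℕ} (u : Fin n) :
    (Finset.univ.filter fun l : Lit (Fin n) => l.1 ≠ u).card = 2 * (n - 1) := by
  have : (Finset.univ.filter fun l : Lit (Fin n) => l.1 ≠ u) =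
      (Finset.univ.erase u) ×ˢ (Finset.univ : Finset ℤˣ) := by
    ext ⟨y, s⟩
    rw [Finset.mem_filter, Finset.mem_product, Finset.mem_erase]
    simp only [Finset.mem_univ, true_and, and_true]
  rw [this, Finset.card_product, Finset.card_erase_of_mem (Finset.mem_univ _)]
  simp [mul_comm]

theorem pair_eq_pair_iff' {α : Type} [DecidableEq α] {a b c d : α} :
    ({a, b} : Finset α) = {c, d} ↔ a = c ∧ b = d ∨ a = d ∧ b = c := by
  rw [← Finset.coe_inj, Finset.coe_pair, Finset.coe_pair, Set.pair_eq_pair_iff]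

/-- Double counting: every clause arises from exactly two ordered pairs of literals with different
variables. -/
theorem card_clause (n : ℕ) : Fintype.card (Clause n) = 2 * n * (n - 1) := by
  have h1 : Fintype.card (Σ l : Lit (Fin n), {l' : Lit (Fin n) // l'.1 ≠ l.1}) =
      2 * n * (2 * (n - 1)) := by
    rw [Fintype.card_sigma]
    simp only [Fintype.card_subtype, card_lit_ne, Finset.sum_const, Finset.card_univ, smul_eq_mul]
    rw [Fintype.card_prod, Fintype.card_units_int, Fintype.card_fin]
    ring
  let φ : (Σ l : Lit (Fin n), {l' : Lit (Fin n) // l'.1 ≠ l.1}) → Clause n :=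
    fun p => mkClause p.1 p.2.1 p.2.2.symm
  have h2 : ∀ c ∈ (Finset.univ : Finset (Clause n)),
      (Finset.univ.filter fun p => φ p = c).card = 2 := by
    intro c _
    obtain ⟨l, l', h, rfl⟩ := exists_eq_mkClause c
    have : (Finset.univ.filter fun p => φ p = mkClause l l' h) =
        {⟨l, l', h.symm⟩, ⟨l', l, h⟩} := by
      ext ⟨a, b, hab⟩
      simp only [Finset.mem_filter, Finset.mem_univ, true_and, Finset.mem_insert,
        Finset.mem_singleton, φ, mkClause, Subtype.mk.injEq, pair_eq_pair_iff']
      constructor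
      · rintro (⟨rfl, rfl⟩ | ⟨rfl, rfl⟩) <;> simp
      · rintro (h | h) <;> cases h <;> simp
    rw [this, Finset.card_pair]
    intro hcon
    exact h (congrArg (fun p => p.1.1) hcon)
  have h3 := Finset.card_eq_sum_card_fiberwise (f := φ) (s := Finset.univ) (t := Finset.univ)
    fun _ _ => Finset.mem_coe.2 (Finset.mem_univ _)
  rw [Finset.sum_congr rfl h2, Finset.card_univ, h1, Finset.sum_const, Finset.card_univ,
    smul_eq_mul] at h3
  have h4 : 2 * n * (2 * (n - 1)) = 2 * n * (n - 1) * 2 := by ring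
  omega

/-- Relative to all `2 * n * (n - 1)` clauses this is the fraction `2 / n`, the probability that a
random clause hits a given variable. -/
theorem card_clause_mem_le {n : ℕ} (u : Fin n) :
    (Finset.univ.filter fun c : Clause n => ∃ s, (u, s) ∈ c.1).card ≤ 4 * (n - 1) := by
  let φ : ℤˣ × {l' : Lit (Fin n) // l'.1 ≠ u} → Clause n :=
    fun p => mkClause (u, p.1) p.2.1 p.2.2.symm
  have h1 : (Finset.univ.filter fun c : Clause n => ∃ s, (u, s) ∈ c.1) ⊆
      Finset.univ.image φ := by
    intro c hc
    obtain ⟨-, s, hs⟩ := Finset.mem_filter.1 hc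
    obtain ⟨l, l', h, rfl⟩ := exists_eq_mkClause c
    rw [Finset.mem_image]
    simp only [mkClause, Finset.mem_insert, Finset.mem_singleton] at hs
    rcases hs with rfl | rfl
    · exact ⟨(s, ⟨l', h.symm⟩), Finset.mem_univ _, rfl⟩
    · exact ⟨(s, ⟨l, h⟩), Finset.mem_univ _, Subtype.ext (Finset.pair_comm _ _)⟩
  refine (Finset.card_le_card h1).trans (Finset.card_image_le.trans ?_)
  rw [Finset.card_univ, Fintype.card_prod, Fintype.card_subtype, card_lit_ne,
    Fintype.card_units_int]
  omega

/-! ### Expectations with respect to the uniform distribution -/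

/-- The expectation with respect to the uniform distribution. -/
def mean {Ω : Type} [Fintype Ω] (X : Ω → ℝ) : ℝ := (∑ ω, X ω) / Fintype.card Ω

section mean

variable {Ω : Type} [Fintype Ω]

theorem mean_mono {X Y : Ω → ℝ} (h : ∀ ω, X ω ≤ Y ω) : mean X ≤ mean Y :=
  div_le_div_of_nonneg_right (Finset.sum_le_sum fun ω _ => h ω) (Nat.cast_nonneg _)

theorem mean_nonneg {X : Ω → ℝ} (h : ∀ ω, 0 ≤ X ω) : 0 ≤ mean X :=
  div_nonneg (Finset.sum_nonneg fun ω _ => h ω) (Nat.cast_nonneg _)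

theorem mean_add (X Y : Ω → ℝ) : mean (fun ω => X ω + Y ω) = mean X + mean Y := by
  rw [mean, Finset.sum_add_distrib, add_div]
  rfl

theorem mean_sub (X Y : Ω → ℝ) : mean (fun ω => X ω - Y ω) = mean X - mean Y := by
  rw [mean, Finset.sum_sub_distrib, sub_div]
  rfl

theorem mean_sum {ι : Type} (s : Finset ι) (X : ι → Ω → ℝ) :
    mean (fun ω => ∑ i ∈ s, X i ω) = ∑ i ∈ s, mean (X i) := by
  rw [mean, Finset.sum_comm, Finset.sum_div]
  rfl

theorem mean_const_mul (c : ℝ) (X : Ω → ℝ) : mean (fun ω => c * X ω) = c * mean X := by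
  rw [mean, ← Finset.mul_sum, mul_div_assoc]
  rfl

theorem mean_const_le {c : ℝ} (hc : 0 ≤ c) : mean (fun _ : Ω => c) ≤ c := by
  rw [mean, Finset.sum_const, Finset.card_univ, nsmul_eq_mul, ← div_mul_eq_mul_div]
  rcases eq_or_ne (Fintype.card Ω : ℝ) 0 with h | h
  · simpa [h] using hc
  · rw [div_self h, one_mul]

open Classical in
theorem uniformProb_eq_mean (E : Set Ω) :
    uniformProb E = mean fun ω => if ω ∈ E then (1 : ℝ) else 0 := by
  rw [uniformProb, mean, Finset.sum_boole, Set.ncard_eq_toFinset_card']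
  congr 2
  refine congrArg _ (Finset.ext fun ω => ?_)
  simp

theorem uniformProb_nonneg (E : Set Ω) : 0 ≤ uniformProb E := by
  unfold uniformProb
  positivity

theorem uniformProb_mono {E F : Set Ω} (h : E ⊆ F) : uniformProb E ≤ uniformProb F :=
  div_le_div_of_nonneg_right (Nat.cast_le.2 (Set.ncard_le_ncard h (Set.toFinite _)))
    (Nat.cast_nonneg _)

theorem uniformProb_union_le (E F : Set Ω) :
    uniformProb (E ∪ F) ≤ uniformProb E + uniformProb F := by
  rw [uniformProb, uniformProb, uniformProb, ← add_div]
  exact div_le_div_of_nonneg_right (mod_cast Set.ncard_union_le E F) (Nat.cast_nonneg _)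

theorem uniformProb_compl [Nonempty Ω] (E : Set Ω) : uniformProb Eᶜ = 1 - uniformProb E := by
  have h := Set.ncard_add_ncard_compl E
  rw [Nat.card_eq_fintype_card] at h
  rw [uniformProb, uniformProb, ← h]
  have : (0 : ℝ) < E.ncard + Eᶜ.ncard := by
    have := Fintype.card_pos (α := Ω)
    rw [← h] at this
    exact_mod_cast this
  push_cast
  field_simp
  ring

/-- Markov's inequality. -/
theorem uniformProb_le_mean_div {X : Ω → ℝ} (hX : ∀ ω, 0 ≤ X ω) {c : ℝ} (hc : 0 < c) :
    uniformProb {ω | c ≤ X ω} ≤ mean X / c := by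
  classical
  rw [uniformProb_eq_mean, div_eq_inv_mul, ← mean_const_mul]
  refine mean_mono fun ω => ?_
  split_ifs with h
  · have h' : c ≤ X ω := h
    rw [← div_eq_inv_mul, le_div_iff₀ hc, one_mul]
    exact h'
  · exact mul_nonneg (inv_nonneg.2 hc.le) (hX ω)

end mean

/-! ### Probabilities of events that are determined clause by clause -/

/-- This is the independence of the clauses: a product set of samples has product probability. -/
theorem uniformProb_forall_mem {n M M' : ℕ} (A : ClauseName M M' → Finset (Clause n)) :
    uniformProb {ω : Sample n M M' | ∀ a, ω a ∈ A a} =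
      ∏ a, ((A a).card / (2 * n * (n - 1)) : ℝ) := by
  have h1 : {ω : Sample n M M' | ∀ a, ω a ∈ A a} = ↑(Fintype.piFinset A) := by
    ext ω
    simp
  have h2 : ((2 * n * (n - 1) : ℕ) : ℝ) = 2 * n * (n - 1) := by
    rcases n with _ | n
    · simp
    · push_cast
      simp
  rw [uniformProb, h1, Set.ncard_coe_finset, Fintype.card_piFinset, Fintype.card_fun, card_clause,
    Finset.prod_div_distrib, Finset.prod_const, Finset.card_univ, Nat.cast_prod, Nat.cast_pow, h2]

theorem uniformProb_forall_eq {n M M' k : ℕ} (hn : 2 ≤ n) {b : Fin k → ClauseName M M'}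
    (hb : Function.Injective b) (C : Fin k → Clause n) :
    uniformProb {ω : Sample n M M' | ∀ i, ω (b i) = C i} = ((2 * n * (n - 1) : ℝ)⁻¹) ^ k := by
  classical
  have hn' : (2 : ℝ) ≤ n := by exact_mod_cast hn
  have hN : (2 * n * (n - 1) : ℝ) ≠ 0 := by
    have : (0 : ℝ) < n - 1 := by linarith
    positivity
  have h1 : {ω : Sample n M M' | ∀ i, ω (b i) = C i} =
      {ω | ∀ a, ω a ∈ Finset.univ.filter fun c => ∀ i, b i = a → c = C i} := by
    ext ω
    simp only [Set.mem_ofPred_eq, Finset.mem_filter, Finset.mem_univ, true_and]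
    exact ⟨fun h a i hi => hi ▸ h i, fun h i => h _ i rfl⟩
  rw [h1, uniformProb_forall_mem, ← Finset.prod_subset (Finset.subset_univ (Finset.univ.image b)),
    Finset.prod_image hb.injOn]
  · rw [Finset.prod_congr rfl (g := fun _ => (2 * n * (n - 1) : ℝ)⁻¹), Finset.prod_const,
      Finset.card_univ, Fintype.card_fin]
    intro i _
    have : (Finset.univ.filter fun c => ∀ j, b j = b i → c = C j) = {C i} := by
      ext c
      simp only [Finset.mem_filter, Finset.mem_univ, true_and, Finset.mem_singleton, hb.eq_iff]
      exact ⟨fun h => h i rfl, fun h j hj => hj ▸ h⟩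
    rw [this, Finset.card_singleton, Nat.cast_one, one_div]
  · intro a _ ha
    have : (Finset.univ.filter fun c => ∀ j, b j = a → c = C j) = Finset.univ := by
      refine Finset.filter_true_of_mem fun c _ i hi => ?_
      exact absurd (Finset.mem_image.2 ⟨i, Finset.mem_univ _, hi⟩) ha
    rw [this, Finset.card_univ, card_clause]
    have : ((2 * n * (n - 1) : ℕ) : ℝ) = 2 * n * (n - 1) := by
      rw [Nat.cast_mul, Nat.cast_sub (by omega)]
      push_cast
      ring
    rw [this, div_self hN]

end

noncomputable section

/-! ### Conflicted variables -/

theorem Lit.neg_neg {V : Type} (l : Lit V) : l.neg.neg = l := by simp [Lit.neg]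

theorem Lit.neg_inj {V : Type} {l l' : Lit V} : l.neg = l'.neg ↔ l = l' :=
  ⟨fun h => by rw [← l.neg_neg, h, l'.neg_neg], fun h => h ▸ rfl⟩

theorem Lit.neg_ne {V : Type} (l : Lit V) : l.neg ≠ l := by
  intro h
  have h1 : -l.2 = l.2 := congrArg Prod.snd h
  exact units_ne_neg_self l.2 h1.symm

/-! ### Implication chains and lassos -/

section Chains

variable {V A : Type} {Φ : CNF V A}

/-- The first `k` steps of the sequence `z` of literals are implications. -/
def ImplicationChain (Φ : CNF V A) (k : ℕ) (z : ℕ → Lit V) : Prop :=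
  ∀ i < k, ∃ a ∈ Φ.clauses, Φ.lits a = {z (i + 1), (z i).neg}

theorem exists_chain_of_ucp {l₀ l : Lit V} (h : Φ.UCP {l₀} l) :
    ∃ k z, ImplicationChain Φ k z ∧ z 0 = l₀ ∧ z k = l := by
  induction h with
  | init hl => exact ⟨0, fun _ => l₀, fun i hi => absurd hi (by simp), rfl, hl.symm⟩
  | @propagate a l l' ha hal _ ih =>
    obtain ⟨k, z, hz, h0, hk⟩ := ih
    refine ⟨k + 1, fun i => if i ≤ k then z i else l, fun i hi => ?_, by simp [h0], by simp⟩
    rcases Nat.lt_succ_iff_lt_or_eq.1 hi with h | rfl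
    · simpa [h.le, Nat.succ_le_of_lt h] using hz i h
    · exact ⟨a, ha, by simpa [hk] using hal⟩

/-- Contraposition: each clause is read as an implication in the other direction. -/
theorem ImplicationChain.reverse {k : ℕ} {z : ℕ → Lit V} (h : ImplicationChain Φ k z) :
    ImplicationChain Φ k (fun i => (z (k - i)).neg) := by
  intro i hi
  obtain ⟨a, ha, hal⟩ := h (k - (i + 1)) (by omega)
  refine ⟨a, ha, ?_⟩
  rw [hal, Lit.neg_neg, Set.pair_comm, show k - (i + 1) + 1 = k - i by omega]

/-- The variable `u` lies on a chain of `k` implications in which a variable occurs twice. -/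
def OnChain (Φ : CNF V A) (u : V) (k : ℕ) : Prop :=
  ∃ z, ImplicationChain Φ k z ∧ (∃ j ≤ k, (z j).1 = u) ∧
    ∃ i j, i < j ∧ j ≤ k ∧ (z i).1 = (z j).1

/-- There are chains from `l₀` to both literals of `u`. The first one, followed by the
contrapositive of the second, leads from `l₀` through `u` to the negation of `l₀`, so the variable
of `l₀` occurs at both ends. -/
theorem Conflicted.exists_onChain {u : V} (h : Conflicted Φ u) : ∃ k, OnChain Φ u k := by
  obtain ⟨l₀, h⟩ := h
  obtain ⟨j, z, hz, hz0, hzj⟩ := exists_chain_of_ucp (h 1)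
  obtain ⟨k, w, hw, hw0, hwk⟩ := exists_chain_of_ucp (h (-1))
  have hjk : 0 < j + k := by
    by_contra h0
    obtain ⟨rfl, rfl⟩ : j = 0 ∧ k = 0 := by omega
    have := congrArg Prod.snd ((hzj.symm.trans hz0).trans (hw0.symm.trans hwk))
    exact absurd (show (1 : ℤˣ) = -1 from this) (by decide)
  have hmid : z j = (w k).neg := by simp [hzj, hwk, Lit.neg]
  refine ⟨j + k, fun i => if i ≤ j then z i else (w (j + k - i)).neg, ?_,
    ⟨j, by omega, by simp [hzj]⟩, 0, j + k, hjk, le_rfl, ?_⟩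
  · intro i hi
    rcases lt_or_ge i j with h1 | h1
    · simpa [h1.le, Nat.succ_le_of_lt h1] using hz i h1
    · obtain ⟨a, ha, hal⟩ := hw.reverse (i - j) (by omega)
      refine ⟨a, ha, ?_⟩
      rw [hal]
      beta_reduce
      have e1 : k - (i - j + 1) = j + k - (i + 1) := by omega
      have e2 : k - (i - j) = j + k - i := by omega
      have e3 : ¬ i + 1 ≤ j := by omega
      rw [e1, e2]
      simp only [e3, if_false]
      split_ifs with h2
      · obtain rfl : i = j := by omega
        rw [hmid, Nat.add_sub_cancel_left]
      · rfl
  · simp only [Nat.zero_le, if_true, hz0]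
    split_ifs with h1
    · obtain rfl : k = 0 := by omega
      have h2 : l₀ = (u, -1) := by rw [← hw0, hwk]
      rw [add_zero, hzj, h2]
    · simp [hw0, Lit.neg]

/-- The variable `u` lies on a chain of `k` implications in which only the variable of the last
literal occurs twice. -/
def OnLasso (Φ : CNF V A) (u : V) (k : ℕ) : Prop :=
  ∃ z, ImplicationChain Φ k z ∧ (∀ i j, i < j → j < k → (z i).1 ≠ (z j).1) ∧
    (∃ i < k, (z k).1 = (z i).1) ∧ ∃ j < k, (z j).1 = u

/-- Take a shortest chain through `u` with a repeated variable. If `u` occurs before the end, a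
repetition among the first `k` literals would survive dropping the last literal, against minimality.
If `u` occurs at the end, reversing the chain moves it to the start. -/
theorem Conflicted.exists_onLasso {u : V} (h : Conflicted Φ u) : ∃ k, OnLasso Φ u k := by
  classical
  have hex := h.exists_onChain
  obtain ⟨z, hz, ⟨j, hj, hju⟩, hrep⟩ := Nat.find_spec hex
  set k := Nat.find hex with hk
  have hmin : ∀ m < k, ¬ OnChain Φ u m := fun m hm => Nat.find_min hex hm
  have key : ∀ z, ImplicationChain Φ k z → (∃ j < k, (z j).1 = u) →
      (∃ i j, i < j ∧ j ≤ k ∧ (z i).1 = (z j).1) → OnLasso Φ u k := by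
    intro z hz hu hrep
    have hinj : ∀ i j, i < j → j < k → (z i).1 ≠ (z j).1 := by
      intro i j hij hj he
      obtain ⟨j', hj', hu'⟩ := hu
      exact hmin (k - 1) (by omega) ⟨z, fun i hi => hz i (by omega), ⟨j', by omega, hu'⟩,
        i, j, hij, by omega, he⟩
    refine ⟨z, hz, hinj, ?_, hu⟩
    obtain ⟨i, j, hij, hj, he⟩ := hrep
    rcases hj.lt_or_eq with h1 | rfl
    · exact absurd he (hinj i j hij h1)
    · exact ⟨i, hij, he.symm⟩
  refine ⟨k, ?_⟩
  rcases hj.lt_or_eq with h1 | rfl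
  · exact key z hz ⟨j, h1, hju⟩ hrep
  · obtain ⟨i', j', hij, hjk, he⟩ := hrep
    refine key _ hz.reverse ⟨0, by omega, hju⟩
      ⟨k - j', k - i', by omega, by omega, ?_⟩
    change (z (k - (k - j'))).1 = (z (k - (k - i'))).1
    rw [show k - (k - j') = j' by omega, show k - (k - i') = i' by omega, he]

end Chains

/-- The names of the clauses of the formula with index `h`. -/
def formulaName {M M' : ℕ} (h : Fin 2) : Fin M ⊕ Fin M' → ClauseName M M'
  | .inl i => .shared i
  | .inr i => .distinct h i

theorem formulaName_injective {M M' : ℕ} (h : Fin 2) :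
    Function.Injective (formulaName (M := M) (M' := M') h) := by
  rintro (i | i) (j | j) hij <;> simp_all [formulaName]

theorem exists_formulaName {n M M' : ℕ} {ω : Sample n M M'} {h : Fin 2} {a : ClauseName M M'}
    (ha : a ∈ (formula ω h).clauses) : ∃ i, formulaName h i = a := by
  rcases ha with ⟨i, rfl⟩ | ⟨i, rfl⟩
  · exact ⟨.inl i, rfl⟩
  · exact ⟨.inr i, rfl⟩

/-! ### First moment bound for lassos -/

section FirstMoment

variable {n M M' : ℕ}

/-- The possible chains of `k` implications in which the variable of the last literal occurs
earlier, with the names of the clauses. -/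
abbrev Lasso (n M M' k : ℕ) : Type :=
  ((Fin k → Lit (Fin n)) × (Fin k × ℤˣ)) × (Fin k → Fin M ⊕ Fin M')

/-- The literals of a lasso. -/
def Lasso.lit {k : ℕ} (q : Lasso n M M' k) : Fin (k + 1) → Lit (Fin n) :=
  Fin.snoc (α := fun _ => Lit (Fin n)) q.1.1 ((q.1.1 q.1.2.1).1, q.1.2.2)

/-- The lasso occurs in the formula with index `h`. -/
def Lasso.Occurs {k : ℕ} (q : Lasso n M M' k) (h : Fin 2) (ω : Sample n M M') : Prop :=
  Function.Injective q.2 ∧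
    ∀ r, (ω (formulaName h (q.2 r))).1 = {q.lit r.succ, (q.lit r.castSucc).neg}

/-- Either no sample contains the lasso, for instance because two of its literals do not form a
clause, or the event prescribes `k` clauses with different names. -/
theorem Lasso.uniformProb_occurs_le {k : ℕ} (hn : 2 ≤ n) (q : Lasso n M M' k) (h : Fin 2) :
    uniformProb {ω | q.Occurs h ω} ≤ ((2 * n * (n - 1) : ℝ)⁻¹) ^ k := by
  have hn' : (2 : ℝ) ≤ n := by exact_mod_cast hn
  by_cases hq : ∃ ω, q.Occurs h ω
  · obtain ⟨ω₀, hinj, hω₀⟩ := hq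
    refine (uniformProb_mono ?_).trans (uniformProb_forall_eq hn
      ((formulaName_injective h).comp hinj) fun r => ω₀ (formulaName h (q.2 r))).le
    intro ω hω r
    exact Subtype.ext ((hω.2 r).trans (hω₀ r).symm)
  · have : {ω | q.Occurs h ω} = ∅ := Set.eq_empty_of_forall_notMem fun ω hω => hq ⟨ω, hω⟩
    rw [this, uniformProb, Set.ncard_empty, Nat.cast_zero, zero_div]
    have : (0 : ℝ) ≤ n - 1 := by linarith
    positivity

/-- The last literal has only `2 * k` options, because its variable is one of the earlier `k`. The
missing factor `n` keeps the first moment bounded. -/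
theorem card_lasso (k : ℕ) :
    Fintype.card (Lasso n M M' k) = (2 * n) ^ k * (2 * k) * (M + M') ^ k := by
  simp only [Lasso, Fintype.card_prod, Fintype.card_fun, Fintype.card_fin, Fintype.card_sum,
    Fintype.card_units_int]
  ring

/-- As the first `k` variables are distinct, `k ≤ n` and no clause is used twice. A clause used at
positions `r < r'` would have the negation of `z r'` equal to `z (r + 1)` or to the negation of `z
r`; the variables differ except for `r' = r + 1`, and there a literal would be its own negation.
Distinct names make the prescribed clauses independent. -/
theorem OnLasso.exists_lasso {h : Fin 2} {ω : Sample n M M'} {u : Fin n} {k : ℕ}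
    (H : OnLasso (formula ω h) u k) :
    k ≤ n ∧ ∃ q : Lasso n M M' k, q.Occurs h ω ∧ ∃ j, (q.1.1 j).1 = u := by
  obtain ⟨z, hz, hinj, ⟨i, hi, hzi⟩, j, hj, hju⟩ := H
  have hinj' : Function.Injective fun r : Fin k => (z r).1 := by
    intro r r' hr
    by_contra hne
    rcases lt_or_gt_of_ne hne with h1 | h1
    · exact hinj r r' h1 r'.2 hr
    · exact hinj r' r h1 r.2 hr.symm
  refine ⟨by simpa using Fintype.card_le_of_injective _ hinj', ?_⟩
  have hz' : ∀ r : Fin k, ∃ b, (ω (formulaName h b)).1 = {z (r + 1), (z r).neg} := by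
    intro r
    obtain ⟨a, ha, hal⟩ := hz r r.2
    obtain ⟨b, rfl⟩ := exists_formulaName ha
    refine ⟨b, Finset.coe_injective ?_⟩
    rw [Finset.coe_pair]
    exact hal
  choose b hb using hz'
  have hlit : ∀ (r : ℕ) (hr : r < k + 1), (Fin.snoc (α := fun _ => Lit (Fin n)) (fun r : Fin k =>
      z r) ((z i).1, (z k).2) : Fin (k + 1) → Lit (Fin n)) ⟨r, hr⟩ = z r := by
    intro r hr
    rcases Nat.lt_succ_iff_lt_or_eq.1 hr with h1 | rfl
    · exact Fin.snoc_castSucc (α := fun _ => Lit (Fin n)) _ _ ⟨r, h1⟩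
    · exact (Fin.snoc_last (α := fun _ => Lit (Fin n)) _ _).trans (Prod.ext hzi.symm rfl)
  refine ⟨((fun r => z r, (⟨i, hi⟩, (z k).2)), b), ⟨?_, fun r => ?_⟩, ⟨j, hj⟩, hju⟩
  · have hne : ∀ r r' : Fin k, r < r' → b r ≠ b r' := by
      intro r r' hr he
      have h1 := hb r
      rw [he, hb r'] at h1
      have h2 : (z r').neg ∈ ({z (r + 1), (z r).neg} : Finset (Lit (Fin n))) := by
        rw [← h1]; simp
      rw [Finset.mem_insert, Finset.mem_singleton, Lit.neg_inj] at h2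
      rcases h2 with h2 | h2
      · have h3 : (z r').neg.1 = (z (r + 1)).1 := congrArg Prod.fst h2
        rcases (Nat.succ_le_of_lt (Fin.lt_def.1 hr)).lt_or_eq with h4 | h4
        · exact hinj _ _ h4 r'.2 h3.symm
        · rw [show (r : ℕ) + 1 = r' from h4] at h2
          exact Lit.neg_ne _ h2
      · exact hinj _ _ hr r'.2 (congrArg Prod.fst h2.symm)
    intro r r' he
    by_contra hcon
    rcases lt_or_gt_of_ne hcon with h1 | h1
    · exact hne _ _ h1 he
    · exact hne _ _ h1 he.symm
  · have h1 := hlit (r + 1) (by omega)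
    have h2 := hlit r (by omega)
    change (ω (formulaName h (b r))).1 = _
    rw [hb r]
    simp only [Lasso.lit]
    congr 1
    · exact h1.symm
    · exact congrArg (fun l : Lit (Fin n) => ({l.neg} : Finset (Lit (Fin n)))) h2.symm

/-- Each conflicted variable is among the first `k` variables of an occurring lasso, which explains
the factor `k`. -/
theorem ncard_conflicted_le (h : Fin 2) (ω : Sample n M M')
    [∀ k (q : Lasso n M M' k), Decidable (q.Occurs h ω)] :
    ({u | Conflicted (formula ω h) u}.ncard : ℝ) ≤
      ∑ k ∈ Finset.range (n + 1), ∑ q : Lasso n M M' k, (k : ℝ) * if q.Occurs h ω then 1 else 0 := by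
  classical
  have h1 : {u | Conflicted (formula ω h) u} ⊆ ↑((Finset.range (n + 1)).biUnion fun k =>
      (Finset.univ.filter fun q : Lasso n M M' k => q.Occurs h ω).biUnion fun q =>
        Finset.univ.image fun j => (q.1.1 j).1) := by
    intro u hu
    obtain ⟨k, hk⟩ := Conflicted.exists_onLasso hu
    obtain ⟨hkn, q, hq, j, hj⟩ := hk.exists_lasso
    simp only [Finset.coe_biUnion, Set.mem_iUnion, Finset.mem_coe, Finset.mem_range,
      Finset.mem_filter, Finset.mem_univ, true_and, Finset.mem_image]
    exact ⟨k, by omega, q, hq, j, hj⟩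
  have h2 := Set.ncard_le_ncard h1 (Set.toFinite _)
  rw [Set.ncard_coe_finset] at h2
  refine (Nat.cast_le.2 (h2.trans (Finset.card_biUnion_le))).trans ?_
  rw [Nat.cast_sum]
  refine Finset.sum_le_sum fun k _ => ?_
  rw [← Finset.mul_sum, Finset.sum_boole, ← Nat.cast_mul, Nat.cast_le, mul_comm]
  refine Finset.card_biUnion_le_card_mul _ _ _ fun q _ => ?_
  exact Finset.card_image_le.trans (by simp)

theorem lasso_weight_eq {k : ℕ} (hn : 2 ≤ n) :
    (((2 * n) ^ k * (2 * k) * (M + M') ^ k : ℕ) : ℝ) * (k * ((2 * n * (n - 1) : ℝ)⁻¹) ^ k) =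
      2 * ((k : ℝ) ^ 2 * (((M + M' : ℕ) : ℝ) / (n - 1)) ^ k) := by
  have hn2 : (2 : ℝ) ≤ n := by exact_mod_cast hn
  have h1 : (2 * n : ℝ) ≠ 0 := by positivity
  have h2 : (2 * n : ℝ) ^ k * ((2 * n : ℝ)⁻¹) ^ k = 1 := by
    rw [← mul_pow, mul_inv_cancel₀ h1, one_pow]
  push_cast
  rw [mul_inv, mul_pow ((2 * n : ℝ)⁻¹), div_eq_mul_inv, mul_pow ((M : ℝ) + M')]
  linear_combination (2 * (k : ℝ) ^ 2 * ((M : ℝ) + M') ^ k * ((n - 1 : ℝ)⁻¹) ^ k) * h2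

open Classical in
theorem mean_lasso_le (hn : 2 ≤ n) (h : Fin 2) (k : ℕ) :
    mean (fun ω : Sample n M M' => ∑ q : Lasso n M M' k,
      (k : ℝ) * if q.Occurs h ω then 1 else 0) ≤
      2 * ((k : ℝ) ^ 2 * (((M + M' : ℕ) : ℝ) / (n - 1)) ^ k) := by
  rw [mean_sum]
  have hq : ∀ q ∈ (Finset.univ : Finset (Lasso n M M' k)),
      mean (fun ω => (k : ℝ) * if q.Occurs h ω then (1 : ℝ) else 0) ≤
        k * ((2 * n * (n - 1) : ℝ)⁻¹) ^ k := by
    intro q _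
    rw [mean_const_mul]
    refine mul_le_mul_of_nonneg_left ?_ (Nat.cast_nonneg _)
    have := q.uniformProb_occurs_le hn h
    rwa [uniformProb_eq_mean] at this
  refine (Finset.sum_le_sum hq).trans ?_
  rw [Finset.sum_const, Finset.card_univ, card_lasso, nsmul_eq_mul, lasso_weight_eq hn]

theorem summable_two_mul_sq_mul_geometric {ρ : ℝ} (h0 : 0 ≤ ρ) (h1 : ρ < 1) :
    Summable fun k : ℕ => 2 * ((k : ℝ) ^ 2 * ρ ^ k) := by
  have h2 : ‖ρ‖ < 1 := by rwa [Real.norm_of_nonneg h0]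
  have h3 : Summable fun k : ℕ => (k : ℝ) ^ 2 * ρ ^ k :=
    summable_pow_mul_geometric_of_norm_lt_one 2 h2
  exact h3.mul_left 2

open Classical in
/-- The expected number of conflicted variables is bounded. -/
theorem mean_conflicted_le (hn : 2 ≤ n) (h : Fin 2) {ρ : ℝ} (hρ1 : ρ < 1)
    (hm : ((M + M' : ℕ) : ℝ) / (n - 1) ≤ ρ) :
    mean (fun ω : Sample n M M' => ({u | Conflicted (formula ω h) u}.ncard : ℝ)) ≤
      ∑' k : ℕ, 2 * ((k : ℝ) ^ 2 * ρ ^ k) := by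
  have hn' : (0 : ℝ) < n - 1 := by
    have : (2 : ℝ) ≤ n := by exact_mod_cast hn
    linarith
  have hm0 : 0 ≤ ((M + M' : ℕ) : ℝ) / (n - 1) := div_nonneg (Nat.cast_nonneg _) hn'.le
  have hρ0 : 0 ≤ ρ := hm0.trans hm
  have hsum := summable_two_mul_sq_mul_geometric hρ0 hρ1
  have h1 : mean (fun ω : Sample n M M' => ({u | Conflicted (formula ω h) u}.ncard : ℝ)) ≤
      mean (fun ω : Sample n M M' => ∑ k ∈ Finset.range (n + 1), ∑ q : Lasso n M M' k,
        (k : ℝ) * if q.Occurs h ω then 1 else 0) :=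
    mean_mono fun ω => ncard_conflicted_le h ω
  have h2 : mean (fun ω : Sample n M M' => ∑ k ∈ Finset.range (n + 1), ∑ q : Lasso n M M' k,
      (k : ℝ) * if q.Occurs h ω then 1 else 0) ≤
      ∑ k ∈ Finset.range (n + 1), 2 * ((k : ℝ) ^ 2 * ρ ^ k) := by
    rw [mean_sum]
    refine Finset.sum_le_sum fun k _ => (mean_lasso_le hn h k).trans ?_
    exact mul_le_mul_of_nonneg_left (mul_le_mul_of_nonneg_left (pow_le_pow_left₀ hm0 hm k)
      (sq_nonneg _)) zero_le_two
  have h3 : ∑ k ∈ Finset.range (n + 1), 2 * ((k : ℝ) ^ 2 * ρ ^ k) ≤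
      ∑' k : ℕ, 2 * ((k : ℝ) ^ 2 * ρ ^ k) :=
    hsum.sum_le_tsum _ fun k _ => mul_nonneg zero_le_two (mul_nonneg (sq_nonneg _)
      (pow_nonneg hρ0 k))
  exact h1.trans (h2.trans h3)

end FirstMoment

end

noncomputable section

/-! ### Realized trees with conflicted variables -/

section Conflicts

open treePattern Classical

variable {ℓ n M M' : ℕ}

/-- The names of the clauses of the formula with index `h` that contain the variable `u`. -/
def incidentNames (ω : Sample n M M') (h : Fin 2) (u : Fin n) : Finset (ClauseName M M') :=
  Finset.univ.filter fun a => a ∈ (formula ω h).clauses ∧ ∃ s, (u, s) ∈ (ω a).1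

/-- The variables that can be reached from `u` by a path that consists of `k` clauses of the
formula with index `h` and leaves only variables with at most `K` incident clauses. -/
def boundedReach (ω : Sample n M M') (h : Fin 2) (K : ℕ) : ℕ → Fin n → Finset (Fin n)
  | 0, u => {u}
  | k + 1, u => if (incidentNames ω h u).card ≤ K then
      (incidentNames ω h u).biUnion fun a =>
        ((ω a).1.image Prod.fst).biUnion fun y => boundedReach ω h K k y
    else ∅

theorem card_boundedReach_le (ω : Sample n M M') (h : Fin 2) (K : ℕ) : ∀ (k : ℕ) (u : Fin n),
    (boundedReach ω h K k u).card ≤ (2 * K) ^ k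
  | 0, u => by simp [boundedReach]
  | k + 1, u => by
    rw [boundedReach]
    split_ifs with hK
    · have h1 : ((incidentNames ω h u).biUnion fun a =>
          ((ω a).1.image Prod.fst).biUnion fun y => boundedReach ω h K k y).card ≤
          (incidentNames ω h u).card * (2 * (2 * K) ^ k) := by
        refine Finset.card_biUnion_le_card_mul _ _ _ fun a _ => ?_
        refine (Finset.card_biUnion_le_card_mul _ _ _
          fun y _ => card_boundedReach_le ω h K k y).trans ?_
        exact Nat.mul_le_mul_right _ (ω a).2.2.le
      refine h1.trans ((Nat.mul_le_mul_right _ hK).trans (le_of_eq ?_))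
      ring
    · simp

/-- Climb from `v` to the root. Every variable left on the way is inner, so all its clauses in the
formula with index `h` belong to the tree, and the number of clauses of the tree bounds its degree.
-/
theorem root_mem_boundedReach {T : TypedTree ℓ} {ω : Sample n M M'} {f : (treePattern T).V → Fin n}
    {g : (treePattern T).S → ClauseName M M'} (H : (treePattern T).Realized ω f g) {h : Fin 2}
    (v : Address) (hv : v ∈ T.nodes) (hl : v.length < ℓ) (hp : (Address.nodeClass v).InPart h) :
    f (node [] (TypedTree.nil_mem_nodes T)) ∈
      boundedReach ω h (Fintype.card (treePattern T).S) v.length (f (node v hv)) := by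
  induction v using List.reverseRecOn with
  | nil => simp [boundedReach]
  | append_singleton p e ih =>
    rw [Address.nodeClass_append] at hp
    obtain ⟨hpp, hmem⟩ := inPart_of_clause H hv hp
    have hin : node (p ++ [e]) hv ∈ (treePattern T).inner := node_mem_inner.2 hl
    have hsub : incidentNames ω h (f (node (p ++ [e]) hv)) ⊆ Finset.univ.image g := by
      intro a ha
      obtain ⟨-, ha, s, hs⟩ := Finset.mem_filter.1 ha
      obtain ⟨σ, hσ, -⟩ := childClass_of_mem (τ := e.1.1) hp ha
      obtain ⟨t, rfl, -⟩ := H.exists_of_mem hin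
        (by rw [cls_node, Address.nodeClass_append, hσ]; simp) hs
      exact Finset.mem_image_of_mem _ (Finset.mem_univ _)
    have hcard := (Finset.card_le_card hsub).trans Finset.card_image_le
    rw [Finset.card_univ] at hcard
    rw [List.length_append, List.length_singleton, boundedReach, if_pos hcard]
    have hc := H.lits_eq (clause p e hv)
    rw [par_clause, child_clause, typ_clause] at hc
    refine Finset.mem_biUnion.2 ⟨g (clause p e hv), ?_, Finset.mem_biUnion.2
      ⟨f (node p (TypedTree.mem_nodes_of_append hv)), ?_, ?_⟩⟩
    · refine Finset.mem_filter.2 ⟨Finset.mem_univ _, hmem, e.1.2.2, ?_⟩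
      rw [hc]; simp
    · rw [hc]; simp
    · exact ih _ (TypedTree.length_lt_of_append hv) hpp

/-- The variables at which the tree is realized. -/
def realizedRoots (T : TypedTree ℓ) (ω : Sample n M M') : Set (Fin n) :=
  {x | ∃ f g, (treePattern T).Realized ω f g ∧ f (node [] (TypedTree.nil_mem_nodes T)) = x}

/-- The variables at which the tree is realized, but with a conflicted variable. -/
def conflictedRoots (T : TypedTree ℓ) (ω : Sample n M M') : Set (Fin n) :=
  {x | ∃ f g, (treePattern T).Realized ω f g ∧ f (node [] (TypedTree.nil_mem_nodes T)) = x ∧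
    ¬ Unconflicted T ω f}

/-- Roots are counted from the conflicted variables: one that sits at depth `2 * k` in the tree
accounts for at most `(2 * card S) ^ k` roots. -/
theorem ncard_conflictedRoots_le (T : TypedTree ℓ) (ω : Sample n M M') :
    (conflictedRoots T ω).ncard ≤ ∑ h : Fin 2, {u | Conflicted (formula ω h) u}.ncard *
      ∑ k ∈ Finset.range ℓ, (2 * Fintype.card (treePattern T).S) ^ k := by
  have h1 : conflictedRoots T ω ⊆ ↑((Finset.univ : Finset (Fin 2)).biUnion fun h =>
      (Finset.univ.filter fun u => Conflicted (formula ω h) u).biUnion fun u =>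
        (Finset.range ℓ).biUnion fun k =>
          boundedReach ω h (Fintype.card (treePattern T).S) k u) := by
    rintro x ⟨f, g, H, rfl, hU⟩
    simp only [Unconflicted, not_forall, not_not] at hU
    obtain ⟨h, v, hv, hp, hc⟩ := hU
    obtain ⟨w, hw, rfl⟩ := exists_eq_node v
    rw [node_mem_inner] at hv
    have := root_mem_boundedReach H w hw hv hp
    simp only [Finset.coe_biUnion, Set.mem_iUnion, Finset.mem_coe, Finset.mem_range,
      Finset.mem_filter, Finset.mem_univ, true_and]
    exact ⟨h, trivial, _, hc, _, hv, this⟩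
  have h2 := Set.ncard_le_ncard h1 (Set.toFinite _)
  rw [Set.ncard_coe_finset] at h2
  refine h2.trans (Finset.card_biUnion_le.trans (Finset.sum_le_sum fun h _ => ?_))
  have h3 : {u | Conflicted (formula ω h) u}.ncard =
      (Finset.univ.filter fun u => Conflicted (formula ω h) u).card := by
    rw [← Set.ncard_coe_finset]
    congr 1
    ext u
    simp
  rw [h3]
  refine Finset.card_biUnion_le_card_mul _ _ _ fun u _ => ?_
  exact Finset.card_biUnion_le.trans (Finset.sum_le_sum fun k _ => card_boundedReach_le _ _ _ _ _)

theorem disjoint_realizedRoots {T T' : TypedTree ℓ} (h : T ≠ T') (ω : Sample n M M') :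
    Disjoint (realizedRoots T ω) (realizedRoots T' ω) := by
  rw [Set.disjoint_left]
  rintro x ⟨f, g, H, rfl⟩ ⟨f', g', H', hx⟩
  exact h (realized_unique H H' hx.symm)

theorem sum_ncard_le_ncard {ι α : Type} [Finite α] (F : Finset ι) (A : ι → Set α) {B : Set α}
    (hA : ∀ i ∈ F, A i ⊆ B) (hd : ∀ i ∈ F, ∀ j ∈ F, i ≠ j → Disjoint (A i) (A j)) :
    ∑ i ∈ F, (A i).ncard ≤ B.ncard := by
  have := Fintype.ofFinite α
  have h1 : ∀ i, (A i).ncard = (A i).toFinset.card := fun i => Set.ncard_eq_toFinset_card' _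
  rw [Finset.sum_congr rfl fun i _ => h1 i, ← Finset.card_biUnion, ← Set.ncard_coe_finset]
  · refine Set.ncard_le_ncard ?_ (Set.toFinite _)
    simpa using hA
  · intro i hi j hj hij
    simpa using hd i hi j hj hij

theorem sum_ncard_realizedRoots_le (F : Finset (TypedTree ℓ)) (ω : Sample n M M') :
    ∑ T ∈ F, (realizedRoots T ω).ncard ≤ n := by
  have := sum_ncard_le_ncard F (fun T => realizedRoots T ω) (B := Set.univ)
    (fun _ _ => Set.subset_univ _) fun T _ T' _ h => disjoint_realizedRoots h ω
  simpa [Set.ncard_univ] using this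

/-- The number of instances is bounded from below by the numbers of variables at which an
isomorphic tree is realized without conflicts. -/
theorem le_numInstances (T : TypedTree ℓ) (F : Finset (TypedTree ℓ))
    (hF : ∀ T' ∈ F, T'.Isomorphic T) (ω : Sample n M M') :
    ∑ T' ∈ F, (realizedRoots T' ω).ncard ≤
      numInstances T ω + ∑ T' ∈ F, (conflictedRoots T' ω).ncard := by
  have h1 : ∑ T' ∈ F, (realizedRoots T' ω \ conflictedRoots T' ω).ncard ≤ numInstances T ω := by
    refine sum_ncard_le_ncard F _ ?_ ?_
    · rintro T' hT' x ⟨⟨f, g, H, rfl⟩, hx⟩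
      have hU : Unconflicted T' ω f := by
        by_contra hU
        exact hx ⟨f, g, H, rfl, hU⟩
      exact (isInstance_of_realized H hU).of_isomorphic (hF T' hT')
    · intro T₁ _ T₂ _ h
      exact (disjoint_realizedRoots h ω).mono Set.sdiff_subset Set.sdiff_subset
  refine le_trans (Finset.sum_le_sum fun T' _ => ?_)
    (Finset.sum_add_distrib.trans_le (Nat.add_le_add_right h1 _))
  have := Set.ncard_le_ncard_sdiff_add_ncard (realizedRoots T' ω) (conflictedRoots T' ω)
    (Set.toFinite _)
  exact this

/-- The number of instances is bounded from above in terms of the numbers of variables at which a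
tree that is not isomorphic is realized without conflicts. -/
theorem numInstances_le (T : TypedTree ℓ) (hT : ∃ T₀ : TypedTree ℓ, T₀.Isomorphic T ∧ T₀.Valid)
    (F : Finset (TypedTree ℓ)) (hF : ∀ T' ∈ F, ¬ T'.Isomorphic T) (hF' : ∀ T' ∈ F, T'.Valid)
    (ω : Sample n M M') :
    numInstances T ω + ∑ T' ∈ F, (realizedRoots T' ω).ncard ≤
      n + ∑ T' ∈ F, (conflictedRoots T' ω).ncard := by
  obtain ⟨T₀, hT₀, hv₀⟩ := hT
  set I : Set (Fin n) := {x | IsInstance T (fun h => (formula ω h).prune) x} with hI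
  have h1 : ∑ T' ∈ F, (realizedRoots T' ω \ conflictedRoots T' ω).ncard ≤ Iᶜ.ncard := by
    refine sum_ncard_le_ncard F _ ?_ ?_
    · rintro T' hT' x ⟨⟨f, g, H, rfl⟩, hx⟩ hcon
      have hU : Unconflicted T' ω f := by
        by_contra hU
        exact hx ⟨f, g, H, rfl, hU⟩
      -- A variable that is an instance of both trees would make `T'` isomorphic to `T`.
      have h2 := (isInstance_of_realized H hU).isomorphic (hF' T' hT') hv₀
        (IsInstance.of_isomorphic hcon hT₀.symm)
      exact hF T' hT' (h2.trans hT₀)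
    · intro T₁ _ T₂ _ h
      exact (disjoint_realizedRoots h ω).mono Set.sdiff_subset Set.sdiff_subset
  have h2 : ∑ T' ∈ F, (realizedRoots T' ω).ncard ≤
      Iᶜ.ncard + ∑ T' ∈ F, (conflictedRoots T' ω).ncard := by
    refine le_trans (Finset.sum_le_sum fun T' _ => ?_)
      (Finset.sum_add_distrib.trans_le (Nat.add_le_add_right h1 _))
    exact Set.ncard_le_ncard_sdiff_add_ncard (realizedRoots T' ω) (conflictedRoots T' ω)
      (Set.toFinite _)
  have h3 := Set.ncard_add_ncard_compl I
  rw [Nat.card_eq_fintype_card, Fintype.card_fin] at h3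
  have h4 : numInstances T ω = I.ncard := rfl
  omega

end Conflicts

end

noncomputable section

/-! ### The expected number of realizations of a pattern -/

section InjectionCount

open Classical

/-- Greedy choice: at each step at most `K` elements have been used. Truncated subtraction makes the
bound trivial when some `A s` is small. -/
theorem prod_card_sub_le_card_injective_fin {N : Type} [Fintype N] (K : ℕ) : ∀ (k : ℕ), k ≤ K →
    ∀ A : Fin k → Finset N, ∏ s, ((A s).card - K) ≤
      (Finset.univ.filter fun g : Fin k → N => Function.Injective g ∧ ∀ s, g s ∈ A s).card
  | 0, _, A => by
    rw [Finset.filter_true_of_mem fun g _ => ⟨Function.injective_of_subsingleton g, fun s => s.elim0⟩]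
    simp
  | k + 1, hk, A => by
    have ih := prod_card_sub_le_card_injective_fin K k (by omega) fun s => A s.succ
    set G := Finset.univ.filter fun g : Fin k → N => Function.Injective g ∧ ∀ s, g s ∈ A s.succ
    have h1 : (G.sigma fun g => A 0 \ Finset.univ.image g).card ≤
        (Finset.univ.filter fun g : Fin (k + 1) → N =>
          Function.Injective g ∧ ∀ s, g s ∈ A s).card := by
      refine Finset.card_le_card_of_injOn (fun p => Fin.cons p.2 p.1) ?_ ?_
      · rintro ⟨g, a⟩ hp
        simp only [Finset.mem_coe, Finset.mem_sigma, Finset.mem_filter, Finset.mem_univ, true_and,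
          Finset.mem_sdiff, Finset.mem_image, G] at hp ⊢
        obtain ⟨⟨h1, h2⟩, h3, h4⟩ := hp
        refine ⟨Fin.cons_injective_iff.2 ⟨?_, h1⟩, fun s => ?_⟩
        · rintro ⟨s, hs⟩
          exact h4 ⟨s, hs⟩
        · refine Fin.cases ?_ (fun s => ?_) s
          · simpa using h3
          · simpa using h2 s
      · rintro ⟨g, a⟩ - ⟨g', a'⟩ - h
        obtain ⟨h1, h2⟩ := Fin.cons_inj.1 h
        subst h1 h2
        rfl
    refine le_trans ?_ h1
    rw [Finset.card_sigma, Fin.prod_univ_succ, mul_comm]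
    refine (Nat.mul_le_mul_right _ ih).trans ?_
    rw [← smul_eq_mul, ← Finset.sum_const]
    refine Finset.sum_le_sum fun g _ => ?_
    refine le_trans ?_ (Finset.le_card_sdiff _ _)
    have : (Finset.univ.image g).card ≤ k := Finset.card_image_le.trans (by simp)
    omega

/-- A lower bound on the number of injective choice functions. -/
theorem prod_card_sub_le_card_injective {S N : Type} [Fintype S] [Fintype N]
    (A : S → Finset N) : ∏ s, ((A s).card - Fintype.card S) ≤
      (Finset.univ.filter fun g : S → N => Function.Injective g ∧ ∀ s, g s ∈ A s).card := by
  let e := Fintype.equivFin S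
  have h := prod_card_sub_le_card_injective_fin (Fintype.card S) _ le_rfl fun i => A (e.symm i)
  rw [← e.symm.prod_comp]
  refine h.trans (Finset.card_le_card_of_injOn (fun g => g ∘ e) ?_ ?_)
  · intro g hg
    simp only [Finset.coe_filter, Finset.mem_univ, true_and, Set.mem_ofPred_eq] at hg ⊢
    exact ⟨hg.1.comp e.injective, fun s => by simpa using hg.2 (e s)⟩
  · intro g _ g' _ h
    exact e.surjective.injective_comp_right h

end InjectionCount

namespace Pattern

open Classical

variable (P : Pattern) {n M M' : ℕ}

/-- The block of a clause: its parent and its type. -/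
def block (s : P.S) : P.V × ClauseType := (P.par s, P.typ s)

/-- The number of ways in which the siblings of the same types can be permuted. -/
def siblingFactorial : ℕ := ∏ b, (Fintype.card {s // P.block s = b}).factorial

/-- Rearrangement inequality: a permutation within the blocks that maximizes the sum of index times
rank is sorted, since swapping two siblings in the wrong order would increase the sum. -/
theorem exists_perm_sorted {g : P.S → ClauseName M M'} (hinj : Function.Injective g)
    (hc : ∀ s, childClass (P.cls (P.par s)) (g s) = some (P.typ s).1) :
    ∃ σ : {σ : Equiv.Perm P.S // P.block ∘ σ = P.block}, P.Sorted (g ∘ σ.1) := by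
  let Γ := {σ : Equiv.Perm P.S // P.block ∘ σ = P.block}
  let Φ : Γ → ℤ := fun σ => ∑ s, (P.idx s : ℤ) * nameRank (g (σ.1 s))
  have : Nonempty Γ := ⟨⟨1, rfl⟩⟩
  obtain ⟨σ, hσ⟩ := Finite.exists_max Φ
  have hb : ∀ s, P.block (σ.1 s) = P.block s := fun s => congrFun σ.2 s
  have hpar : ∀ s, P.par (σ.1 s) = P.par s := fun s => congrArg Prod.fst (hb s)
  have htyp : ∀ s, P.typ (σ.1 s) = P.typ s := fun s => congrArg Prod.snd (hb s)
  refine ⟨σ, hinj.comp σ.1.injective, fun s => ?_, fun s s' h1 h2 h3 => ?_⟩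
  · rw [← hpar s, ← htyp s]
    exact hc _
  · by_contra hlt
    have hss : s ≠ s' := by
      rintro rfl
      exact lt_irrefl _ h3
    have hne : nameRank (g (σ.1 s)) ≠ nameRank (g (σ.1 s')) := fun he =>
      hss (σ.1.injective (hinj (nameRank_injective he)))
    have hgt : nameRank (g (σ.1 s')) < nameRank (g (σ.1 s)) :=
      lt_of_le_of_ne (not_lt.1 hlt) hne.symm
    have hblk : P.block s = P.block s' := Prod.ext h1 h2
    let σ' : Γ := ⟨σ.1 * Equiv.swap s s', by
      funext t
      rw [Function.comp_apply, Equiv.Perm.mul_apply, hb]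
      by_cases ht : t = s
      · rw [ht, Equiv.swap_apply_left, hblk]
      · by_cases ht' : t = s'
        · rw [ht', Equiv.swap_apply_right, hblk]
        · rw [Equiv.swap_apply_of_ne_of_ne ht ht']⟩
    have hd : Φ σ' - Φ σ = ((P.idx s' : ℤ) - P.idx s) *
        (nameRank (g (σ.1 s)) - nameRank (g (σ.1 s'))) := by
      simp only [Φ, ← Finset.sum_sub_distrib]
      rw [← Finset.sum_subset (Finset.subset_univ {s, s'}), Finset.sum_pair hss]
      · simp only [σ', Equiv.Perm.mul_apply, Equiv.swap_apply_left, Equiv.swap_apply_right]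
        ring
      · intro t _ ht
        simp only [Finset.mem_insert, Finset.mem_singleton, not_or] at ht
        simp only [σ', Equiv.Perm.mul_apply, Equiv.swap_apply_of_ne_of_ne ht.1 ht.2, sub_self]
    have h4 : (0 : ℤ) < ((P.idx s' : ℤ) - P.idx s) *
        (nameRank (g (σ.1 s)) - nameRank (g (σ.1 s'))) :=
      mul_pos (by omega) (by omega)
    have := hσ σ'
    omega

/-- An injective matching is recovered from its sorted version and the sorting permutation, and the
permutations that preserve the blocks number `siblingFactorial`. -/
theorem card_injective_le_card_sorted :
    (Finset.univ.filter fun g : P.S → ClauseName M M' => Function.Injective g ∧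
      ∀ s, g s ∈ Finset.univ.filter fun a =>
        childClass (P.cls (P.par s)) a = some (P.typ s).1).card ≤
    (Finset.univ.filter fun g : P.S → ClauseName M M' => P.Sorted g).card *
      P.siblingFactorial := by
  have h1 : P.siblingFactorial =
      (Finset.univ : Finset {σ : Equiv.Perm P.S // P.block ∘ σ = P.block}).card := by
    rw [Finset.card_univ, siblingFactorial]
    exact (DomMulAct.stabilizer_card P.block).symm.trans (Fintype.card_congr (Equiv.refl _))
  rw [h1, ← Finset.card_product]
  have hex : ∀ g : P.S → ClauseName M M', ∃ σ : {σ : Equiv.Perm P.S // P.block ∘ σ = P.block},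
      Function.Injective g → (∀ s, childClass (P.cls (P.par s)) (g s) = some (P.typ s).1) →
        P.Sorted (g ∘ σ.1) := by
    intro g
    by_cases hg : Function.Injective g ∧
        ∀ s, childClass (P.cls (P.par s)) (g s) = some (P.typ s).1
    · obtain ⟨σ, hσ⟩ := P.exists_perm_sorted hg.1 hg.2
      exact ⟨σ, fun _ _ => hσ⟩
    · exact ⟨⟨1, rfl⟩, fun h h' => absurd ⟨h, h'⟩ hg⟩
  choose σ hσ using hex
  refine Finset.card_le_card_of_injOn (fun g => (g ∘ (σ g).1, σ g)) ?_ ?_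
  · intro g hg
    simp only [Finset.coe_filter, Finset.mem_filter, Finset.mem_univ, true_and,
      Set.mem_ofPred_eq] at hg
    simp only [Finset.coe_product, Finset.coe_filter, Finset.mem_univ, true_and, Set.mem_prod,
      Set.mem_ofPred_eq, Finset.coe_univ, Set.mem_univ, and_true]
    exact hσ g hg.1 hg.2
  · intro g _ g' _ h
    obtain ⟨h1, h2⟩ := Prod.mk.inj h
    rw [h2] at h1
    exact (σ g').1.surjective.injective_comp_right h1

/-- The number of inner variables that may occur in the clause `a`. -/
def exposure (a : ClauseName M M') : ℕ :=
  (P.inner.filter fun v => childClass (P.cls v) a ≠ none).card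

theorem exposure_le (a : ClauseName M M') : P.exposure a ≤ Fintype.card P.V :=
  (Finset.card_le_card (Finset.filter_subset _ _)).trans (Finset.card_le_univ _)

/-- The event is a product event. A name in the range of `g` must carry one prescribed clause; any
other name must avoid the inner variables exposed to it, which by a union bound fails with
probability at most `2 * exposure / n`. Applying the second factor to the names in the range as well
only weakens the bound and lets the product run over all names. The condition `hV` keeps the factors
nonnegative. -/
theorem le_uniformProb_realized (hn : 2 ≤ n) (hV : 2 * Fintype.card P.V ≤ n) {f : P.V → Fin n}
    (hf : Function.Injective f) {g : P.S → ClauseName M M'} (hg : P.Sorted g) :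
    ((2 * n * (n - 1) : ℝ)⁻¹) ^ Fintype.card P.S *
        ∏ a : ClauseName M M', (1 - 2 * P.exposure a / n : ℝ) ≤
      uniformProb {ω : Sample n M M' | P.Realized ω f g} := by
  have hn' : (2 : ℝ) ≤ n := by exact_mod_cast hn
  have hn1 : (0 : ℝ) < n - 1 := by linarith
  have hN : (0 : ℝ) < 2 * n * (n - 1) := by positivity
  have hVn : (2 : ℝ) * Fintype.card P.V ≤ n := by exact_mod_cast hV
  have hx : ∀ a : ClauseName M M', 0 ≤ (1 - 2 * P.exposure a / n : ℝ) ∧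
      (1 - 2 * P.exposure a / n : ℝ) ≤ 1 := by
    intro a
    have h1 : (P.exposure a : ℝ) ≤ Fintype.card P.V := by exact_mod_cast P.exposure_le a
    have h2 : (2 * P.exposure a / n : ℝ) ≤ 1 := by
      rw [div_le_one (by linarith)]
      linarith
    have h3 : (0 : ℝ) ≤ 2 * P.exposure a / n := by positivity
    constructor <;> linarith
  let A : ClauseName M M' → Finset (Clause n) := fun a => Finset.univ.filter fun c =>
    (∀ s, g s = a → c.1 = {(f (P.par s), (P.typ s).2.1), (f (P.child s), (P.typ s).2.2)}) ∧
    (a ∉ Set.range g → ∀ v ∈ P.inner, childClass (P.cls v) a ≠ none → ∀ s, (f v, s) ∉ c.1)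
  have hA : {ω : Sample n M M' | P.Realized ω f g} = {ω | ∀ a, ω a ∈ A a} := by
    ext ω
    simp only [Set.mem_ofPred_eq, A, Finset.mem_filter, Finset.mem_univ, true_and]
    constructor
    · rintro ⟨-, -, h3, h4⟩ a
      exact ⟨fun s hs => hs ▸ h3 s, h4 a⟩
    · intro h
      exact ⟨hf, hg, fun s => (h _).1 s rfl, fun a => (h a).2⟩
  rw [hA, uniformProb_forall_mem]
  have hprod : ((2 * n * (n - 1) : ℝ)⁻¹) ^ Fintype.card P.S =
      ∏ a : ClauseName M M', if a ∈ Set.range g then (2 * n * (n - 1) : ℝ)⁻¹ else 1 := by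
    rw [← Finset.prod_filter, Finset.prod_const]
    congr 1
    rw [← Finset.card_univ, ← Finset.card_image_of_injective _ hg.injective]
    congr 1
    ext a
    simp
  rw [hprod, ← Finset.prod_mul_distrib]
  refine Finset.prod_le_prod (fun a _ => mul_nonneg ?_ (hx a).1) fun a _ => ?_
  · split_ifs
    · exact inv_nonneg.2 hN.le
    · exact zero_le_one
  · split_ifs with ha
    · obtain ⟨s, rfl⟩ := ha
      have h1 : 1 ≤ (A (g s)).card := by
        refine Finset.card_pos.2 ⟨mkClause (f (P.par s), (P.typ s).2.1)
          (f (P.child s), (P.typ s).2.2) fun h => P.child_ne_par s (hf h.symm), ?_⟩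
        refine Finset.mem_filter.2 ⟨Finset.mem_univ _, fun t ht => ?_, fun h => absurd ⟨s, rfl⟩ h⟩
        rw [hg.injective ht]
        rfl
      refine (mul_le_of_le_one_right (inv_nonneg.2 hN.le) (hx _).2).trans ?_
      rw [inv_eq_one_div]
      gcongr
      exact_mod_cast h1
    · rw [one_mul, le_div_iff₀ hN]
      have h1 : (A a)ᶜ ⊆ (P.inner.filter fun v => childClass (P.cls v) a ≠ none).biUnion fun v =>
          Finset.univ.filter fun c : Clause n => ∃ s, (f v, s) ∈ c.1 := by
        intro c hc
        simp only [A, Finset.mem_compl, Finset.mem_filter, Finset.mem_univ, true_and, not_and] at hc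
        have h2 := hc fun s hs => absurd ⟨s, hs⟩ ha
        push Not at h2
        obtain ⟨-, v, hv, hva, s, hs⟩ := h2
        simp only [Finset.mem_biUnion, Finset.mem_filter, Finset.mem_univ, true_and]
        exact ⟨v, ⟨hv, hva⟩, s, hs⟩
      have h2 : (A a)ᶜ.card ≤ P.exposure a * (4 * (n - 1)) :=
        (Finset.card_le_card h1).trans
          (Finset.card_biUnion_le_card_mul _ _ _ fun v _ => card_clause_mem_le (f v))
      have h3 : 2 * n * (n - 1) ≤ (A a).card + P.exposure a * (4 * (n - 1)) := by
        have := Finset.card_add_card_compl (A a)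
        rw [card_clause] at this
        omega
      have h4 : ((2 * n * (n - 1) : ℕ) : ℝ) ≤
          (((A a).card + P.exposure a * (4 * (n - 1)) : ℕ) : ℝ) := Nat.cast_le.2 h3
      rw [Nat.cast_add, Nat.cast_mul, Nat.cast_mul _ (4 * (n - 1)), Nat.cast_mul 4,
        Nat.cast_sub (by omega)] at h4
      push_cast at h4
      have h5 : (1 - 2 * P.exposure a / n : ℝ) * (2 * n * (n - 1)) =
          2 * n * (n - 1) - P.exposure a * (4 * (n - 1)) := by
        have : (n : ℝ) ≠ 0 := by linarith
        field_simp
        ring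
      rw [h5]
      linarith

/-- The number of realizations of the pattern. -/
def numRealized (ω : Sample n M M') : ℕ :=
  (Finset.univ.filter fun p : (P.V → Fin n) × (P.S → ClauseName M M') =>
    P.Realized ω p.1 p.2).card

theorem le_mean_numRealized (hn : 2 ≤ n) (hV : 2 * Fintype.card P.V ≤ n) :
    (n.descFactorial (Fintype.card P.V) : ℝ) *
      (Finset.univ.filter fun g : P.S → ClauseName M M' => P.Sorted g).card *
      (((2 * n * (n - 1) : ℝ)⁻¹) ^ Fintype.card P.S *
        ∏ a : ClauseName M M', (1 - 2 * P.exposure a / n : ℝ)) ≤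
      mean fun ω : Sample n M M' => (P.numRealized ω : ℝ) := by
  have h1 : ∀ ω : Sample n M M', (P.numRealized ω : ℝ) =
      ∑ p : (P.V → Fin n) × (P.S → ClauseName M M'), if P.Realized ω p.1 p.2 then 1 else 0 :=
    fun ω => by rw [numRealized, Finset.sum_boole]
  simp only [h1]
  rw [mean_sum]
  have h2 : (n.descFactorial (Fintype.card P.V) : ℝ) *
      (Finset.univ.filter fun g : P.S → ClauseName M M' => P.Sorted g).card =
      (((Finset.univ.filter fun f : P.V → Fin n => Function.Injective f) ×ˢ
        (Finset.univ.filter fun g : P.S → ClauseName M M' => P.Sorted g)).card : ℝ) := by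
    rw [Finset.card_product, Nat.cast_mul]
    congr 2
    rw [← Fintype.card_subtype,
      ← Fintype.card_congr (Equiv.subtypeInjectiveEquivEmbedding P.V (Fin n)).symm,
      Fintype.card_embedding_eq, Fintype.card_fin]
  rw [h2, ← nsmul_eq_mul, ← Finset.sum_const]
  refine le_trans (Finset.sum_le_sum fun p hp => ?_)
    (Finset.sum_le_sum_of_subset_of_nonneg (Finset.subset_univ _) fun p _ _ => ?_)
  · rw [Finset.mem_product, Finset.mem_filter, Finset.mem_filter] at hp
    have := P.le_uniformProb_realized hn hV hp.1.2 hp.2.2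
    rw [uniformProb_eq_mean] at this
    exact this
  · exact mean_nonneg fun ω => by split_ifs <;> simp

end Pattern

end

noncomputable section

/-! ### Asymptotics of the expected number of realizations -/

theorem sum_clauseName {M M' : ℕ} (F : ClauseName M M' → ℕ) :
    ∑ a, F a = ∑ i, F (.shared i) + ∑ h, ∑ i, F (.distinct h i) := by
  let e : ClauseName M M' ≃ Fin M ⊕ (Fin 2 × Fin M') :=
    { toFun := fun a => match a with
        | .shared i => .inl i
        | .distinct h i => .inr (h, i)
      invFun := fun b => match b with
        | .inl i => .shared i
        | .inr (h, i) => .distinct h i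
      left_inv := fun a => by cases a <;> rfl
      right_inv := fun b => by rcases b with i | ⟨h, i⟩ <;> rfl }
  rw [← e.symm.sum_comp, Fintype.sum_sum_type, Fintype.sum_prod_type]
  rfl

/-- The number of names of clauses that lead from a variable of class `τ` to one of class `σ`. -/
def compatibleCount (M M' : ℕ) (τ σ : NodeClass) : ℕ :=
  (Finset.univ.filter fun a : ClauseName M M' => childClass τ a = some σ).card

theorem compatibleCount_eq (M M' : ℕ) (τ σ : NodeClass) : compatibleCount M M' τ σ =
    match τ, σ with
    | .shared, .shared => M
    | .shared, .distinct _ => M'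
    | .distinct _, .shared => 0
    | .distinct h, .distinct h' => if h = h' then M + M' else 0 := by
  rw [compatibleCount, Finset.card_filter, sum_clauseName]
  rcases τ with _ | h <;> rcases σ with _ | h'
  · simp [childClass]
  · simp [childClass]
  · simp only [childClass, Fin.sum_univ_two, Option.some.injEq, reduceCtorEq, if_false,
      Finset.sum_const_zero, zero_add]
    fin_cases h <;> simp
  · fin_cases h <;> fin_cases h' <;> simp [childClass]

section Limits

variable {d t : ℝ} {M M' : ℕ → ℕ}

/-- The normalization is `2 * n` because a name carries a given clause with probability `1 / (2 * n
* (n - 1))`, while there are about `n` choices for the child variable. -/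
theorem tendsto_compatibleCount
    (hM : Tendsto (fun n : ℕ => (M n : ℝ) / n) atTop (𝓝 (t * d / 2)))
    (hM' : Tendsto (fun n : ℕ => (M' n : ℝ) / n) atTop (𝓝 ((1 - t) * d / 2)))
    (τ : NodeClass) (c : ClauseType) :
    Tendsto (fun n : ℕ => (compatibleCount (M n) (M' n) τ c.1 : ℝ) / (2 * n)) atTop
      (𝓝 (rate d t τ c)) := by
  have e : ∀ x y : ℝ, x / (2 * y) = (1 / 2) * (x / y) := fun x y => by ring
  simp only [e, compatibleCount_eq]
  rcases c with ⟨σ, s⟩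
  rcases τ with _ | h <;> rcases σ with _ | h'
  · have := hM.const_mul (1 / 2)
    convert this using 2
    simp only [rate]
    ring
  · have := hM'.const_mul (1 / 2)
    convert this using 2
    simp only [rate]
    ring
  · simp [rate]
  · simp only [rate]
    split_ifs with hh
    · have := (hM.add hM').const_mul (1 / 2)
      convert this using 2
      · push_cast
        ring
      · ring
    · simp

/-- The inequality log y ≥ 1 - 1/y at y = 1 - x gives log (1 - x) ≥ -x/(1 - x) ≥ -x/(1 - δ). -/
theorem prod_one_sub_ge_exp {ι : Type} [Fintype ι] (x : ι → ℝ) {δ : ℝ} (hx : ∀ a, 0 ≤ x a)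
    (hδ : ∀ a, x a ≤ δ) (hδ1 : δ < 1) :
    Real.exp (-((∑ a, x a) / (1 - δ))) ≤ ∏ a, (1 - x a) := by
  rw [Finset.sum_div, ← Finset.sum_neg_distrib, Real.exp_sum]
  refine Finset.prod_le_prod (fun _ _ => (Real.exp_pos _).le) fun a _ => ?_
  have h1 : 0 < 1 - x a := by linarith [hδ a]
  have h2 := Real.one_sub_inv_le_log_of_pos h1
  have h3 : -(x a / (1 - δ)) ≤ Real.log (1 - x a) := by
    refine le_trans ?_ h2
    have h4 : 1 - (1 - x a)⁻¹ = -(x a / (1 - x a)) := by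
      field_simp
      ring
    rw [h4, neg_le_neg_iff]
    exact div_le_div_of_nonneg_left (hx a) (by linarith) (by linarith [hδ a])
  exact (Real.exp_le_exp.2 h3).trans (Real.exp_log h1).le

namespace Pattern

open Classical

variable (P : Pattern)

/-- The limit of the rescaled expected number of realizations of the pattern. -/
def weight (d t : ℝ) : ℝ :=
  (∏ s, rate d t (P.cls (P.par s)) (P.typ s)) / P.siblingFactorial *
    Real.exp (-∑ v ∈ P.inner, ∑ c, rate d t (P.cls v) c)

/-- The division by 4 accounts for the four sign pairs of clause types with the same class. -/
theorem card_childClass_ne_none (m m' : ℕ) (τ : NodeClass) :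
    ((Finset.univ.filter fun a : ClauseName m m' => childClass τ a ≠ none).card : ℝ) =
      ∑ c : ClauseType, (compatibleCount m m' τ c.1 : ℝ) / 4 := by
  have h1 : (Finset.univ.filter fun a : ClauseName m m' => childClass τ a ≠ none).card =
      ∑ σ, compatibleCount m m' τ σ := by
    simp only [compatibleCount]
    rw [← Finset.card_biUnion]
    · congr 1
      ext a
      simp [Option.ne_none_iff_exists']
    · intro σ _ σ' _ h
      rw [Function.onFun, Finset.disjoint_left]
      intro a ha ha'
      rw [Finset.mem_filter] at ha ha'
      exact h (Option.some_injective _ (ha.2.symm.trans ha'.2))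
  rw [h1, Fintype.sum_prod_type, Nat.cast_sum]
  refine Finset.sum_congr rfl fun σ _ => ?_
  refine ((Finset.sum_const ((compatibleCount m m' τ σ : ℝ) / 4)).trans ?_).symm
  rw [Finset.card_univ, Fintype.card_prod, Fintype.card_units_int, nsmul_eq_mul]
  push_cast
  ring

theorem sum_exposure (m m' n : ℕ) :
    ∑ a : ClauseName m m', (2 * P.exposure a / n : ℝ) =
      ∑ v ∈ P.inner, ∑ c : ClauseType, (compatibleCount m m' (P.cls v) c.1 : ℝ) / (2 * n) := by
  have h1 : ∑ a : ClauseName m m', (P.exposure a : ℝ) = ∑ v ∈ P.inner,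
      ((Finset.univ.filter fun a : ClauseName m m' => childClass (P.cls v) a ≠ none).card : ℝ) := by
    simp only [exposure, Finset.card_filter, Nat.cast_sum]
    rw [Finset.sum_comm]
  simp only [card_childClass_ne_none] at h1
  rw [← Finset.sum_div, ← Finset.mul_sum, h1, Finset.mul_sum, Finset.sum_div]
  refine Finset.sum_congr rfl fun v _ => ?_
  rw [Finset.mul_sum, Finset.sum_div]
  refine Finset.sum_congr rfl fun c _ => ?_
  ring

/-- A lower bound for the rescaled expected number of realizations. -/
def lowerBound (m m' n : ℕ) : ℝ :=
  (n.descFactorial (Fintype.card P.V) : ℝ) / (n : ℝ) ^ Fintype.card P.V *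
    (∏ s, ((compatibleCount m m' (P.cls (P.par s)) (P.typ s).1 - Fintype.card P.S : ℕ) : ℝ) /
      (2 * n)) * ((n : ℝ) / (n - 1)) ^ Fintype.card P.S / P.siblingFactorial *
    Real.exp (-((∑ v ∈ P.inner, ∑ c : ClauseType, (compatibleCount m m' (P.cls v) c.1 : ℝ) / (2 * n)) /
      (1 - 2 * Fintype.card P.V / n)))

theorem siblingFactorial_pos : 0 < P.siblingFactorial :=
  Finset.prod_pos fun _ _ => Nat.factorial_pos _

theorem prod_compatibleCount_le (m m' : ℕ) :
    ∏ s, (compatibleCount m m' (P.cls (P.par s)) (P.typ s).1 - Fintype.card P.S) ≤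
      (Finset.univ.filter fun g : P.S → ClauseName m m' => P.Sorted g).card *
        P.siblingFactorial := by
  have h1 := prod_card_sub_le_card_injective fun s : P.S => Finset.univ.filter
    fun a : ClauseName m m' => childClass (P.cls (P.par s)) a = some (P.typ s).1
  refine le_trans (le_of_eq ?_) (h1.trans (le_trans (le_of_eq ?_) P.card_injective_le_card_sorted))
  · refine Finset.prod_congr rfl fun s _ => ?_
    rw [compatibleCount]
  · congr!

theorem rescale_eq {n : ℝ} (hn : n ≠ 0) (hn1 : n - 1 ≠ 0) (D Q F E : ℝ) (s r : ℕ) :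
    D / n ^ (s + r) * (Q / (2 * n) ^ s) * (n / (n - 1)) ^ s / F * E * n ^ r =
      D * (Q / F) * (((2 * n * (n - 1))⁻¹) ^ s * E) := by
  rw [pow_add, mul_inv, mul_pow ((2 * n)⁻¹), div_pow, inv_pow, inv_pow]
  field_simp

/-- For a forest, `r` is the number of trees: each child variable is matched with its clause, and
one free choice among `n` variables remains per root. -/
theorem lowerBound_le {m m' n r : ℕ} (hr : Fintype.card P.V = Fintype.card P.S + r) (hn : 2 ≤ n)
    (hV : 2 * Fintype.card P.V < n) :
    P.lowerBound m m' n ≤ (mean fun ω : Sample n m m' => (P.numRealized ω : ℝ)) / (n : ℝ) ^ r := by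
  have hn' : (2 : ℝ) ≤ n := by exact_mod_cast hn
  have hn0 : (n : ℝ) ≠ 0 := by linarith
  have hn1 : (0 : ℝ) < n - 1 := by linarith
  have hVn : (2 : ℝ) * Fintype.card P.V < n := by exact_mod_cast hV
  have hsib : (0 : ℝ) < P.siblingFactorial := by exact_mod_cast P.siblingFactorial_pos
  have hδ : (2 * Fintype.card P.V / n : ℝ) < 1 := by
    rw [div_lt_one (by linarith)]
    exact hVn
  have hexp := prod_one_sub_ge_exp (fun a : ClauseName m m' => (2 * P.exposure a / n : ℝ))
    (δ := (2 * Fintype.card P.V / n : ℝ)) (fun a => by positivity) (fun a => by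
      have : (P.exposure a : ℝ) ≤ Fintype.card P.V := Nat.cast_le.2 (P.exposure_le a)
      exact div_le_div_of_nonneg_right (mul_le_mul_of_nonneg_left this zero_le_two)
        (Nat.cast_nonneg _)) hδ
  rw [P.sum_exposure] at hexp
  have hsort : (∏ s, ((compatibleCount m m' (P.cls (P.par s)) (P.typ s).1 - Fintype.card P.S : ℕ) :
      ℝ)) / P.siblingFactorial ≤
      (Finset.univ.filter fun g : P.S → ClauseName m m' => P.Sorted g).card := by
    rw [div_le_iff₀ hsib]
    exact_mod_cast P.prod_compatibleCount_le m m'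
  rw [le_div_iff₀ (by positivity)]
  have hN : (0 : ℝ) ≤ ((2 * n * (n - 1) : ℝ)⁻¹) ^ Fintype.card P.S :=
    pow_nonneg (inv_nonneg.2 (mul_nonneg (by linarith) hn1.le)) _
  have h1 := mul_le_mul_of_nonneg_left hsort
    (Nat.cast_nonneg (α := ℝ) (n.descFactorial (Fintype.card P.V)))
  have h2 := mul_le_mul_of_nonneg_left hexp hN
  have h3 := mul_le_mul h1 h2 (mul_nonneg hN (Real.exp_pos _).le)
    (mul_nonneg (Nat.cast_nonneg _) (Nat.cast_nonneg _))
  refine le_trans (le_of_eq ?_) (h3.trans (P.le_mean_numRealized hn hV.le))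
  rw [lowerBound, Finset.prod_div_distrib, Finset.prod_const, Finset.card_univ, hr]
  exact rescale_eq hn0 hn1.ne' _ _ _ _ _ _

theorem tendsto_lowerBound
    (hM : Tendsto (fun n : ℕ => (M n : ℝ) / n) atTop (𝓝 (t * d / 2)))
    (hM' : Tendsto (fun n : ℕ => (M' n : ℝ) / n) atTop (𝓝 ((1 - t) * d / 2))) :
    Tendsto (fun n => P.lowerBound (M n) (M' n) n) atTop (𝓝 (P.weight d t)) := by
  have hinv : Tendsto (fun n : ℕ => (1 : ℝ) / n) atTop (𝓝 0) := tendsto_one_div_atTop_nhds_zero_nat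
  have h1 : Tendsto (fun n : ℕ => (n.descFactorial (Fintype.card P.V) : ℝ) /
      (n : ℝ) ^ Fintype.card P.V) atTop (𝓝 1) := by
    refine (Asymptotics.isEquivalent_iff_tendsto_one ?_).1
      (isEquivalent_descFactorial (Fintype.card P.V))
    filter_upwards [eventually_gt_atTop 0] with n hn
    positivity
  -- The truncated subtraction of a constant disappears in the limit, by squeezing.
  have h2 : ∀ s, Tendsto (fun n : ℕ => ((compatibleCount (M n) (M' n) (P.cls (P.par s))
      (P.typ s).1 - Fintype.card P.S : ℕ) : ℝ) / (2 * n)) atTop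
      (𝓝 (rate d t (P.cls (P.par s)) (P.typ s))) := by
    intro s
    have h3 := tendsto_compatibleCount hM hM' (P.cls (P.par s)) (P.typ s)
    have h4 := h3.sub (hinv.const_mul ((Fintype.card P.S : ℝ) / 2))
    rw [mul_zero, sub_zero] at h4
    refine tendsto_of_tendsto_of_tendsto_of_le_of_le h4 h3 (fun n => ?_) fun n => ?_
    · have h5 : ((compatibleCount (M n) (M' n) (P.cls (P.par s)) (P.typ s).1 : ℝ) -
          Fintype.card P.S) ≤ ((compatibleCount (M n) (M' n) (P.cls (P.par s))
          (P.typ s).1 - Fintype.card P.S : ℕ) : ℝ) := by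
        rw [sub_le_iff_le_add]
        exact_mod_cast le_tsub_add
      have h6 : (0 : ℝ) ≤ 2 * n := by positivity
      have := div_le_div_of_nonneg_right h5 h6
      refine le_trans (le_of_eq ?_) this
      rw [sub_div]
      congr 1
      rw [div_mul_div_comm, mul_one]
    · have : ((compatibleCount (M n) (M' n) (P.cls (P.par s))
          (P.typ s).1 - Fintype.card P.S : ℕ) : ℝ) ≤
          (compatibleCount (M n) (M' n) (P.cls (P.par s)) (P.typ s).1 : ℝ) := by
        exact_mod_cast Nat.sub_le _ _
      exact div_le_div_of_nonneg_right this (by positivity)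
  have h3 : Tendsto (fun n : ℕ => (n : ℝ) / (n - 1)) atTop (𝓝 1) := by
    have := (hinv.const_sub 1).inv₀ (by norm_num)
    rw [sub_zero, inv_one] at this
    refine this.congr' ?_
    filter_upwards [eventually_gt_atTop 1] with n hn
    have hn1 : (1 : ℝ) < n := by exact_mod_cast hn
    have : (n : ℝ) - 1 ≠ 0 := by linarith
    have : (n : ℝ) ≠ 0 := by linarith
    field_simp
  have h4 : Tendsto (fun n : ℕ => (1 - 2 * Fintype.card P.V / n : ℝ)) atTop (𝓝 1) := by
    have := (hinv.const_mul (2 * Fintype.card P.V : ℝ)).const_sub 1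
    rw [mul_zero, sub_zero] at this
    simpa only [mul_one_div] using this
  have h5 : Tendsto (fun n : ℕ => ∑ v ∈ P.inner, ∑ c : ClauseType,
      (compatibleCount (M n) (M' n) (P.cls v) c.1 : ℝ) / (2 * n)) atTop
      (𝓝 (∑ v ∈ P.inner, ∑ c, rate d t (P.cls v) c)) :=
    tendsto_finsetSum _ fun v _ => tendsto_finsetSum _ fun c _ => tendsto_compatibleCount hM hM' _ c
  have h6 := (h5.div h4 one_ne_zero).neg.rexp
  have h7 := (((h1.mul (tendsto_finsetProd Finset.univ fun s _ => h2 s)).mul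
    (h3.pow (Fintype.card P.S))).div_const (P.siblingFactorial : ℝ)).mul h6
  rwa [one_mul, one_pow, mul_one, div_one] at h7

end Pattern

end Limits

end

noncomputable section

/-! ### Weights of trees and of pairs of trees -/

namespace Pattern

open Classical

/-- The number of clauses in a block. -/
def blockCard (P : Pattern) (v : P.V) (c : ClauseType) : ℕ :=
  Fintype.card {s // P.block s = (v, c)}

/-- Regrouping the clauses by parent and type turns the weight into Poisson factors, one for each
variable and type. -/
theorem weight_eq (P : Pattern) (d t : ℝ) : P.weight d t =
    (∏ v, ∏ c, (rate d t (P.cls v) c ^ P.blockCard v c / (P.blockCard v c).factorial)) *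
      ∏ v ∈ P.inner, ∏ c, Real.exp (-rate d t (P.cls v) c) := by
  have h1 : ∏ s, rate d t (P.cls (P.par s)) (P.typ s) =
      ∏ v, ∏ c, rate d t (P.cls v) c ^ P.blockCard v c := by
    rw [← Fintype.prod_prod_type' (f := fun v c => rate d t (P.cls v) c ^ P.blockCard v c),
      ← Finset.prod_fiberwise (s := Finset.univ) P.block]
    refine Finset.prod_congr rfl fun b _ => ?_
    rw [blockCard, Fintype.card_subtype, ← Finset.prod_const]
    refine Finset.prod_congr rfl fun s hs => ?_
    have h : P.block s = b := (Finset.mem_filter.1 hs).2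
    rw [← h]
    rfl
  have h2 : (P.siblingFactorial : ℝ) = ∏ v, ∏ c, ((P.blockCard v c).factorial : ℝ) := by
    rw [siblingFactorial, Fintype.prod_prod_type, Nat.cast_prod]
    refine Finset.prod_congr rfl fun v _ => ?_
    rw [Nat.cast_prod]
    rfl
  rw [weight, h1, h2, ← Finset.sum_neg_distrib, Real.exp_sum]
  simp only [← Finset.sum_neg_distrib, Real.exp_sum, Finset.prod_div_distrib]

/-- The disjoint union of two patterns. -/
def sum (P Q : Pattern) : Pattern where
  V := P.V ⊕ Q.V
  S := P.S ⊕ Q.S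
  fintypeV := inferInstance
  fintypeS := inferInstance
  decidableEqV := inferInstance
  decidableEqS := inferInstance
  par := Sum.map P.par Q.par
  child := Sum.map P.child Q.child
  typ := Sum.elim P.typ Q.typ
  idx := Sum.elim P.idx Q.idx
  cls := Sum.elim P.cls Q.cls
  inner := P.inner.disjSum Q.inner
  child_ne_par s := by
    rcases s with s | s
    · exact fun h => P.child_ne_par s (Sum.inl_injective h)
    · exact fun h => Q.child_ne_par s (Sum.inr_injective h)
  idx_injective s s' h1 h2 h3 := by
    rcases s with s | s <;> rcases s' with s' | s'
    · exact congrArg _ (P.idx_injective s s' (Sum.inl_injective h1) h2 h3)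
    · cases h1
    · cases h1
    · exact congrArg _ (Q.idx_injective s s' (Sum.inr_injective h1) h2 h3)

theorem blockCard_sum_inl (P Q : Pattern) (v : P.V) (c : ClauseType) :
    (P.sum Q).blockCard (Sum.inl v) c = P.blockCard v c := by
  unfold blockCard
  rw [← Nat.card_eq_fintype_card, ← Nat.card_eq_fintype_card]
  refine (Nat.card_eq_of_bijective (fun s : {s // P.block s = (v, c)} =>
    (⟨Sum.inl s.1, by
      obtain ⟨s, h⟩ := s
      have h1 := congrArg Prod.fst h
      have h2 := congrArg Prod.snd h
      exact Prod.ext (congrArg Sum.inl h1) h2⟩ :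
      {s // (P.sum Q).block s = (Sum.inl v, c)})) ⟨?_, ?_⟩).symm
  · intro s s' h
    exact Subtype.ext (Sum.inl_injective (congrArg Subtype.val h))
  · rintro ⟨s | s, hs⟩
    · have h1 := congrArg Prod.fst hs
      have h2 := congrArg Prod.snd hs
      exact ⟨⟨s, Prod.ext (Sum.inl_injective h1) h2⟩, rfl⟩
    · cases congrArg Prod.fst hs

theorem blockCard_sum_inr (P Q : Pattern) (v : Q.V) (c : ClauseType) :
    (P.sum Q).blockCard (Sum.inr v) c = Q.blockCard v c := by
  unfold blockCard
  rw [← Nat.card_eq_fintype_card, ← Nat.card_eq_fintype_card]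
  refine (Nat.card_eq_of_bijective (fun s : {s // Q.block s = (v, c)} =>
    (⟨Sum.inr s.1, by
      obtain ⟨s, h⟩ := s
      have h1 := congrArg Prod.fst h
      have h2 := congrArg Prod.snd h
      exact Prod.ext (congrArg Sum.inr h1) h2⟩ :
      {s // (P.sum Q).block s = (Sum.inr v, c)})) ⟨?_, ?_⟩).symm
  · intro s s' h
    exact Subtype.ext (Sum.inr_injective (congrArg Subtype.val h))
  · rintro ⟨s | s, hs⟩
    · cases congrArg Prod.fst hs
    · have h1 := congrArg Prod.fst hs
      have h2 := congrArg Prod.snd hs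
      exact ⟨⟨s, Prod.ext (Sum.inr_injective h1) h2⟩, rfl⟩

/-- In the limit this is the asymptotic independence of two realizations, which makes the second
moment factorize. -/
theorem weight_sum (P Q : Pattern) (d t : ℝ) :
    (P.sum Q).weight d t = P.weight d t * Q.weight d t := by
  rw [weight_eq, weight_eq P, weight_eq Q]
  have h1 : ∏ v, ∏ c, (rate d t ((P.sum Q).cls v) c ^ (P.sum Q).blockCard v c /
      ((P.sum Q).blockCard v c).factorial) =
      (∏ v, ∏ c, (rate d t (P.cls v) c ^ P.blockCard v c / (P.blockCard v c).factorial)) *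
      ∏ v, ∏ c, (rate d t (Q.cls v) c ^ Q.blockCard v c / (Q.blockCard v c).factorial) := by
    refine (Fintype.prod_sum_type _).trans ?_
    congr 1
    · refine Finset.prod_congr rfl fun v _ => Finset.prod_congr rfl fun c _ => ?_
      rw [blockCard_sum_inl]
      rfl
    · refine Finset.prod_congr rfl fun v _ => Finset.prod_congr rfl fun c _ => ?_
      rw [blockCard_sum_inr]
      rfl
  have h2 : ∏ v ∈ (P.sum Q).inner, ∏ c, Real.exp (-rate d t ((P.sum Q).cls v) c) =
      (∏ v ∈ P.inner, ∏ c, Real.exp (-rate d t (P.cls v) c)) *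
        ∏ v ∈ Q.inner, ∏ c, Real.exp (-rate d t (Q.cls v) c) :=
    Finset.prod_disjSum P.inner Q.inner _
  rw [h1, h2]
  ring

theorem Realized.inl {P Q : Pattern} {n M M' : ℕ} {ω : Sample n M M'} {f : (P.sum Q).V → Fin n}
    {g : (P.sum Q).S → ClauseName M M'} (H : (P.sum Q).Realized ω f g) :
    P.Realized ω (f ∘ Sum.inl) (g ∘ Sum.inl) where
  injective := H.injective.comp Sum.inl_injective
  sorted :=
    { injective := H.sorted.injective.comp Sum.inl_injective
      compatible := fun s => H.sorted.compatible (Sum.inl s)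
      increasing := fun s s' h1 h2 h3 =>
        H.sorted.increasing (Sum.inl s) (Sum.inl s') (congrArg Sum.inl h1) h2 h3 }
  lits_eq s := H.lits_eq (Sum.inl s)
  avoid a ha v hv hc e he := by
    obtain ⟨s, hs, h⟩ := H.exists_of_mem (v := Sum.inl v) (a := a)
      (Finset.inl_mem_disjSum.2 hv) hc he
    rcases s with s | s
    · exact ha ⟨s, hs⟩
    · rcases h with ⟨h, -⟩ | ⟨h, -⟩ <;> cases h

theorem Realized.inr {P Q : Pattern} {n M M' : ℕ} {ω : Sample n M M'} {f : (P.sum Q).V → Fin n}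
    {g : (P.sum Q).S → ClauseName M M'} (H : (P.sum Q).Realized ω f g) :
    Q.Realized ω (f ∘ Sum.inr) (g ∘ Sum.inr) where
  injective := H.injective.comp Sum.inr_injective
  sorted :=
    { injective := H.sorted.injective.comp Sum.inr_injective
      compatible := fun s => H.sorted.compatible (Sum.inr s)
      increasing := fun s s' h1 h2 h3 =>
        H.sorted.increasing (Sum.inr s) (Sum.inr s') (congrArg Sum.inr h1) h2 h3 }
  lits_eq s := H.lits_eq (Sum.inr s)
  avoid a ha v hv hc e he := by
    obtain ⟨s, hs, h⟩ := H.exists_of_mem (v := Sum.inr v) (a := a)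
      (Finset.inr_mem_disjSum.2 hv) hc he
    rcases s with s | s
    · rcases h with ⟨h, -⟩ | ⟨h, -⟩ <;> cases h
    · exact ha ⟨s, hs⟩

end Pattern

namespace treePattern

open Classical

variable {ℓ : ℕ} (T : TypedTree ℓ)

theorem blockCard_node {v : Address} (hv : v ∈ T.nodes) (c : ClauseType) :
    (treePattern T).blockCard (node v hv) c = T.deg ℓ v c := by
  refine (Fintype.card_of_bijective (f := fun i : Fin (T.deg ℓ v c) =>
    (⟨clause v (c, i) (TypedTree.append_mem_nodes.2 ⟨hv, i.2⟩), ?_⟩ :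
      {s // (treePattern T).block s = (node v hv, c)})) ⟨?_, ?_⟩).symm.trans (Fintype.card_fin _)
  · exact Prod.ext par_clause typ_clause
  · intro i j h
    have h1 : v ++ [(c, (i : ℕ))] = v ++ [(c, (j : ℕ))] :=
      congrArg Subtype.val (congrArg Subtype.val h)
    simpa [Fin.ext_iff] using h1
  · rintro ⟨s, hs⟩
    obtain ⟨p, ⟨c', i⟩, h, rfl⟩ := exists_eq_clause s
    have h1 := congrArg Prod.fst hs
    have h2 := congrArg Prod.snd hs
    change (treePattern T).par _ = _ at h1
    change (treePattern T).typ _ = _ at h2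
    rw [par_clause, node_inj] at h1
    rw [typ_clause] at h2
    subst h1
    obtain rfl : c' = c := h2
    exact ⟨⟨i, (TypedTree.append_mem_nodes.1 h).2⟩, rfl⟩

theorem deg_eq_zero {v : Address} (hv : v ∈ T.nodes) (hl : ℓ ≤ v.length) (c : ClauseType) :
    T.deg ℓ v c = 0 := by
  by_contra h
  have := TypedTree.length_lt_of_append
    (TypedTree.append_mem_nodes.2 ⟨hv, Nat.pos_of_ne_zero h⟩)
  omega

/-- Realizations are sorted, so their count carries the sibling factorials in the denominator, and
these are the factorials of the Poisson weights. -/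
theorem weight_eq_galtonWatson {d t : ℝ} (hd : 0 ≤ d) (ht0 : 0 ≤ t) (ht1 : t ≤ 1) :
    (treePattern T).weight d t = (galtonWatson d t ℓ .shared T).toReal := by
  rw [galtonWatson_apply, ENNReal.toReal_prod, Pattern.weight_eq]
  simp only [offspringWeight_toReal hd ht0 ht1]
  rw [← Finset.prod_subset (Finset.subset_univ (treePattern T).inner), ← Finset.prod_mul_distrib]
  · refine Finset.prod_bij' (fun v _ => v.1) (fun v hv => node v (TypedTree.mem_innerFinset.1 hv).1)
      (fun v hv => ?_) (fun v hv => ?_) (fun _ _ => rfl) (fun _ _ => rfl) (fun v hv => ?_)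
    · obtain ⟨w, hw, rfl⟩ := exists_eq_node v
      exact TypedTree.mem_innerFinset.2 ⟨hw, node_mem_inner.1 hv⟩
    · exact node_mem_inner.2 (TypedTree.mem_innerFinset.1 hv).2
    · obtain ⟨w, hw, rfl⟩ := exists_eq_node v
      rw [← Finset.prod_mul_distrib]
      refine Finset.prod_congr rfl fun c _ => ?_
      rw [blockCard_node, cls_node]
      change _ = Real.exp (-rate d t (Address.nodeClass w) c) *
        rate d t (Address.nodeClass w) c ^ T.deg ℓ w c / (T.deg ℓ w c).factorial
      ring
  -- Variables of the last generation have no children and contribute only trivial factors.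
  · intro v _ hv
    obtain ⟨w, hw, rfl⟩ := exists_eq_node v
    rw [node_mem_inner, not_lt] at hv
    refine Finset.prod_eq_one fun c _ => ?_
    rw [blockCard_node, deg_eq_zero T hw hv]
    simp

theorem card_vertices : Fintype.card (treePattern T).V = Fintype.card (treePattern T).S + 1 := by
  have h1 : Fintype.card (treePattern T).V = T.nodeFinset.card := Fintype.card_coe _
  have h2 : Fintype.card (treePattern T).S = (T.nodeFinset.filter (· ≠ [])).card :=
    @Fintype.card_of_subtype _ _ _ (by simp) (treePattern T).fintypeS
  have h3 : [] ∈ T.nodeFinset := TypedTree.mem_nodeFinset.2 (TypedTree.nil_mem_nodes T)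
  rw [h1, h2, Finset.filter_ne', Finset.card_erase_add_one h3]

theorem card_vertices_sum (T' : TypedTree ℓ) :
    Fintype.card ((treePattern T).sum (treePattern T')).V =
      Fintype.card ((treePattern T).sum (treePattern T')).S + 2 := by
  have h1 : Fintype.card ((treePattern T).sum (treePattern T')).V =
    Fintype.card (treePattern T).V + Fintype.card (treePattern T').V := Fintype.card_sum
  have h2 : Fintype.card ((treePattern T).sum (treePattern T')).S =
    Fintype.card (treePattern T).S + Fintype.card (treePattern T').S := Fintype.card_sum
  rw [h1, h2, card_vertices, card_vertices]
  ring

/-- A realization of the union is determined by its two roots. Overlapping pairs of realizations are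
missed on the left, which is harmless for a lower bound on the second moment. -/
theorem numRealized_sum_le {T T' : TypedTree ℓ} {n M M' : ℕ} (ω : Sample n M M') :
    ((treePattern T).sum (treePattern T')).numRealized ω ≤
      (realizedRoots T ω).ncard * (realizedRoots T' ω).ncard := by
  rw [Set.ncard_eq_toFinset_card', Set.ncard_eq_toFinset_card', ← Finset.card_product,
    Pattern.numRealized]
  refine Finset.card_le_card_of_injOn (fun p =>
    (p.1 (Sum.inl (node [] (TypedTree.nil_mem_nodes T))),
      p.1 (Sum.inr (node [] (TypedTree.nil_mem_nodes T'))))) ?_ ?_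
  · rintro ⟨f, g⟩ hp
    have H : Pattern.Realized _ ω f g := (Finset.mem_filter.1 hp).2
    refine Finset.mem_coe.2 (Finset.mem_product.2 ⟨Set.mem_toFinset.2 ?_, Set.mem_toFinset.2 ?_⟩)
    · exact ⟨_, _, H.inl, rfl⟩
    · exact ⟨_, _, H.inr, rfl⟩
  · rintro ⟨f, g⟩ hp ⟨f', g'⟩ hp' h
    have H : Pattern.Realized _ ω f g := (Finset.mem_filter.1 hp).2
    have H' : Pattern.Realized _ ω f' g' := (Finset.mem_filter.1 hp').2
    obtain ⟨h1, h2⟩ := Prod.mk.inj h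
    obtain ⟨h3, h4⟩ := realized_unique' H.inl H'.inl h1
    obtain ⟨h5, h6⟩ := realized_unique' H.inr H'.inr h2
    refine Prod.ext (funext fun v => ?_) (funext fun s => ?_)
    · rcases v with v | v
      · exact congrFun h3 v
      · exact congrFun h5 v
    · rcases s with s | s
      · exact congrFun h4 s
      · exact congrFun h6 s

end treePattern

end

noncomputable section

/-! ### Concentration of the numbers of realized trees -/

/-- If nonnegative random variables `Y i` have sum at most one, and their mixed second moments are
nearly at least the products of numbers `p i` that sum up to nearly one, then `Y i` is close
to `p i` in mean square. -/
theorem mean_sq_sub_le {Ω ι : Type} [Fintype Ω] (F : Finset ι) (Y : ι → Ω → ℝ) (p : ι → ℝ)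
    {δ η : ℝ} (hY : ∀ i ω, 0 ≤ Y i ω) (hsum : ∀ ω, ∑ i ∈ F, Y i ω ≤ 1) (hp : ∀ i ∈ F, 0 ≤ p i)
    (hp1 : 1 - δ ≤ ∑ i ∈ F, p i) (hp2 : ∑ i ∈ F, p i ≤ 1)
    (hη : (F.card : ℝ) ^ 2 * η ≤ δ) (hη0 : 0 ≤ η)
    (hpair : ∀ i ∈ F, ∀ j ∈ F, p i * p j - η ≤ mean fun ω => Y i ω * Y j ω) {i : ι} (hi : i ∈ F) :
    mean (fun ω => (Y i ω - p i) ^ 2) ≤ 7 * δ := by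
  have hpi := hp i hi
  have hpi1 : p i ≤ 1 := (Finset.single_le_sum hp hi).trans hp2
  have hcard : (1 : ℝ) ≤ F.card := by exact_mod_cast Finset.card_pos.2 ⟨i, hi⟩
  have hcη : (F.card : ℝ) * η ≤ δ := by
    refine le_trans ?_ hη
    have : (F.card : ℝ) * η * 1 ≤ (F.card : ℝ) * η * F.card :=
      mul_le_mul_of_nonneg_left hcard (by positivity)
    nlinarith
  -- The terms `mean (Y a * Y b) - p a * p b + η` are nonnegative and their sum is at most 1 - (1 -
  -- δ)² + δ ≤ 3δ, so each single one is at most 3δ.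
  have hsecond : mean (fun ω => Y i ω * Y i ω) ≤ p i * p i + 3 * δ := by
    have h1 : ∑ a ∈ F, ∑ b ∈ F, mean (fun ω => Y a ω * Y b ω) ≤ 1 := by
      have h2 : ∑ a ∈ F, ∑ b ∈ F, mean (fun ω => Y a ω * Y b ω) =
          mean fun ω => (∑ a ∈ F, Y a ω) * ∑ b ∈ F, Y b ω := by
        simp only [Finset.sum_mul_sum, mean_sum]
      rw [h2]
      refine (mean_mono fun ω => ?_).trans (mean_const_le zero_le_one)
      exact mul_le_one₀ (hsum ω) (Finset.sum_nonneg fun a _ => hY a ω) (hsum ω)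
    have h3 : mean (fun ω => Y i ω * Y i ω) - p i * p i + η ≤
        ∑ a ∈ F, ∑ b ∈ F, (mean (fun ω => Y a ω * Y b ω) - p a * p b + η) := by
      have h4 : ∀ a ∈ F, ∀ b ∈ F, 0 ≤ mean (fun ω => Y a ω * Y b ω) - p a * p b + η :=
        fun a ha b hb => by linarith [hpair a ha b hb]
      refine le_trans ?_ (Finset.single_le_sum
        (f := fun a => ∑ b ∈ F, (mean (fun ω => Y a ω * Y b ω) - p a * p b + η))
        (fun a ha => Finset.sum_nonneg (h4 a ha)) hi)
      exact Finset.single_le_sum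
        (f := fun b => mean (fun ω => Y i ω * Y b ω) - p i * p b + η) (h4 i hi) hi
    have h5 : ∑ a ∈ F, ∑ b ∈ F, (mean (fun ω => Y a ω * Y b ω) - p a * p b + η) =
        ∑ a ∈ F, ∑ b ∈ F, mean (fun ω => Y a ω * Y b ω) -
          (∑ a ∈ F, p a) * ∑ b ∈ F, p b + (F.card : ℝ) ^ 2 * η := by
      simp only [Finset.sum_add_distrib, Finset.sum_sub_distrib, Finset.sum_mul_sum,
        Finset.sum_const, nsmul_eq_mul]
      ring
    rw [h5] at h3
    nlinarith [sq_nonneg (1 - ∑ a ∈ F, p a)]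
  -- Since the `Y b` sum to at most 1, the mean of `Y i` dominates the sum of its mixed moments. One
  -- `δ` is lost because the `p b` sum only to `1 - δ`, the other through the errors `η`.
  have hfirst : p i - 2 * δ ≤ mean (fun ω => Y i ω) := by
    have h1 : ∑ b ∈ F, mean (fun ω => Y i ω * Y b ω) ≤ mean (fun ω => Y i ω) := by
      rw [← mean_sum]
      refine mean_mono fun ω => ?_
      rw [← Finset.mul_sum]
      exact mul_le_of_le_one_right (hY i ω) (hsum ω)
    have h2 : p i * ∑ b ∈ F, p b - F.card * η ≤ ∑ b ∈ F, mean (fun ω => Y i ω * Y b ω) := by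
      rw [Finset.mul_sum, ← nsmul_eq_mul, ← Finset.sum_const, ← Finset.sum_sub_distrib]
      exact Finset.sum_le_sum fun b hb => hpair i hi b hb
    nlinarith
  -- The square expands to at most 3δ + 4 p_i δ in mean, and p_i ≤ 1.
  have hexp : ∀ ω, (Y i ω - p i) ^ 2 = (Y i ω * Y i ω - (2 * p i) * Y i ω) + p i ^ 2 :=
    fun ω => by ring
  simp only [hexp]
  rw [mean_add, mean_sub, mean_const_mul]
  have hconst := mean_const_le (Ω := Ω) (sq_nonneg (p i))
  nlinarith

section Concentration

variable {d t : ℝ} {ℓ : ℕ} {M M' : ℕ → ℕ}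

/-- The probability that the Galton-Watson tree equals a given tree. -/
def treeProb (d t : ℝ) {ℓ : ℕ} (T : TypedTree ℓ) : ℝ := (galtonWatson d t ℓ .shared T).toReal

theorem treeProb_nonneg (d t : ℝ) (T : TypedTree ℓ) : 0 ≤ treeProb d t T := ENNReal.toReal_nonneg

theorem hasSum_treeProb (d t : ℝ) (ℓ : ℕ) : HasSum (treeProb d t (ℓ := ℓ)) 1 := by
  have h := (galtonWatson d t ℓ .shared).tsum_coe
  have h1 : Summable (treeProb d t (ℓ := ℓ)) := ENNReal.summable_toReal (by rw [h]; simp)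
  have h2 : ∑' T : TypedTree ℓ, treeProb d t T = 1 := by
    rw [← ENNReal.toReal_one, ← h, ENNReal.tsum_toReal_eq fun T => PMF.apply_ne_top _ _]
    rfl
  rw [← h2]
  exact h1.hasSum

/-- The fraction of the variables at which a tree is realized. -/
def realizedFraction {n m m' : ℕ} (T : TypedTree ℓ) (ω : Sample n m m') : ℝ :=
  ((realizedRoots T ω).ncard : ℝ) / n

theorem realizedFraction_nonneg {n m m' : ℕ} (T : TypedTree ℓ) (ω : Sample n m m') :
    0 ≤ realizedFraction T ω := by
  unfold realizedFraction
  positivity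

theorem sum_realizedFraction_le {n m m' : ℕ} (F : Finset (TypedTree ℓ)) (ω : Sample n m m') :
    ∑ T ∈ F, realizedFraction T ω ≤ 1 := by
  unfold realizedFraction
  rw [← Finset.sum_div]
  refine div_le_one_of_le₀ ?_ (Nat.cast_nonneg _)
  exact_mod_cast sum_ncard_realizedRoots_le F ω

theorem eventually_le_mean_mul (hd : 0 ≤ d) (ht0 : 0 ≤ t) (ht1 : t ≤ 1)
    (hM : Tendsto (fun n : ℕ => (M n : ℝ) / n) atTop (𝓝 (t * d / 2)))
    (hM' : Tendsto (fun n : ℕ => (M' n : ℝ) / n) atTop (𝓝 ((1 - t) * d / 2)))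
    (T T' : TypedTree ℓ) {η : ℝ} (hη : 0 < η) :
    ∀ᶠ n : ℕ in atTop, treeProb d t T * treeProb d t T' - η ≤
      mean fun ω : Sample n (M n) (M' n) => realizedFraction T ω * realizedFraction T' ω := by
  set P := (treePattern T).sum (treePattern T') with hP
  have h1 := P.tendsto_lowerBound hM hM'
  rw [hP, Pattern.weight_sum, treePattern.weight_eq_galtonWatson T hd ht0 ht1,
    treePattern.weight_eq_galtonWatson T' hd ht0 ht1, ← hP] at h1
  filter_upwards [h1.eventually (lt_mem_nhds (sub_lt_self _ hη)), eventually_ge_atTop 2,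
    eventually_gt_atTop (2 * Fintype.card P.V)] with n hn hn2 hnV
  refine hn.le.trans ((P.lowerBound_le (treePattern.card_vertices_sum T T') hn2 hnV).trans ?_)
  rw [div_eq_inv_mul, ← mean_const_mul]
  refine mean_mono fun ω => ?_
  have h2 : (P.numRealized ω : ℝ) ≤ (realizedRoots T ω).ncard * (realizedRoots T' ω).ncard := by
    exact_mod_cast treePattern.numRealized_sum_le ω
  rw [← div_eq_inv_mul, realizedFraction, realizedFraction, div_mul_div_comm, ← sq]
  exact div_le_div_of_nonneg_right h2 (sq_nonneg _)

theorem exists_finset_treeProb (d t : ℝ) (ℓ : ℕ) {δ : ℝ} (hδ : 0 < δ) :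
    ∃ F : Finset (TypedTree ℓ), ∀ G, F ⊆ G → 1 - δ ≤ ∑ T ∈ G, treeProb d t T := by
  have h := (hasSum_treeProb d t ℓ).eventually (lt_mem_nhds (sub_lt_self 1 hδ))
  obtain ⟨F, hF⟩ := Filter.eventually_atTop.1 h
  exact ⟨F, fun G hG => (hF G hG).le⟩

theorem sum_treeProb_le_one (d t : ℝ) (F : Finset (TypedTree ℓ)) : ∑ T ∈ F, treeProb d t T ≤ 1 :=
  sum_le_hasSum F (fun T _ => treeProb_nonneg d t T) (hasSum_treeProb d t ℓ)

theorem tendsto_mean_sq (hd : 0 ≤ d) (ht0 : 0 ≤ t) (ht1 : t ≤ 1)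
    (hM : Tendsto (fun n : ℕ => (M n : ℝ) / n) atTop (𝓝 (t * d / 2)))
    (hM' : Tendsto (fun n : ℕ => (M' n : ℝ) / n) atTop (𝓝 ((1 - t) * d / 2)))
    (T : TypedTree ℓ) :
    Tendsto (fun n => mean fun ω : Sample n (M n) (M' n) =>
      (realizedFraction T ω - treeProb d t T) ^ 2) atTop (𝓝 0) := by
  classical
  rw [Metric.tendsto_nhds]
  intro ε hε
  -- The bound `7 * δ` from `mean_sq_sub_le` has to stay below `ε`.
  set δ := ε / 8 with hδ
  have hδ0 : 0 < δ := by positivity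
  obtain ⟨F₀, hF₀⟩ := exists_finset_treeProb d t ℓ hδ0
  set F := insert T F₀ with hF
  have hcard : (0 : ℝ) < F.card := by
    exact_mod_cast Finset.card_pos.2 ⟨T, Finset.mem_insert_self _ _⟩
  have hpair : ∀ᶠ n : ℕ in atTop, ∀ i ∈ F, ∀ j ∈ F,
      treeProb d t i * treeProb d t j - δ / (F.card : ℝ) ^ 2 ≤
        mean fun ω : Sample n (M n) (M' n) => realizedFraction i ω * realizedFraction j ω := by
    rw [Filter.eventually_all_finset]
    intro i _
    rw [Filter.eventually_all_finset]
    intro j _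
    exact eventually_le_mean_mul hd ht0 ht1 hM hM' i j (by positivity)
  filter_upwards [hpair] with n hn
  have h1 := mean_sq_sub_le F (fun T (ω : Sample n (M n) (M' n)) => realizedFraction T ω)
    (treeProb d t) (fun T ω => realizedFraction_nonneg T ω) (sum_realizedFraction_le F)
    (fun T _ => treeProb_nonneg d t T) (hF₀ F (Finset.subset_insert _ _))
    (sum_treeProb_le_one d t F) (by field_simp; exact le_rfl) (by positivity) hn
    (Finset.mem_insert_self T F₀)
  rw [Real.dist_0_eq_abs, abs_of_nonneg (mean_nonneg fun ω => sq_nonneg _)]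
  linarith

theorem tendsto_uniformProb_lt (hd : 0 ≤ d) (ht0 : 0 ≤ t) (ht1 : t ≤ 1)
    (hM : Tendsto (fun n : ℕ => (M n : ℝ) / n) atTop (𝓝 (t * d / 2)))
    (hM' : Tendsto (fun n : ℕ => (M' n : ℝ) / n) atTop (𝓝 ((1 - t) * d / 2)))
    (T : TypedTree ℓ) {η : ℝ} (hη : 0 < η) :
    Tendsto (fun n => uniformProb {ω : Sample n (M n) (M' n) |
      realizedFraction T ω < treeProb d t T - η}) atTop (𝓝 0) := by
  have h1 := (tendsto_mean_sq hd ht0 ht1 hM hM' T).div_const (η ^ 2)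
  rw [zero_div] at h1
  refine squeeze_zero (fun n => uniformProb_nonneg _) (fun n => ?_) h1
  refine le_trans (uniformProb_mono fun ω hω => ?_)
    (uniformProb_le_mean_div (fun ω => sq_nonneg _) (by positivity))
  have h2 : realizedFraction T ω < treeProb d t T - η := hω
  change η ^ 2 ≤ (realizedFraction T ω - treeProb d t T) ^ 2
  nlinarith

/-- The expected number of spoiled roots is bounded uniformly in large `n`, so Markov's inequality
at level `η * n` gives a bound of order `1 / n`. -/
theorem tendsto_uniformProb_conflicted (hd0 : 0 ≤ d) (hd2 : d < 2)
    (hM : Tendsto (fun n : ℕ => (M n : ℝ) / n) atTop (𝓝 (t * d / 2)))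
    (hM' : Tendsto (fun n : ℕ => (M' n : ℝ) / n) atTop (𝓝 ((1 - t) * d / 2)))
    (T : TypedTree ℓ) {η : ℝ} (hη : 0 < η) :
    Tendsto (fun n : ℕ => uniformProb {ω : Sample n (M n) (M' n) |
      η * n ≤ (conflictedRoots T ω).ncard}) atTop (𝓝 0) := by
  -- The midpoint of `d / 2` and 1 eventually exceeds the clause density and still makes the series
  -- converge.
  set ρ := (d / 2 + 1) / 2 with hρ
  have hρ1 : ρ < 1 := by rw [hρ]; linarith
  have hinv : Tendsto (fun n : ℕ => (1 : ℝ) / n) atTop (𝓝 0) := tendsto_one_div_atTop_nhds_zero_nat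
  have h1 : Tendsto (fun n : ℕ => ((M n + M' n : ℕ) : ℝ) / (n - 1)) atTop (𝓝 (d / 2)) := by
    have h2 := (hM.add hM').div (hinv.const_sub 1) (by norm_num)
    have h3 : (t * d / 2 + (1 - t) * d / 2) / (1 - 0) = d / 2 := by ring
    rw [h3] at h2
    refine h2.congr' ?_
    filter_upwards [eventually_gt_atTop 1] with n hn
    have hn1 : (1 : ℝ) < n := by exact_mod_cast hn
    have : (n : ℝ) - 1 ≠ 0 := by linarith
    have : (n : ℝ) ≠ 0 := by linarith
    push_cast
    simp only [Pi.div_apply]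
    field_simp
  set K : ℝ := ((∑ k ∈ Finset.range ℓ, (2 * Fintype.card (treePattern T).S) ^ k : ℕ) : ℝ) with hK
  set C : ℝ := ∑' k : ℕ, 2 * ((k : ℝ) ^ 2 * ρ ^ k) with hC
  have h4 : Tendsto (fun n : ℕ => (2 * (K * C) / η) * ((1 : ℝ) / n)) atTop (𝓝 0) := by
    simpa using hinv.const_mul (2 * (K * C) / η)
  refine squeeze_zero' (Eventually.of_forall fun n => uniformProb_nonneg _) ?_ h4
  have hlt : d / 2 < ρ := by rw [hρ]; linarith
  filter_upwards [h1.eventually (gt_mem_nhds hlt), eventually_ge_atTop 2] with n hn hn2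
  have hn0 : (0 : ℝ) < n := by
    have : (2 : ℝ) ≤ n := by exact_mod_cast hn2
    linarith
  refine (uniformProb_le_mean_div (fun ω => Nat.cast_nonneg _) (by positivity)).trans ?_
  have h5 : mean (fun ω : Sample n (M n) (M' n) => ((conflictedRoots T ω).ncard : ℝ)) ≤
      2 * (K * C) := by
    have h6 : mean (fun ω : Sample n (M n) (M' n) => ((conflictedRoots T ω).ncard : ℝ)) ≤
        mean (fun ω : Sample n (M n) (M' n) =>
          K * ∑ h : Fin 2, ({u | Conflicted (formula ω h) u}.ncard : ℝ)) := by
      refine mean_mono fun ω => ?_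
      have := ncard_conflictedRoots_le T ω
      rw [← Finset.sum_mul, mul_comm] at this
      rw [hK]
      exact_mod_cast this
    refine h6.trans ?_
    rw [mean_const_mul, mean_sum, Fin.sum_univ_two]
    have h7 := mean_conflicted_le (M := M n) (M' := M' n) hn2 0 hρ1 hn.le
    have h8 := mean_conflicted_le (M := M n) (M' := M' n) hn2 1 hρ1 hn.le
    have hK0 : 0 ≤ K := Nat.cast_nonneg _
    nlinarith
  have h9 : (2 * (K * C) / η) * ((1 : ℝ) / n) = 2 * (K * C) / (η * n) := by
    field_simp
  rw [h9]
  exact div_le_div_of_nonneg_right h5 (by positivity)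

end Concentration

end

noncomputable section

/-! ### Concentration of the numbers of instances -/

theorem prob_eq_tsum (d t : ℝ) {ℓ : ℕ} (T : TypedTree ℓ) :
    T.prob d t = ∑' T' : TypedTree ℓ, {T' | T'.Isomorphic T}.indicator (treeProb d t) T' := by
  classical
  rw [TypedTree.prob, PMF.toOuterMeasure_apply, ENNReal.tsum_toReal_eq]
  · refine tsum_congr fun T' => ?_
    simp only [Set.indicator_apply]
    split_ifs <;> simp [treeProb]
  · intro T'
    rw [Set.indicator_apply]
    split_ifs
    · exact PMF.apply_ne_top _ _
    · simp

theorem sum_treeProb_le_prob (d t : ℝ) {ℓ : ℕ} (T : TypedTree ℓ) (F : Finset (TypedTree ℓ))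
    (hF : ∀ T' ∈ F, T'.Isomorphic T) : ∑ T' ∈ F, treeProb d t T' ≤ T.prob d t := by
  rw [prob_eq_tsum]
  have h1 := (hasSum_treeProb d t ℓ).summable.indicator {T' | T'.Isomorphic T}
  refine le_trans (le_of_eq (Finset.sum_congr rfl fun T' hT' => ?_)) (h1.sum_le_tsum F fun T' _ =>
    Set.indicator_nonneg (fun T' _ => treeProb_nonneg d t T') T')
  rw [Set.indicator_of_mem (show T' ∈ {T' | T'.Isomorphic T} from hF T' hT')]

theorem sum_treeProb_le_one_sub_prob (d t : ℝ) {ℓ : ℕ} (T : TypedTree ℓ)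
    (F : Finset (TypedTree ℓ)) (hF : ∀ T' ∈ F, ¬ T'.Isomorphic T) :
    ∑ T' ∈ F, treeProb d t T' ≤ 1 - T.prob d t := by
  have h0 := hasSum_treeProb d t ℓ
  have h1 := h0.summable.indicator {T' | T'.Isomorphic T}ᶜ
  have h2 := h0.summable.indicator {T' | T'.Isomorphic T}
  have h3 : ∑' T', {T' | T'.Isomorphic T}ᶜ.indicator (treeProb d t) T' = 1 - T.prob d t := by
    rw [prob_eq_tsum, eq_sub_iff_add_eq, add_comm, ← h2.tsum_add h1, ← h0.tsum_eq]
    exact tsum_congr fun T' => congrFun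
      (Set.indicator_self_add_compl {T' | T'.Isomorphic T} (treeProb d t)) T'
  rw [← h3]
  refine le_trans (le_of_eq (Finset.sum_congr rfl fun T' hT' => ?_)) (h1.sum_le_tsum F fun T' _ =>
    Set.indicator_nonneg (fun T' _ => treeProb_nonneg d t T') T')
  rw [Set.indicator_of_mem (show T' ∈ {T' | T'.Isomorphic T}ᶜ from hF T' hT')]

theorem exists_of_prob_pos {d t : ℝ} {ℓ : ℕ} {T : TypedTree ℓ} (h : 0 < T.prob d t) :
    ∃ T₀ : TypedTree ℓ, T₀.Isomorphic T ∧ treeProb d t T₀ ≠ 0 := by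
  by_contra! hcon
  rw [prob_eq_tsum] at h
  refine h.ne' ((tsum_congr fun T' => ?_).trans tsum_zero)
  by_cases hT' : T'.Isomorphic T
  · rw [Set.indicator_of_mem (show T' ∈ {T' | T'.Isomorphic T} from hT'), hcon T' hT']
  · exact Set.indicator_of_notMem (show T' ∉ {T' | T'.Isomorphic T} from hT') _

theorem valid_of_treeProb {d t : ℝ} (hd : 0 ≤ d) (ht0 : 0 ≤ t) (ht1 : t ≤ 1) {ℓ : ℕ}
    {T : TypedTree ℓ} (h : treeProb d t T ≠ 0) : T.Valid :=
  valid_of_galtonWatson hd ht0 ht1 fun h0 => h (by rw [treeProb, h0, ENNReal.toReal_zero])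

/-- If a finite family of trees carries almost all of the mass of the Galton-Watson law, and the
numbers of variables at which these trees are realized are not too small, then the number of
instances of a tree is close to its expectation. -/
theorem abs_numInstances_sub_le {d t : ℝ} {ℓ n m m' : ℕ} {T : TypedTree ℓ}
    (hT : ∃ T₀ : TypedTree ℓ, T₀.Isomorphic T ∧ T₀.Valid) {F : Finset (TypedTree ℓ)}
    (hFv : ∀ T' ∈ F, T'.Valid) {δ : ℝ} (hδ : 0 ≤ δ) (hF : 1 - δ ≤ ∑ T' ∈ F, treeProb d t T')
    (hn : 0 < n) (ω : Sample n m m')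
    (hlow : ∀ T' ∈ F, treeProb d t T' - δ / F.card ≤ realizedFraction T' ω)
    (hconf : ∀ T' ∈ F, ((conflictedRoots T' ω).ncard : ℝ) ≤ δ / F.card * n) :
    |(numInstances T ω : ℝ) - n * T.prob d t| ≤ 3 * δ * n := by
  classical
  have hn' : (0 : ℝ) < n := by exact_mod_cast hn
  set A := F.filter fun T' => T'.Isomorphic T
  set B := F.filter fun T' => ¬ T'.Isomorphic T
  have hAB : ∀ u : TypedTree ℓ → ℝ, ∑ T' ∈ A, u T' + ∑ T' ∈ B, u T' = ∑ T' ∈ F, u T' :=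
    fun u => Finset.sum_filter_add_sum_filter_not F _ u
  have hA1 : ∀ T' ∈ A, T'.Isomorphic T := fun T' h => (Finset.mem_filter.1 h).2
  have hB1 : ∀ T' ∈ B, ¬ T'.Isomorphic T := fun T' h => (Finset.mem_filter.1 h).2
  have hpA := sum_treeProb_le_prob d t T A hA1
  have hpB := sum_treeProb_le_one_sub_prob d t T B hB1
  have hp := hAB (treeProb d t)
  have hconst : ∀ G ⊆ F, ∑ _T' ∈ G, δ / (F.card : ℝ) ≤ δ := by
    intro G hG
    rw [Finset.sum_const, nsmul_eq_mul]
    rcases Nat.eq_zero_or_pos F.card with h0 | h0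
    · simpa [h0] using hδ
    · have h1 : (G.card : ℝ) ≤ F.card := by exact_mod_cast Finset.card_le_card hG
      have h2 : (0 : ℝ) < F.card := by exact_mod_cast h0
      rw [mul_div_left_comm]
      exact mul_le_of_le_one_right hδ (div_le_one_of_le₀ h1 h2.le)
  have hlow' : ∀ G ⊆ F, (∑ T' ∈ G, treeProb d t T' - δ) * n ≤
      ∑ T' ∈ G, ((realizedRoots T' ω).ncard : ℝ) := by
    intro G hG
    have h1 : ∑ T' ∈ G, treeProb d t T' - δ ≤ ∑ T' ∈ G, realizedFraction T' ω := by
      have h2 := Finset.sum_le_sum fun T' (h : T' ∈ G) => hlow T' (hG h)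
      rw [Finset.sum_sub_distrib] at h2
      linarith [hconst G hG]
    have h3 : ∑ T' ∈ G, ((realizedRoots T' ω).ncard : ℝ) =
        (∑ T' ∈ G, realizedFraction T' ω) * n := by
      rw [Finset.sum_mul]
      refine Finset.sum_congr rfl fun T' _ => ?_
      rw [realizedFraction, div_mul_cancel₀ _ hn'.ne']
    rw [h3]
    exact mul_le_mul_of_nonneg_right h1 hn'.le
  have hconf' : ∀ G ⊆ F, ∑ T' ∈ G, ((conflictedRoots T' ω).ncard : ℝ) ≤ δ * n := by
    intro G hG
    refine (Finset.sum_le_sum fun T' h => hconf T' (hG h)).trans ?_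
    rw [← Finset.sum_mul]
    exact mul_le_mul_of_nonneg_right (hconst G hG) hn'.le
  have hAF : A ⊆ F := Finset.filter_subset _ _
  have hBF : B ⊆ F := Finset.filter_subset _ _
  have h1 : ∑ T' ∈ A, ((realizedRoots T' ω).ncard : ℝ) ≤
      numInstances T ω + ∑ T' ∈ A, ((conflictedRoots T' ω).ncard : ℝ) := by
    exact_mod_cast le_numInstances T A hA1 ω
  have h2 : (numInstances T ω : ℝ) + ∑ T' ∈ B, ((realizedRoots T' ω).ncard : ℝ) ≤
      n + ∑ T' ∈ B, ((conflictedRoots T' ω).ncard : ℝ) := by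
    exact_mod_cast numInstances_le T hT B hB1 (fun T' h => hFv T' (hBF h)) ω
  have h3 := hlow' A hAF
  have h4 := hlow' B hBF
  have h5 := hconf' A hAF
  have h6 := hconf' B hBF
  -- On either side three errors of size `δ * n` add up: the mass outside `F`, the deficit in
  -- `hlow`, and the conflicted roots.
  have hA2 : T.prob d t - δ ≤ ∑ T' ∈ A, treeProb d t T' := by linarith
  have hB2 : 1 - T.prob d t - δ ≤ ∑ T' ∈ B, treeProb d t T' := by linarith
  have h7 := mul_le_mul_of_nonneg_right (sub_le_sub_right hA2 δ) hn'.le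
  have h8 := mul_le_mul_of_nonneg_right (sub_le_sub_right hB2 δ) hn'.le
  rw [abs_le]
  constructor <;> linarith

theorem uniformProb_iUnion_le {Ω ι : Type} [Fintype Ω] (F : Finset ι) (E : ι → Set Ω) :
    uniformProb (⋃ i ∈ F, E i) ≤ ∑ i ∈ F, uniformProb (E i) := by
  classical
  induction F using Finset.induction_on with
  | empty => simp [uniformProb]
  | insert i F hi ih =>
    rw [Finset.set_biUnion_insert, Finset.sum_insert hi]
    exact (uniformProb_union_le _ _).trans (add_le_add_right ih _)

/-- The number of instances of a tree is concentrated. -/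
theorem tendsto_uniformProb_numInstances {d t : ℝ} (hd0 : 0 ≤ d) (hd2 : d < 2) (ht0 : 0 ≤ t)
    (ht1 : t ≤ 1) {ℓ : ℕ} {M M' : ℕ → ℕ}
    (hM : Tendsto (fun n : ℕ => (M n : ℝ) / n) atTop (𝓝 (t * d / 2)))
    (hM' : Tendsto (fun n : ℕ => (M' n : ℝ) / n) atTop (𝓝 ((1 - t) * d / 2)))
    {T : TypedTree ℓ} (hT : 0 < T.prob d t) {ε : ℝ} (hε : 0 < ε) :
    Tendsto (fun n => uniformProb {ω : Sample n (M n) (M' n) |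
      ε * n < |(numInstances T ω : ℝ) - n * T.prob d t|}) atTop (𝓝 0) := by
  classical
  set δ := ε / 3 with hδ
  have hδ0 : 0 < δ := by positivity
  obtain ⟨F₀, hF₀⟩ := exists_finset_treeProb d t ℓ hδ0
  obtain ⟨T₀, hT₀, hT₀'⟩ := exists_of_prob_pos hT
  -- Dropping the trees of probability zero costs no mass and leaves valid trees only, as the upper
  -- bound requires.
  set F := F₀.filter fun T' => treeProb d t T' ≠ 0 with hF
  have hFsum : 1 - δ ≤ ∑ T' ∈ F, treeProb d t T' := by
    rw [Finset.sum_filter_ne_zero]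
    exact hF₀ F₀ subset_rfl
  have hFv : ∀ T' ∈ F, T'.Valid := fun T' h =>
    valid_of_treeProb hd0 ht0 ht1 (Finset.mem_filter.1 h).2
  -- The empty family, which can occur only for `δ ≥ 1`, is separated because `δ / F.card` is then 0
  -- and no positive tolerance.
  rcases F.eq_empty_or_nonempty with hFe | hFne
  · have hpos : ∀ n : ℕ, 0 < n → {ω : Sample n (M n) (M' n) |
        ε * n < |(numInstances T ω : ℝ) - n * T.prob d t|} = ∅ := by
      intro n hn
      refine Set.eq_empty_of_forall_notMem fun ω hω => ?_
      have := abs_numInstances_sub_le (d := d) (t := t)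
        ⟨T₀, hT₀, valid_of_treeProb hd0 ht0 ht1 hT₀'⟩ hFv hδ0.le hFsum hn ω
        (fun T' h => by simp [hFe] at h) (fun T' h => by simp [hFe] at h)
      have h2 : ε * n < |(numInstances T ω : ℝ) - n * T.prob d t| := hω
      rw [hδ] at this
      linarith
    refine tendsto_const_nhds.congr' ?_
    filter_upwards [eventually_gt_atTop 0] with n hn
    rw [hpos n hn]
    simp [uniformProb]
  · have hc : (0 : ℝ) < F.card := by exact_mod_cast hFne.card_pos
    have hη : 0 < δ / F.card := by positivity
    have hlim : Tendsto (fun n => ∑ T' ∈ F, (uniformProb {ω : Sample n (M n) (M' n) |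
        realizedFraction T' ω < treeProb d t T' - δ / F.card} +
        uniformProb {ω : Sample n (M n) (M' n) |
          δ / F.card * n ≤ (conflictedRoots T' ω).ncard})) atTop (𝓝 0) := by
      have := tendsto_finsetSum F fun T' _ =>
        (tendsto_uniformProb_lt hd0 ht0 ht1 hM hM' T' hη).add
          (tendsto_uniformProb_conflicted hd0 hd2 hM hM' T' hη)
      simpa using this
    refine squeeze_zero' (Eventually.of_forall fun n => uniformProb_nonneg _) ?_ hlim
    filter_upwards [eventually_gt_atTop 0] with n hn
    refine le_trans (uniformProb_mono ?_) ((uniformProb_iUnion_le F fun T' =>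
      {ω : Sample n (M n) (M' n) | realizedFraction T' ω < treeProb d t T' - δ / F.card} ∪
        {ω : Sample n (M n) (M' n) | δ / F.card * n ≤ (conflictedRoots T' ω).ncard}).trans
      (Finset.sum_le_sum fun T' _ => uniformProb_union_le _ _))
    intro ω hω
    by_contra hcon
    simp only [Set.mem_iUnion, Set.mem_union, not_exists, not_or] at hcon
    have := abs_numInstances_sub_le (d := d) (t := t)
      ⟨T₀, hT₀, valid_of_treeProb hd0 ht0 ht1 hT₀'⟩ hFv hδ0.le hFsum hn ω
      (fun T' h => not_lt.1 (hcon T' h).1) (fun T' h => (not_le.1 (hcon T' h).2).le)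
    have h2 : ε * n < |(numInstances T ω : ℝ) - n * T.prob d t| := hω
    rw [hδ] at this
    linarith

/-- Countably many sequences of events of vanishing probabilities can be avoided simultaneously,
each of them eventually. -/
theorem exists_events {Ω : ℕ → Type} [∀ n, Fintype (Ω n)] (hΩ : ∀ᶠ n in atTop, Nonempty (Ω n))
    {ι : Type} [Countable ι] (B : ι → (n : ℕ) → Set (Ω n))
    (hB : ∀ i, Tendsto (fun n => uniformProb (B i n)) atTop (𝓝 0)) :
    ∃ E : (n : ℕ) → Set (Ω n), Tendsto (fun n => uniformProb (E n)) atTop (𝓝 1) ∧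
      ∀ i, ∀ᶠ n in atTop, Disjoint (E n) (B i n) := by
  classical
  obtain ⟨e, he⟩ := exists_injective_nat ι
  let D : ℕ → (n : ℕ) → Set (Ω n) := fun k n => if h : ∃ i, e i = k then B h.choose n else ∅
  have hDe : ∀ i, D (e i) = B i := by
    intro i
    have hex : ∃ j, e j = e i := ⟨i, rfl⟩
    have hch : hex.choose = i := he hex.choose_spec
    funext n
    simp only [D, dif_pos hex, hch]
  have hD : ∀ k, Tendsto (fun n => uniformProb (D k n)) atTop (𝓝 0) := by
    intro k
    by_cases h : ∃ i, e i = k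
    · obtain ⟨i, rfl⟩ := h
      rw [hDe]
      exact hB i
    · have : ∀ n, D k n = ∅ := fun n => dif_neg h
      simp [this, uniformProb]
  let U : ℕ → (n : ℕ) → Set (Ω n) := fun K n => ⋃ k ∈ Finset.range K, D k n
  have hU : ∀ K, Tendsto (fun n => uniformProb (U K n)) atTop (𝓝 0) := by
    intro K
    refine squeeze_zero (fun n => uniformProb_nonneg _) (fun n => uniformProb_iUnion_le _ _) ?_
    simpa using tendsto_finsetSum (Finset.range K) fun k _ => hD k
  -- At stage `n` the first `κ n` bad events are avoided, with `κ n` as large as is compatible with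
  -- a union of probability at most `1 / (κ n + 1)`. The value 0 is always admissible, as the empty
  -- union has probability 0.
  let κ : ℕ → ℕ := fun n => Nat.findGreatest (fun K => uniformProb (U K n) ≤ 1 / (K + 1)) n
  have hκ : ∀ n, uniformProb (U (κ n) n) ≤ 1 / ((κ n : ℝ) + 1) := by
    intro n
    refine Nat.findGreatest_spec (P := fun K : ℕ => uniformProb (U K n) ≤ 1 / ((K : ℝ) + 1))
      (Nat.zero_le n) ?_
    simp [U, uniformProb]
  have hκtop : Tendsto κ atTop atTop := by
    rw [tendsto_atTop]
    intro K
    have hpos : (0 : ℝ) < 1 / (K + 1) := by positivity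
    filter_upwards [(hU K).eventually (gt_mem_nhds hpos), eventually_ge_atTop K] with n hn hKn
    exact Nat.le_findGreatest hKn hn.le
  refine ⟨fun n => (U (κ n) n)ᶜ, ?_, fun i => ?_⟩
  · have h1 : Tendsto (fun n => 1 / ((κ n : ℝ) + 1)) atTop (𝓝 0) :=
      tendsto_one_div_add_atTop_nhds_zero_nat.comp hκtop
    have h2 := (squeeze_zero (fun n => uniformProb_nonneg _) hκ h1).const_sub 1
    rw [sub_zero] at h2
    refine h2.congr' ?_
    filter_upwards [hΩ] with n hn
    exact (uniformProb_compl _).symm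
  · filter_upwards [hκtop.eventually_gt_atTop (e i)] with n hn
    rw [Set.disjoint_compl_left_iff_subset]
    intro ω hω
    rw [← hDe] at hω
    exact Set.mem_biUnion (Finset.mem_coe.2 (Finset.mem_range.2 hn)) hω

theorem nonempty_sample {n : ℕ} (hn : 2 ≤ n) (m m' : ℕ) : Nonempty (Sample n m m') :=
  ⟨fun _ => mkClause (⟨0, by omega⟩, 1) (⟨1, by omega⟩, 1) (by simp)⟩

theorem proposition2p4 (d t : ℝ) (hd0 : 0 < d) (hd2 : d < 2) (ht0 : 0 ≤ t) (ht1 : t ≤ 1)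
    (ℓ : ℕ) (hℓ : 0 < ℓ) (M M' : ℕ → ℕ)
    (hM : Tendsto (fun n : ℕ => (M n : ℝ) / n) atTop (𝓝 (t * d / 2)))
    (hM' : Tendsto (fun n : ℕ => (M' n : ℝ) / n) atTop (𝓝 ((1 - t) * d / 2))) :
    ∃ E : (n : ℕ) → Set (Sample n (M n) (M' n)),
      Tendsto (fun n => uniformProb (E n)) atTop (𝓝 1) ∧
      ∀ T : TypedTree ℓ, 0 < T.prob d t →
        ∀ ε : ℝ, 0 < ε → ∀ᶠ n : ℕ in atTop, ∀ ω ∈ E n,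
          |(numInstances T ω : ℝ) - n * T.prob d t| ≤ ε * (n * T.prob d t) := by
  obtain ⟨E, hE, hB⟩ := exists_events (Ω := fun n => Sample n (M n) (M' n))
    -- The second index stands for the absolute tolerance `1 / (k + 1)`. As `T.prob d t` is
    -- positive, some such tolerance lies below `ε * T.prob d t`.
    (ι := {T : TypedTree ℓ // 0 < T.prob d t} × ℕ)
    (eventually_atTop.2 ⟨2, fun n hn => nonempty_sample hn _ _⟩)
    (fun i n => {ω | 1 / ((i.2 : ℝ) + 1) * n < |(numInstances i.1.1 ω : ℝ) - n * i.1.1.prob d t|})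
    (fun i => tendsto_uniformProb_numInstances hd0.le hd2 ht0 ht1 hM hM' i.1.2
      Nat.one_div_pos_of_nat)
  refine ⟨E, hE, fun T hT ε hε => ?_⟩
  obtain ⟨k, hk⟩ := exists_nat_one_div_lt (mul_pos hε hT)
  filter_upwards [hB (⟨T, hT⟩, k)] with n hn ω hω
  have h0 : ¬ 1 / ((k : ℝ) + 1) * n < |(numInstances T ω : ℝ) - n * T.prob d t| :=
    Set.disjoint_left.1 hn hω
  have h1 := not_lt.1 h0
  refine h1.trans ?_
  have h2 := mul_le_mul_of_nonneg_right hk.le (Nat.cast_nonneg (α := ℝ) n)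
  refine h2.trans (le_of_eq ?_)
  ring

end
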